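/- Call $\rho:\mathbb{R}^d\to(0,\infty)$ an admissible density if $\rho$ is $C^\infty$, $\int\rho\,dx=1$, $\sup_x\|x\|^k\rho(x)<\infty$ for every $k\ge 0$, and $\log\rho$ together with its derivatives of order one and two grows at most polynomially. Let $p,q$ be admissible densities on $\mathbb{R}^d$, $d\ge 0$. Let $H_t=e^{tL}$, $t\ge0$, be the Langevin semigroup of $q$, that is, the strongly continuous Markov semigroup (positivity preserving, $H_t1=1$) on $L^2(q\,dx)$ whose generator is the closure of the operator $$L\varphi=\langle\nabla\log q,\nabla\varphi\rangle+\Delta\varphi,\qquad \varphi\in C_c^\infty(\mathbb{R}^d).$$ Let $p_t$ be the Langevin evolution of $p$, that is, the law at time $t$ of the Langevin dynamics for $q$ started from $X_0\sim p$: the measure $p_t(A)=\int (H_t1_A)(x)\,p(x)\,dx$ for Borel $A$ (so $p_t=q\,H_t(p/q)$ when $p/q\in L^2(q\,dx)$). Let $N(0,2t)$ be the centred Gaussian law on $\mathbb{R}^d$ with covariance matrix $2tI$, let $\ast$ denote convolution, and let $\mathrm{KL}$ be the Kullback--Leibler divergence. Then $\mathrm{KL}(p_t,q)$ and $\mathrm{KL}(p\ast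 N(0,2t),\,q\ast N(0,2t))$ are finite for every $t\ge0$, both are (right-)differentiable at $t=0$ with a finite derivative, and $$\frac{d}{dt}\mathrm{KL}(p_t,q)\Big|_{t=0}=\frac{d}{dt}\mathrm{KL}\big(p\ast N(0,2t),\,q\ast N(0,2t)\big)\Big|_{t=0}.$$ -/

import Mathlib

open MeasureTheory Filter Topology

/-- The space `ℝᵈ` with its Euclidean structure. -/
abbrev Eucl (d : ℕ) : Type := EuclideanSpace ℝ (Fin d)

/-- A strictly positive smooth probability density `ρ` on `ℝᵈ` that decays faster than every power
of `‖x‖`, and whose logarithm grows, together with its first and second derivatives, at most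
polynomially. -/
structure IsRapidDensity {d : ℕ} (ρ : Eucl d → ℝ) : Prop where
  smooth : ContDiff ℝ (⊤ : ℕ∞) ρ
  pos : ∀ x, 0 < ρ x
  integral_eq_one : ∫ x, ρ x = 1
  rapid_decay : ∀ k : ℕ, ∃ C : ℝ, ∀ x, ‖x‖ ^ k * ρ x ≤ C
  log_growth : ∀ j : ℕ, j ≤ 2 → ∃ (C : ℝ) (k : ℕ), ∀ x,
    ‖iteratedFDeriv ℝ j (fun y => Real.log (ρ y)) x‖ ≤ C * (1 + ‖x‖) ^ k

/-- The measure `ρ(x) dx`. -/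
noncomputable def densityMeasure {d : ℕ} (ρ : Eucl d → ℝ) : Measure (Eucl d) :=
  (volume : Measure (Eucl d)).withDensity (fun x => ENNReal.ofReal (ρ x))

/-- The Langevin operator of `q`, `L φ = ⟨∇ log q, ∇ φ⟩ + Δ φ`. -/
noncomputable def langevinOp {d : ℕ} (q : Eucl d → ℝ) (φ : Eucl d → ℝ) (x : Eucl d) : ℝ :=
  inner ℝ (gradient (fun y => Real.log (q y)) x) (gradient φ x) + Laplacian.laplacian φ x

/-- The graph in `L²(q) × L²(q)` of the Langevin operator on the space `C_c^∞(ℝᵈ)`. -/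
def langevinGraph {d : ℕ} (q : Eucl d → ℝ) :
    Set (Lp ℝ 2 (densityMeasure q) × Lp ℝ 2 (densityMeasure q)) :=
  {w | ∃ φ : Eucl d → ℝ, ContDiff ℝ (⊤ : ℕ∞) φ ∧ HasCompactSupport φ ∧
    w.1 =ᵐ[densityMeasure q] φ ∧ w.2 =ᵐ[densityMeasure q] langevinOp q φ}

/-- `H` is the Langevin semigroup `H_t = e^{tL}` of `q`: the strongly continuous Markov semigroup
on `L²(q)` whose infinitesimal generator is the closure of the Langevin operator on `C_c^∞(ℝᵈ)`.
Only the values `H t` with `t ≥ 0` matter. -/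
structure IsLangevinSemigroup {d : ℕ} (q : Eucl d → ℝ)
    (H : ℝ → Lp ℝ 2 (densityMeasure q) →L[ℝ] Lp ℝ 2 (densityMeasure q)) : Prop where
  map_zero : ∀ u, H 0 u = u
  map_add : ∀ s t : ℝ, 0 ≤ s → 0 ≤ t → ∀ u, H (s + t) u = H s (H t u)
  continuous : ∀ u, Tendsto (fun t : ℝ => H t u) (𝓝[>] 0) (𝓝 u)
  positive : ∀ t : ℝ, 0 ≤ t → ∀ u, 0 ≤ u → 0 ≤ H t u
  map_one : ∀ t : ℝ, 0 ≤ t → ∀ u : Lp ℝ 2 (densityMeasure q),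
    u =ᵐ[densityMeasure q] (fun _ => (1 : ℝ)) → H t u =ᵐ[densityMeasure q] (fun _ => (1 : ℝ))
  generator : ∀ u v : Lp ℝ 2 (densityMeasure q),
    Tendsto (fun t : ℝ => t⁻¹ • (H t u - u)) (𝓝[>] 0) (𝓝 v) ↔ (u, v) ∈ closure (langevinGraph q)

/-- `P t`, `t ≥ 0`, is the law at time `t` of the Markov process with semigroup `H` started from
the density `p`, that is, `P_t(A) = ∫ (H_t 1_A)(x) p(x) dx` for every Borel set `A`.
By symmetry of `H_t`, `P_t` has the density `q · H_t (p / q)` when `p / q ∈ L²(q)`. -/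
def IsLangevinEvolution {d : ℕ} (p q : Eucl d → ℝ)
    (H : ℝ → Lp ℝ 2 (densityMeasure q) →L[ℝ] Lp ℝ 2 (densityMeasure q))
    (P : ℝ → Measure (Eucl d)) : Prop :=
  ∀ t : ℝ, 0 ≤ t → ∀ A : Set (Eucl d), MeasurableSet A →
    ∀ u : Lp ℝ 2 (densityMeasure q), u =ᵐ[densityMeasure q] A.indicator (fun _ => (1 : ℝ)) →
      P t A = ENNReal.ofReal (∫ x, H t u x * p x)

/-- The measure `p ∗ N(0, 2t)` (where `N(0, 2t)` has covariance matrix `2t · I`), for `t ≥ 0`. -/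
noncomputable def addNoise {d : ℕ} (p : Eucl d → ℝ) (t : ℝ) : Measure (Eucl d) :=
  (densityMeasure p).conv
    (ProbabilityTheory.multivariateGaussian 0 ((2 * t) • (1 : Matrix (Fin d) (Fin d) ℝ)))

/-!
Both derivatives equal minus the relative Fisher information `fisherInfo p q`, that is,
`-∫ ‖∇ log (p / q)‖² dp`.

**Langevin side.** The hypotheses describe the semigroup `H` only through the Markov
property and its generator, with core `C_c^∞`, and give no regularity of `q · H_t (p / q)`, so the
divergence is never differentiated under the integral sign. Instead its two variational bounds are
expanded to first order in `t`.

* Lower bound. For bounded `g`, `KL(p_t, q) ≥ ∫ g dp_t + 1 - ∫ e^g dq` (`le_toReal_klDiv`). This is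
  applied to `g = χ_R log (p / q)`, where `χ_R` is a cutoff at radius `R`; the loss at `t = 0` is
  smaller than any power of `R⁻¹`. Short-time bounds for `∫ g dp_t = ∫ (H_t g) p dx` come from
  integrating the semigroup equation twice (`IsLangevinSemigroup.exists_le_apply`). Derivatives of
  `log p` and `log q` of order three and four have no growth bound, so `L g` is replaced by a
  smooth minorant (`dissipationMinorant`) that involves them only on a fixed ball. The error is
  then polynomial in `R`, and `R` is chosen as a small negative power of `t`
  (`IsLangevinEvolution.exists_le_toReal_klDiv`).
* Upper bound. If `H_t e^g ≤ e^k` then `KL(p_t, q) ≤ KL(p, q) - ∫ g dp + ∫ k dp_t`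
  (`IsLangevinEvolution.klDiv_le`); this rests on the symmetry of `H_t`, Jensen's inequality, and the
  converse variational bound `klDiv_le_of_forall`. With `g = k = 0` it gives finiteness. For
  `g ∈ C_c^∞` and `k = g + t (L g + ‖∇g‖²) + O(t²)` it bounds the derivative by
  `∫ (2 L g + ‖∇g‖²) dp`, which equals `-fisherInfo p q` at `g = log (p / q)`; that function is
  reached by truncation.

**Heat side.** The density of `p ∗ N(0, 2t)` is `heat t p`. The integrand of the divergence is
differentiated pointwise, and the derivative is dominated uniformly in `t ∈ [0, 1]`: `heat t p` and
`heat t Δp` decay rapidly, `log (heat t p)` grows polynomially by Jensen's inequality, and so does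
`heat t Δq / heat t q` (`IsRapidDensity.exists_abs_heat_mul_le`). Integration by parts identifies
the derivative at `0` (`integral_heatIntegrandDeriv_zero`).
-/

/-! ### Partial derivatives and polynomial growth -/

/-- The `i`-th partial derivative `∂ᵢu`. -/
noncomputable def pd {d : ℕ} (i : Fin d) (u : Eucl d → ℝ) (x : Eucl d) : ℝ :=
  fderiv ℝ u x (EuclideanSpace.basisFun (Fin d) ℝ i)

section Calculus

variable {d : ℕ} {u v : Eucl d → ℝ} {x : Eucl d}

lemma ContDiff.pd (i : Fin d) (hu : ContDiff ℝ (⊤ : ℕ∞) u) : ContDiff ℝ (⊤ : ℕ∞) (pd i u) := by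
  unfold _root_.pd
  exact (hu.fderiv_right (m := (⊤ : ℕ∞)) (by simp)).clm_apply contDiff_const

lemma smooth_differentiable (hu : ContDiff ℝ (⊤ : ℕ∞) u) : Differentiable ℝ u :=
  hu.differentiable (by simp)

lemma pd_congr (i : Fin d) (h : u =ᶠ[𝓝 x] v) : pd i u x = pd i v x := by
  simp [pd, h.fderiv_eq]

lemma pd_add (i : Fin d) (hu : ContDiff ℝ (⊤ : ℕ∞) u) (hv : ContDiff ℝ (⊤ : ℕ∞) v) :
    pd i (fun y => u y + v y) = fun y => pd i u y + pd i v y := by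
  ext y
  simp [pd, fderiv_fun_add (smooth_differentiable hu y) (smooth_differentiable hv y)]

lemma pd_sub (i : Fin d) (hu : ContDiff ℝ (⊤ : ℕ∞) u) (hv : ContDiff ℝ (⊤ : ℕ∞) v) :
    pd i (fun y => u y - v y) = fun y => pd i u y - pd i v y := by
  ext y
  simp [pd, fderiv_fun_sub (smooth_differentiable hu y) (smooth_differentiable hv y)]

lemma pd_mul (i : Fin d) (hu : ContDiff ℝ (⊤ : ℕ∞) u) (hv : ContDiff ℝ (⊤ : ℕ∞) v) :
    pd i (fun y => u y * v y) = fun y => u y * pd i v y + pd i u y * v y := by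
  ext y
  simp [pd, fderiv_fun_mul (smooth_differentiable hu y) (smooth_differentiable hv y), mul_comm]

lemma pd_const (i : Fin d) (c : ℝ) : pd i (fun _ : Eucl d => c) = fun _ => 0 := by
  ext y; simp [pd]

lemma pd_exp (i : Fin d) (hu : ContDiff ℝ (⊤ : ℕ∞) u) :
    pd i (fun y => Real.exp (u y)) = fun y => Real.exp (u y) * pd i u y := by
  ext y
  simp [pd, fderiv_exp (smooth_differentiable hu y)]

lemma pd_comp_smul (i : Fin d) (hu : ContDiff ℝ (⊤ : ℕ∞) u) (c : ℝ) :
    pd i (fun y => u (c • y)) = fun y => c * pd i u (c • y) := by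
  ext y
  have h : HasFDerivAt (fun y => u (c • y)) ((fderiv ℝ u (c • y)).comp
      (c • ContinuousLinearMap.id ℝ (Eucl d))) y :=
    ((smooth_differentiable hu (c • y)).hasFDerivAt).comp y ((hasFDerivAt_id y).const_smul c)
  simp [pd, h.fderiv]

lemma iteratedFDeriv_one_eq_pd (i : Fin d) :
    pd i u x = iteratedFDeriv ℝ 1 u x ![EuclideanSpace.basisFun (Fin d) ℝ i] := by
  simp [pd]

lemma pd_pd_apply (hu : ContDiff ℝ (⊤ : ℕ∞) u) (i j : Fin d) :
    pd i (pd j u) x = fderiv ℝ (fderiv ℝ u) x (EuclideanSpace.basisFun (Fin d) ℝ i)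
      (EuclideanSpace.basisFun (Fin d) ℝ j) := by
  unfold pd
  have h : DifferentiableAt ℝ (fderiv ℝ u) x :=
    (hu.fderiv_right (m := (⊤ : ℕ∞)) (by simp)).differentiable (by simp) x
  rw [fderiv_clm_apply h (by fun_prop)]
  simp

lemma pd_pd_eq_iteratedFDeriv (hu : ContDiff ℝ (⊤ : ℕ∞) u) (i j : Fin d) :
    pd i (pd j u) x = iteratedFDeriv ℝ 2 u x
      ![EuclideanSpace.basisFun (Fin d) ℝ i, EuclideanSpace.basisFun (Fin d) ℝ j] := by
  rw [pd_pd_apply hu, iteratedFDeriv_two_apply]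
  simp

lemma laplacian_eq_sum_pd (hu : ContDiff ℝ (⊤ : ℕ∞) u) :
    Laplacian.laplacian u x = ∑ i, pd i (pd i u) x := by
  rw [InnerProductSpace.laplacian_eq_iteratedFDeriv_orthonormalBasis u
    (EuclideanSpace.basisFun (Fin d) ℝ)]
  simp only [pd_pd_eq_iteratedFDeriv hu]

lemma inner_gradient_eq_sum_pd :
    inner ℝ (gradient u x) (gradient v x) = ∑ i, pd i u x * pd i v x := by
  rw [← (EuclideanSpace.basisFun (Fin d) ℝ).sum_inner_mul_inner]
  refine Finset.sum_congr rfl fun i _ => ?_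
  rw [real_inner_comm (gradient v x)]
  simp only [gradient, InnerProductSpace.toDual_symm_apply, pd]

lemma langevinOp_eq_sum (q : Eucl d → ℝ) (hu : ContDiff ℝ (⊤ : ℕ∞) u) :
    langevinOp q u x =
      ∑ i, (pd i (fun y => Real.log (q y)) x * pd i u x + pd i (pd i u) x) := by
  rw [langevinOp, laplacian_eq_sum_pd hu, inner_gradient_eq_sum_pd, Finset.sum_add_distrib]

lemma langevinOp_congr (q : Eucl d → ℝ) (h : u =ᶠ[𝓝 x] v) :
    langevinOp q u x = langevinOp q v x := by
  rw [langevinOp, langevinOp, InnerProductSpace.laplacian_congr_nhds h |>.eq_of_nhds]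
  simp [gradient, h.fderiv_eq]

lemma langevinOp_sub (q : Eucl d → ℝ) (hu : ContDiff ℝ (⊤ : ℕ∞) u) (hv : ContDiff ℝ (⊤ : ℕ∞) v) :
    langevinOp q (fun y => u y - v y) x = langevinOp q u x - langevinOp q v x := by
  rw [langevinOp_eq_sum q hu, langevinOp_eq_sum q hv, langevinOp_eq_sum q (hu.sub hv),
    ← Finset.sum_sub_distrib]
  refine Finset.sum_congr rfl fun i _ => ?_
  rw [pd_sub i hu hv, pd_sub i (hu.pd i) (hv.pd i)]
  ring

lemma langevinOp_exp (q : Eucl d → ℝ) (hu : ContDiff ℝ (⊤ : ℕ∞) u) :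
    langevinOp q (fun y => Real.exp (u y)) x =
      Real.exp (u x) * (langevinOp q u x + ∑ i, pd i u x ^ 2) := by
  rw [langevinOp_eq_sum q hu, langevinOp_eq_sum q hu.exp, ← Finset.sum_add_distrib,
    Finset.mul_sum]
  refine Finset.sum_congr rfl fun i _ => ?_
  rw [pd_exp i hu, pd_mul i hu.exp (hu.pd i), pd_exp i hu]
  ring

/-- `u` is smooth, and `u` and its partial derivatives of order one and two are bounded by
`C (1 + ‖x‖) ^ k`. The constants are explicit so that the bound can be uniform over families. -/
structure Growth2 {d : ℕ} (C : ℝ) (k : ℕ) (u : Eucl d → ℝ) : Prop where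
  smooth : ContDiff ℝ (⊤ : ℕ∞) u
  bound : ∀ x, |u x| ≤ C * (1 + ‖x‖) ^ k
  bound_pd : ∀ i x, |pd i u x| ≤ C * (1 + ‖x‖) ^ k
  bound_pd_pd : ∀ i j x, |pd i (pd j u) x| ≤ C * (1 + ‖x‖) ^ k

lemma Growth2.nonneg {C : ℝ} {k : ℕ} (h : Growth2 C k u) : 0 ≤ C := by
  have := (abs_nonneg _).trans (h.bound 0)
  simpa using this

lemma poly_mono {C C' : ℝ} {k k' : ℕ} (hC : C ≤ C') (hC' : 0 ≤ C') (hk : k ≤ k') (x : Eucl d) :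
    C * (1 + ‖x‖) ^ k ≤ C' * (1 + ‖x‖) ^ k' :=
  mul_le_mul hC (pow_le_pow_right₀ (by linarith [norm_nonneg x]) hk) (by positivity) hC'

lemma Growth2.mono {C C' : ℝ} {k k' : ℕ} (h : Growth2 C k u) (hC : C ≤ C') (hk : k ≤ k') :
    Growth2 C' k' u where
  smooth := h.smooth
  bound x := (h.bound x).trans (poly_mono hC (h.nonneg.trans hC) hk x)
  bound_pd i x := (h.bound_pd i x).trans (poly_mono hC (h.nonneg.trans hC) hk x)
  bound_pd_pd i j x := (h.bound_pd_pd i j x).trans (poly_mono hC (h.nonneg.trans hC) hk x)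

lemma Growth2.sub {C C' : ℝ} {k : ℕ} (hu : Growth2 C k u) (hv : Growth2 C' k v) :
    Growth2 (C + C') k (fun y => u y - v y) where
  smooth := hu.smooth.sub hv.smooth
  bound x := by
    rw [add_mul]
    exact (abs_sub _ _).trans (add_le_add (hu.bound x) (hv.bound x))
  bound_pd i x := by
    rw [add_mul, pd_sub i hu.smooth hv.smooth]
    exact (abs_sub _ _).trans (add_le_add (hu.bound_pd i x) (hv.bound_pd i x))
  bound_pd_pd i j x := by
    rw [add_mul, pd_sub j hu.smooth hv.smooth, pd_sub i (hu.smooth.pd j) (hv.smooth.pd j)]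
    exact (abs_sub _ _).trans (add_le_add (hu.bound_pd_pd i j x) (hv.bound_pd_pd i j x))

lemma Growth2.mul {C C' : ℝ} {k k' : ℕ} (hu : Growth2 C k u) (hv : Growth2 C' k' v) :
    Growth2 (4 * (C * C')) (k + k') (fun y => u y * v y) := by
  have key : ∀ {a b : ℝ} {x : Eucl d}, |a| ≤ C * (1 + ‖x‖) ^ k → |b| ≤ C' * (1 + ‖x‖) ^ k' →
      |a * b| ≤ C * C' * (1 + ‖x‖) ^ (k + k') := by
    intro a b x ha hb
    rw [abs_mul, pow_add]
    calc |a| * |b| ≤ (C * (1 + ‖x‖) ^ k) * (C' * (1 + ‖x‖) ^ k') :=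
          mul_le_mul ha hb (abs_nonneg _) ((abs_nonneg _).trans ha)
      _ = _ := by ring
  refine ⟨hu.smooth.mul hv.smooth, fun x => ?_, fun i x => ?_, fun i j x => ?_⟩
  · have h1 := key (hu.bound x) (hv.bound x)
    linarith [abs_nonneg (u x * v x)]
  · rw [pd_mul i hu.smooth hv.smooth]
    have h1 := key (hu.bound x) (hv.bound_pd i x)
    have h2 := key (hu.bound_pd i x) (hv.bound x)
    have h3 := abs_add_le (u x * pd i v x) (pd i u x * v x)
    linarith [abs_nonneg (u x * pd i v x)]
  · rw [pd_mul j hu.smooth hv.smooth,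
      pd_add i (hu.smooth.mul (hv.smooth.pd j)) ((hu.smooth.pd j).mul hv.smooth),
      pd_mul i hu.smooth (hv.smooth.pd j), pd_mul i (hu.smooth.pd j) hv.smooth]
    have h1 := key (hu.bound x) (hv.bound_pd_pd i j x)
    have h2 := key (hu.bound_pd i x) (hv.bound_pd j x)
    have h3 := key (hu.bound_pd j x) (hv.bound_pd i x)
    have h4 := key (hu.bound_pd_pd i j x) (hv.bound x)
    have h5 := abs_add_le (u x * pd i (pd j v) x + pd i u x * pd j v x)
      (pd j u x * pd i v x + pd i (pd j u) x * v x)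
    have h6 := abs_add_le (u x * pd i (pd j v) x) (pd i u x * pd j v x)
    have h7 := abs_add_le (pd j u x * pd i v x) (pd i (pd j u) x * v x)
    linarith

lemma Growth2.abs_langevinOp_le {q : Eucl d → ℝ} {B C : ℝ} {k m : ℕ}
    (hq : Growth2 B m (fun y => Real.log (q y))) (hu : Growth2 C k u) (x : Eucl d) :
    |langevinOp q u x| ≤ d * (B * C + C) * (1 + ‖x‖) ^ (m + k) := by
  rw [langevinOp_eq_sum q hu.smooth]
  have hB := hq.nonneg
  have hC := hu.nonneg
  have h1 : (1 : ℝ) ≤ 1 + ‖x‖ := by linarith [norm_nonneg x]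
  refine (Finset.abs_sum_le_sum_abs _ _).trans ?_
  refine (Finset.sum_le_sum (g := fun _ => (B * C + C) * (1 + ‖x‖) ^ (m + k))
    fun i _ => ?_).trans ?_
  · refine (abs_add_le _ _).trans ?_
    rw [abs_mul, add_mul]
    refine add_le_add ?_ ((hu.bound_pd_pd i i x).trans ?_)
    · calc _ ≤ (B * (1 + ‖x‖) ^ m) * (C * (1 + ‖x‖) ^ k) :=
            mul_le_mul (hq.bound_pd i x) (hu.bound_pd i x) (abs_nonneg _)
              ((abs_nonneg _).trans (hq.bound_pd i x))
        _ = _ := by ring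
    · exact mul_le_mul_of_nonneg_left (pow_le_pow_right₀ h1 (by omega)) hC
  · simp [mul_assoc]

lemma exists_growth2_of_iteratedFDeriv (hu : ContDiff ℝ (⊤ : ℕ∞) u)
    (h : ∀ j : ℕ, j ≤ 2 → ∃ (C : ℝ) (k : ℕ), ∀ x,
      ‖iteratedFDeriv ℝ j u x‖ ≤ C * (1 + ‖x‖) ^ k) : ∃ C k, Growth2 C k u := by
  obtain ⟨C0, k0, h0⟩ := h 0 (by norm_num)
  obtain ⟨C1, k1, h1⟩ := h 1 (by norm_num)
  obtain ⟨C2, k2, h2⟩ := h 2 (by norm_num)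
  have key : ∀ {C : ℝ} {k : ℕ} (x : Eucl d), |C| ≤ |C0| + |C1| + |C2| → k ≤ k0 + k1 + k2 →
      C * (1 + ‖x‖) ^ k ≤ (|C0| + |C1| + |C2|) * (1 + ‖x‖) ^ (k0 + k1 + k2) :=
    fun x hC hk => poly_mono ((le_abs_self _).trans hC) (by positivity) hk x
  refine ⟨|C0| + |C1| + |C2|, k0 + k1 + k2, hu, fun x => ?_, fun i x => ?_, fun i j x => ?_⟩
  · refine le_trans ?_ ((h0 x).trans (key x ?_ (by omega)))
    · simp
    · linarith [abs_nonneg C1, abs_nonneg C2]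
  · refine le_trans ?_ ((h1 x).trans (key x ?_ (by omega)))
    · rw [iteratedFDeriv_one_eq_pd, ← Real.norm_eq_abs]
      refine ((iteratedFDeriv ℝ 1 u x).le_opNorm _).trans ?_
      simp
    · linarith [abs_nonneg C0, abs_nonneg C2]
  · refine le_trans ?_ ((h2 x).trans (key x ?_ (by omega)))
    · rw [pd_pd_eq_iteratedFDeriv hu, ← Real.norm_eq_abs]
      refine ((iteratedFDeriv ℝ 2 u x).le_opNorm _).trans ?_
      simp [Fin.prod_univ_two]
    · linarith [abs_nonneg C0, abs_nonneg C1]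

lemma ContDiff.langevinOp {q : Eucl d → ℝ} (hq : ContDiff ℝ (⊤ : ℕ∞) (fun y => Real.log (q y)))
    (hu : ContDiff ℝ (⊤ : ℕ∞) u) : ContDiff ℝ (⊤ : ℕ∞) (langevinOp q u) := by
  have : _root_.langevinOp q u = fun x =>
      ∑ i, (_root_.pd i (fun y => Real.log (q y)) x * _root_.pd i u x
        + _root_.pd i (_root_.pd i u) x) :=
    funext fun x => langevinOp_eq_sum q hu
  rw [this]
  exact ContDiff.sum fun i _ => ((hq.pd i).mul (hu.pd i)).add ((hu.pd i).pd i)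

lemma HasCompactSupport.langevinOp (q : Eucl d → ℝ) (hu : HasCompactSupport u) :
    HasCompactSupport (langevinOp q u) := by
  refine HasCompactSupport.intro hu fun x hx => ?_
  have h : u =ᶠ[𝓝 x] fun _ => 0 := notMem_tsupport_iff_eventuallyEq.1 hx
  rw [langevinOp_congr q h]
  simp [_root_.langevinOp, gradient]

lemma HasCompactSupport.exists_abs_le (hu : HasCompactSupport u) (hc : Continuous u) :
    ∃ C, 0 ≤ C ∧ ∀ x, |u x| ≤ C := by
  obtain ⟨C, hC⟩ := hu.exists_bound_of_continuous hc
  exact ⟨C, (norm_nonneg _).trans (hC 0), hC⟩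

/-- A smooth compactly supported function has bounded derivatives. -/
lemma HasCompactSupport.exists_growth2 (hu : HasCompactSupport u) (hs : ContDiff ℝ (⊤ : ℕ∞) u) :
    ∃ C, Growth2 C 0 u := by
  obtain ⟨C, k, h⟩ := exists_growth2_of_iteratedFDeriv hs fun j _ => by
    obtain ⟨C, hC⟩ := (hu.iteratedFDeriv (𝕜 := ℝ) j).exists_bound_of_continuous
      (hs.continuous_iteratedFDeriv (by exact_mod_cast le_top))
    exact ⟨C, 0, fun x => by simpa using hC x⟩
  obtain ⟨R, hR⟩ := hu.isBounded.exists_norm_le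
  have hle : ∀ x ∈ tsupport u, C * (1 + ‖x‖) ^ k ≤ C * (1 + |R|) ^ k := fun x hx => by
    have hC := h.nonneg
    gcongr
    exact (hR x hx).trans (le_abs_self R)
  have h0 : 0 ≤ C * (1 + |R|) ^ k := by have hC := h.nonneg; positivity
  have hz : ∀ x ∉ tsupport u, u =ᶠ[𝓝 x] fun _ => 0 := fun x hx =>
    notMem_tsupport_iff_eventuallyEq.1 hx
  refine ⟨C * (1 + |R|) ^ k, hs, fun x => ?_, fun i x => ?_, fun i j x => ?_⟩ <;>
    rw [pow_zero, mul_one] <;> by_cases hx : x ∈ tsupport u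
  · exact (h.bound x).trans (hle x hx)
  · rwa [image_eq_zero_of_notMem_tsupport hx, abs_zero]
  · exact (h.bound_pd i x).trans (hle x hx)
  · rwa [pd_congr i (hz x hx), pd_const, abs_zero]
  · exact (h.bound_pd_pd i j x).trans (hle x hx)
  · have h1 : _root_.pd j u =ᶠ[𝓝 x] fun _ => 0 := by
      filter_upwards [(hz x hx).eventuallyEq_nhds] with y hy
      rw [pd_congr j hy, pd_const]
    rwa [pd_congr i h1, pd_const, abs_zero]

end Calculus

/-! ### Rapidly decaying densities -/

section RapidDensity

variable {d : ℕ} {ρ : Eucl d → ℝ}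

namespace IsRapidDensity

lemma smooth_log (h : IsRapidDensity ρ) : ContDiff ℝ (⊤ : ℕ∞) (fun y => Real.log (ρ y)) :=
  h.smooth.log fun x => (h.pos x).ne'

lemma exists_growth2 (h : IsRapidDensity ρ) : ∃ C k, Growth2 C k (fun y => Real.log (ρ y)) :=
  exists_growth2_of_iteratedFDeriv h.smooth_log h.log_growth

lemma continuous (h : IsRapidDensity ρ) : Continuous ρ := h.smooth.continuous

lemma pd_eq (h : IsRapidDensity ρ) (i : Fin d) (x : Eucl d) :
    pd i ρ x = ρ x * pd i (fun y => Real.log (ρ y)) x := by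
  have hρ : (fun y => Real.exp (Real.log (ρ y))) = ρ := funext fun y => Real.exp_log (h.pos y)
  conv_lhs => rw [← hρ, pd_exp i h.smooth_log]
  simp only [Real.exp_log (h.pos x)]

lemma exists_bound (h : IsRapidDensity ρ) (k : ℕ) :
    ∃ C, 0 ≤ C ∧ ∀ x, (1 + ‖x‖) ^ k * ρ x ≤ C := by
  obtain ⟨C, hC⟩ := h.rapid_decay k
  obtain ⟨C0, hC0⟩ := h.rapid_decay 0
  refine ⟨2 ^ (k - 1) * (C0 + C), ?_, fun x => ?_⟩
  · have h1 := hC 0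
    have h2 := hC0 0
    have h3 := (h.pos 0).le
    have : 0 ≤ ‖(0 : Eucl d)‖ ^ k * ρ 0 := by positivity
    have : 0 ≤ ‖(0 : Eucl d)‖ ^ 0 * ρ 0 := by positivity
    have : 0 ≤ C0 + C := by linarith
    positivity
  · calc (1 + ‖x‖) ^ k * ρ x ≤ (2 ^ (k - 1) * (1 ^ k + ‖x‖ ^ k)) * ρ x :=
          mul_le_mul_of_nonneg_right (add_pow_le zero_le_one (norm_nonneg x) k) (h.pos x).le
      _ = 2 ^ (k - 1) * (‖x‖ ^ 0 * ρ x + ‖x‖ ^ k * ρ x) := by ring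
      _ ≤ _ := by gcongr <;> [exact hC0 x; exact hC x]

lemma integrable_pow_mul (h : IsRapidDensity ρ) (k : ℕ) :
    Integrable (fun x => (1 + ‖x‖) ^ k * ρ x) := by
  obtain ⟨C, -, hC⟩ := h.exists_bound (k + (d + 1))
  have h1 : Integrable (fun x : Eucl d => (1 + ‖x‖) ^ (-((d + 1 : ℕ) : ℝ))) :=
    integrable_one_add_norm (by simp)
  have hc := h.continuous
  refine (h1.const_mul C).mono' (by fun_prop) (Eventually.of_forall fun x => ?_)
  have h2 : 0 < 1 + ‖x‖ := by positivity
  have h3 := (h.pos x).le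
  rw [Real.norm_of_nonneg (by positivity), Real.rpow_neg h2.le, Real.rpow_natCast,
    ← div_eq_mul_inv, le_div_iff₀ (by positivity)]
  refine le_trans (le_of_eq ?_) (hC x)
  rw [pow_add]; ring

lemma integrable_mul (h : IsRapidDensity ρ) {F : Eucl d → ℝ} {C : ℝ} {k : ℕ}
    (hm : AEStronglyMeasurable F) (hF : ∀ x, |F x| ≤ C * (1 + ‖x‖) ^ k) :
    Integrable (fun x => F x * ρ x) := by
  refine ((h.integrable_pow_mul k).const_mul C).mono'
    (hm.mul h.continuous.aestronglyMeasurable) (Eventually.of_forall fun x => ?_)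
  rw [Real.norm_eq_abs, abs_mul, abs_of_pos (h.pos x), ← mul_assoc]
  exact mul_le_mul_of_nonneg_right (hF x) (h.pos x).le

lemma integrable (h : IsRapidDensity ρ) : Integrable ρ := by
  simpa using h.integrable_pow_mul 0

lemma integrable_mul_of_ae_bound (h : IsRapidDensity ρ) {F : Eucl d → ℝ} {C : ℝ}
    (hm : AEStronglyMeasurable F) (hF : ∀ᵐ x, |F x| ≤ C) :
    Integrable (fun x => F x * ρ x) := by
  refine (h.integrable.const_mul C).mono'
    (hm.mul h.continuous.aestronglyMeasurable) (hF.mono fun x hx => ?_)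
  rw [Real.norm_eq_abs, abs_mul, abs_of_pos (h.pos x)]
  exact mul_le_mul_of_nonneg_right hx (h.pos x).le

/-- Integrals of polynomially bounded functions vanishing on the ball of radius `R` are smaller than
any power of `R⁻¹`. -/
lemma exists_tail_bound (h : IsRapidDensity ρ) (k N : ℕ) :
    ∃ M, 0 ≤ M ∧ ∀ (R C : ℝ) (F : Eucl d → ℝ), 0 < R → 0 ≤ C →
      (∀ x, |F x| ≤ C * (1 + ‖x‖) ^ k) →
      (∀ x, ‖x‖ < R → F x = 0) → |∫ x, F x * ρ x| ≤ C * M / R ^ N := by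
  refine ⟨∫ x, (1 + ‖x‖) ^ (k + N) * ρ x, integral_nonneg fun x => ?_,
    fun R C F hR hC hF h0 => ?_⟩
  · have := (h.pos x).le
    positivity
  · have := norm_integral_le_of_norm_le (f := fun x => F x * ρ x)
      ((h.integrable_pow_mul (k + N)).const_mul (C / R ^ N)) (Eventually.of_forall fun x => ?_)
    · rw [integral_const_mul] at this
      rw [← Real.norm_eq_abs]
      refine this.trans (le_of_eq (by ring))
    · have h3 := (h.pos x).le
      rcases lt_or_ge ‖x‖ R with hx | hx
      · rw [h0 x hx, zero_mul, norm_zero]; positivity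
      · rw [Real.norm_eq_abs, abs_mul, abs_of_nonneg h3, ← mul_assoc]
        refine mul_le_mul_of_nonneg_right ((hF x).trans ?_) h3
        rw [pow_add, div_mul_eq_mul_div, le_div_iff₀ (by positivity), mul_assoc]
        gcongr
        linarith

/-- Green's formula for the Langevin operator of `ρ`: `∫ v (Lu) ρ = -∫ ⟨∇v, ∇u⟩ ρ`. -/
lemma integral_mul_langevinOp (h : IsRapidDensity ρ) {u v : Eucl d → ℝ} {C C' : ℝ} {k k' : ℕ}
    (hv : Growth2 C' k' v) (hu : Growth2 C k u) :
    ∫ x, v x * langevinOp ρ u x * ρ x = -∫ x, (∑ i, pd i v x * pd i u x) * ρ x := by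
  obtain ⟨A, m, ha⟩ := h.exists_growth2
  set a : Eucl d → ℝ := fun y => Real.log (ρ y) with hadef
  have int : ∀ {f g : Eucl d → ℝ} {C C' : ℝ} {k k' : ℕ}, Continuous f → Continuous g →
      (∀ x, |f x| ≤ C * (1 + ‖x‖) ^ k) → (∀ x, |g x| ≤ C' * (1 + ‖x‖) ^ k') →
      Integrable (fun x => f x * g x * ρ x) := by
    intro f g C C' k k' hf hg hfb hgb
    refine h.integrable_mul (C := C * C') (k := k + k') (hf.mul hg).aestronglyMeasurable
      fun x => ?_
    rw [abs_mul, pow_add]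
    calc |f x| * |g x| ≤ (C * (1 + ‖x‖) ^ k) * (C' * (1 + ‖x‖) ^ k') :=
          mul_le_mul (hfb x) (hgb x) (abs_nonneg _) ((abs_nonneg _).trans (hfb x))
      _ = _ := by ring
  have j1 : ∀ i, Integrable (fun x => v x * pd i (pd i u) x * ρ x) := fun i =>
    int hv.smooth.continuous ((hu.smooth.pd i).pd i).continuous hv.bound (hu.bound_pd_pd i i)
  have j3 : ∀ i, Integrable (fun x => (v x * pd i a x) * pd i u x * ρ x) := fun i => by
    refine int (C := C' * A) (k := k' + m)
      (hv.smooth.continuous.mul (ha.smooth.pd i).continuous) (hu.smooth.pd i).continuous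
      (fun x => ?_) (hu.bound_pd i)
    rw [abs_mul, pow_add]
    calc _ ≤ (C' * (1 + ‖x‖) ^ k') * (A * (1 + ‖x‖) ^ m) :=
          mul_le_mul (hv.bound x) (ha.bound_pd i x) (abs_nonneg _)
            ((abs_nonneg _).trans (hv.bound x))
      _ = _ := by ring
  have j4 : ∀ i, Integrable (fun x => pd i v x * pd i u x * ρ x) := fun i =>
    int (hv.smooth.pd i).continuous (hu.smooth.pd i).continuous (hv.bound_pd i) (hu.bound_pd i)
  have hpv : ∀ i, pd i (fun x => v x * ρ x) = fun x => (v x * pd i a x + pd i v x) * ρ x := by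
    intro i
    rw [pd_mul i hv.smooth h.smooth]
    ext x
    rw [h.pd_eq i]; ring
  have ibp : ∀ i, ∫ x, v x * pd i (pd i u) x * ρ x
      = -∫ x, (v x * pd i a x + pd i v x) * pd i u x * ρ x := by
    intro i
    have hdf : Differentiable ℝ (fun x => v x * ρ x) :=
      smooth_differentiable (hv.smooth.mul h.smooth)
    have e1 : ∀ x, fderiv ℝ (fun x => v x * ρ x) x (EuclideanSpace.basisFun (Fin d) ℝ i)
        = (v x * pd i a x + pd i v x) * ρ x := fun x => congrFun (hpv i) x
    have e2 : ∀ x, fderiv ℝ (pd i u) x (EuclideanSpace.basisFun (Fin d) ℝ i)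
        = pd i (pd i u) x := fun x => rfl
    have i2 := int hv.smooth.continuous (hu.smooth.pd i).continuous hv.bound (hu.bound_pd i)
    have := integral_mul_fderiv_eq_neg_fderiv_mul_of_integrable
      (μ := (volume : Measure (Eucl d)))
      (v := EuclideanSpace.basisFun (Fin d) ℝ i) (f := fun x => v x * ρ x) (g := pd i u)
      ?_ ?_ ?_ (fun x _ => hdf x) (fun x _ => smooth_differentiable (hu.smooth.pd i) x)
    · simp only [e1, e2] at this
      calc _ = _ := by congr 1; ext x; ring
        _ = _ := this
        _ = _ := by congr 2; ext x; ring
    · simp only [e1]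
      refine ((j3 i).add (j4 i)).congr (Eventually.of_forall fun x => ?_)
      simp; ring
    · simp only [e2]
      exact (j1 i).congr (Eventually.of_forall fun x => by ring)
    · exact i2.congr (Eventually.of_forall fun x => by ring)
  have lhs : ∀ x, v x * langevinOp ρ u x * ρ x = ∑ i, ((v x * pd i a x) * pd i u x * ρ x
      + v x * pd i (pd i u) x * ρ x) := fun x => by
    rw [langevinOp_eq_sum ρ hu.smooth, Finset.mul_sum, Finset.sum_mul]
    exact Finset.sum_congr rfl fun i _ => by simp only [hadef]; ring
  simp only [lhs, Finset.sum_mul]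
  rw [integral_finsetSum (f := fun i x => v x * pd i a x * pd i u x * ρ x
    + v x * pd i (pd i u) x * ρ x) _ fun i _ => (j3 i).add (j1 i),
    integral_finsetSum _ fun i _ => j4 i,
    ← Finset.sum_neg_distrib]
  refine Finset.sum_congr rfl fun i _ => ?_
  rw [integral_add (j3 i) (j1 i), ibp i]
  simp only [add_mul]
  rw [integral_add (j3 i) (j4 i)]
  ring

end IsRapidDensity

lemma densityMeasure_ae_iff (h : IsRapidDensity ρ) {P : Eucl d → Prop} :
    (∀ᵐ x ∂densityMeasure ρ, P x) ↔ ∀ᵐ x, P x := by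
  rw [densityMeasure, ae_withDensity_iff (by have := h.continuous; fun_prop)]
  simp [h.pos]

lemma densityMeasure_apply (h : IsRapidDensity ρ) {A : Set (Eucl d)} (hA : MeasurableSet A) :
    densityMeasure ρ A = ENNReal.ofReal (∫ x, A.indicator (fun _ => (1 : ℝ)) x * ρ x) := by
  rw [densityMeasure, withDensity_apply _ hA, ← ofReal_integral_eq_lintegral_ofReal
    h.integrable.integrableOn (Eventually.of_forall fun x => (h.pos x).le), ← integral_indicator hA]
  congr 2
  ext x
  by_cases hx : x ∈ A <;> simp [hx]

lemma isProbabilityMeasure_densityMeasure (h : IsRapidDensity ρ) :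
    IsProbabilityMeasure (densityMeasure ρ) :=
  ⟨by rw [densityMeasure_apply h MeasurableSet.univ]; simp [h.integral_eq_one]⟩

lemma integral_densityMeasure (h : IsRapidDensity ρ) (F : Eucl d → ℝ) :
    ∫ x, F x ∂densityMeasure ρ = ∫ x, F x * ρ x := by
  rw [densityMeasure, integral_withDensity_eq_integral_toReal_smul
    (by have := h.continuous; fun_prop) (by simp)]
  congr 1; ext x
  rw [ENNReal.toReal_ofReal (h.pos x).le, smul_eq_mul, mul_comm]

end RapidDensity

/-! ### Variational bounds for the Kullback-Leibler divergence -/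

section KL

open InformationTheory

/-- Young's inequality for the conjugate pair `klFun` and `exp - 1`. -/
lemma le_klFun {x : ℝ} (hx : 0 ≤ x) (g : ℝ) : x * g + 1 - Real.exp g ≤ klFun x := by
  rw [klFun_apply]
  rcases hx.eq_or_lt with rfl | hx
  · simp; positivity
  · have h1 := Real.log_le_sub_one_of_pos (x := Real.exp g / x) (by positivity)
    rw [Real.log_div (by positivity) hx.ne', Real.log_exp] at h1
    have h2 : x * (g - Real.log x) ≤ x * (Real.exp g / x - 1) :=
      mul_le_mul_of_nonneg_left h1 hx.le
    have h3 : x * (Real.exp g / x - 1) = Real.exp g - x := by field_simp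
    linarith

variable {α : Type*} [MeasurableSpace α] {μ ν : Measure α}

lemma integrable_of_abs_le [IsFiniteMeasure μ] {g : α → ℝ} {C : ℝ} (hg : Measurable g)
    (hC : ∀ x, |g x| ≤ C) : Integrable g μ :=
  Integrable.of_bound hg.aestronglyMeasurable C (Eventually.of_forall hC)

lemma abs_exp_le {x C : ℝ} (h : |x| ≤ C) : |Real.exp x| ≤ Real.exp C := by
  rw [Real.abs_exp]
  exact Real.exp_le_exp.2 ((le_abs_self x).trans h)

lemma integrable_rnDeriv_mul [IsFiniteMeasure μ] [IsFiniteMeasure ν] (hac : μ ≪ ν) {g : α → ℝ}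
    {C : ℝ} (hg : Measurable g) (hC : ∀ x, |g x| ≤ C) :
    Integrable (fun x => (μ.rnDeriv ν x).toReal * g x) ν :=
  (integrable_rnDeriv_smul_iff hac).2 (integrable_of_abs_le hg hC)

lemma integral_rnDeriv_mul_add [IsProbabilityMeasure μ] [IsProbabilityMeasure ν] (hac : μ ≪ ν)
    {g : α → ℝ} {C : ℝ} (hg : Measurable g) (hC : ∀ x, |g x| ≤ C) :
    ∫ x, ((μ.rnDeriv ν x).toReal * g x + 1 - Real.exp (g x)) ∂ν
      = ∫ x, g x ∂μ + 1 - ∫ x, Real.exp (g x) ∂ν := by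
  have h1 := integrable_rnDeriv_mul hac hg hC
  have h2 : Integrable (fun x => (μ.rnDeriv ν x).toReal * g x + 1) ν := h1.add (integrable_const 1)
  rw [integral_sub h2
    (integrable_of_abs_le hg.exp fun x => abs_exp_le (hC x)), integral_add h1 (integrable_const 1)]
  have := integral_rnDeriv_smul (f := g) hac
  simp only [smul_eq_mul] at this
  simp [this]

/-- Lower bound in the Donsker-Varadhan formula, in its linearised form
`∫ g dμ + 1 - ∫ e^g dν ≤ KL(μ, ν)`. -/
lemma le_toReal_klDiv [IsProbabilityMeasure μ] [IsProbabilityMeasure ν] (hfin : klDiv μ ν ≠ ⊤)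
    {g : α → ℝ} {C : ℝ} (hg : Measurable g) (hC : ∀ x, |g x| ≤ C) :
    ∫ x, g x ∂μ + 1 - ∫ x, Real.exp (g x) ∂ν ≤ (klDiv μ ν).toReal := by
  obtain ⟨hac, hint⟩ := klDiv_ne_top_iff.1 hfin
  rw [toReal_klDiv_eq_integral_klFun hac, ← integral_rnDeriv_mul_add hac hg hC]
  refine integral_mono (((integrable_rnDeriv_mul hac hg hC).add (integrable_const 1)).sub
    (integrable_of_abs_le hg.exp fun x => abs_exp_le (hC x)))
    ((integrable_klFun_rnDeriv_iff hac).2 hint) fun x => le_klFun ENNReal.toReal_nonneg _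

/-- The value `x` clipped to the interval `[1 / (n + 1), n + 1]`. -/
noncomputable def clip (n : ℕ) (x : ℝ) : ℝ := max ((n + 1 : ℝ)⁻¹) (min (n + 1) x)

lemma inv_le_clip (n : ℕ) (x : ℝ) : (n + 1 : ℝ)⁻¹ ≤ clip n x := le_max_left _ _

lemma clip_pos (n : ℕ) (x : ℝ) : 0 < clip n x := lt_of_lt_of_le (by positivity) (inv_le_clip n x)

lemma clip_le (n : ℕ) (x : ℝ) : clip n x ≤ n + 1 := by
  have : ((n : ℝ) + 1)⁻¹ ≤ 1 := inv_le_one_of_one_le₀ (by linarith [n.cast_nonneg (α := ℝ)])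
  exact max_le (by linarith [n.cast_nonneg (α := ℝ)]) (min_le_left _ _)

/-- Clipping moves `x` towards `1`, so `(x - clip n x) log (clip n x) ≥ 0`; the rest is `klFun`
evaluated at `clip n x`. -/
lemma clip_kl_nonneg (n : ℕ) (x : ℝ) :
    0 ≤ x * Real.log (clip n x) + 1 - clip n x := by
  have h0 := klFun_nonneg (clip_pos n x).le
  rw [klFun_apply] at h0
  suffices 0 ≤ (x - clip n x) * Real.log (clip n x) by linarith
  have hn : (1 : ℝ) ≤ n + 1 := by linarith [n.cast_nonneg (α := ℝ)]
  rcases le_total x ((n + 1 : ℝ)⁻¹) with h | h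
  · have : clip n x = (n + 1 : ℝ)⁻¹ := max_eq_left ((min_le_right _ _).trans h)
    rw [this]
    refine mul_nonneg_of_nonpos_of_nonpos (by linarith) ?_
    exact Real.log_nonpos (by positivity) (inv_le_one_of_one_le₀ hn)
  · rcases le_total x (n + 1) with h' | h'
    · have : clip n x = x := by rw [clip, min_eq_right h', max_eq_right h]
      simp [this]
    · have : clip n x = n + 1 := by
        rw [clip, min_eq_left h', max_eq_right]
        exact (inv_le_one_of_one_le₀ hn).trans hn
      rw [this]
      exact mul_nonneg (by linarith) (Real.log_nonneg hn)

lemma tendsto_clip_kl {x : ℝ} (hx : 0 ≤ x) :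
    Tendsto (fun n : ℕ => x * Real.log (clip n x) + 1 - clip n x) atTop (𝓝 (klFun x)) := by
  have hinv : Tendsto (fun n : ℕ => ((n : ℝ) + 1)⁻¹) atTop (𝓝 0) :=
    tendsto_inv_atTop_zero.comp (tendsto_natCast_atTop_atTop.atTop_add tendsto_const_nhds)
  have hle : ∀ᶠ n : ℕ in atTop, x ≤ n + 1 := by
    filter_upwards [tendsto_natCast_atTop_atTop.eventually_ge_atTop x] with n hn
    linarith
  rcases hx.eq_or_lt with rfl | hx
  · have : ∀ n : ℕ, clip n 0 = ((n : ℝ) + 1)⁻¹ := fun n => by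
      rw [clip, min_eq_right (by positivity), max_eq_left (by positivity)]
    simpa [this, klFun_zero] using hinv.const_sub 1
  · refine tendsto_const_nhds.congr' ?_
    filter_upwards [hle, hinv.eventually_le_const hx] with n h1 h2
    rw [clip, min_eq_right h1, max_eq_right h2, klFun_apply]

/-- Upper bound in the Donsker-Varadhan formula, in its linearised form: bounded test functions
suffice. The supremum is approached by `g = log (dμ/dν)`, clipped to a bounded function. -/
lemma klDiv_le_of_forall [IsProbabilityMeasure μ] [IsProbabilityMeasure ν] (hac : μ ≪ ν) {K : ℝ}
    (h : ∀ (g : α → ℝ) (C : ℝ), Measurable g → (∀ x, |g x| ≤ C) →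
      ∫ x, g x ∂μ + 1 - ∫ x, Real.exp (g x) ∂ν ≤ K) :
    klDiv μ ν ≠ ⊤ ∧ (klDiv μ ν).toReal ≤ K := by
  have hK : 0 ≤ K := by
    simpa using h (fun _ => 0) 0 measurable_const (by simp)
  suffices hle : klDiv μ ν ≤ ENNReal.ofReal K from
    ⟨ne_top_of_le_ne_top ENNReal.ofReal_ne_top hle, ENNReal.toReal_le_of_le_ofReal hK hle⟩
  rw [klDiv_eq_lintegral_klFun_of_ac hac]
  set f : α → ℝ := fun x => (μ.rnDeriv ν x).toReal with hf
  have hfm : Measurable f := by fun_prop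
  have hcm : ∀ n, Measurable fun x => clip n (f x) := fun n => by unfold clip; fun_prop
  set G : ℕ → α → ℝ := fun n x => f x * Real.log (clip n (f x)) + 1 - clip n (f x) with hG
  have hGm : ∀ n, Measurable (G n) := fun n =>
    ((hfm.mul (hcm n).log).add_const 1).sub (hcm n)
  have hle : ∀ n, ∫⁻ x, ENNReal.ofReal (G n x) ∂ν ≤ ENNReal.ofReal K := by
    intro n
    have hn : (1 : ℝ) ≤ n + 1 := by linarith [n.cast_nonneg (α := ℝ)]
    have hb : ∀ x, |Real.log (clip n (f x))| ≤ Real.log (n + 1) := fun x => by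
      refine abs_le.2 ⟨?_, Real.log_le_log (clip_pos _ _) (clip_le _ _)⟩
      rw [← Real.log_inv]
      exact Real.log_le_log (by positivity) (inv_le_clip _ _)
    have hexp : ∀ x, Real.exp (Real.log (clip n (f x))) = clip n (f x) := fun x =>
      Real.exp_log (clip_pos _ _)
    have h1 := integral_rnDeriv_mul_add hac (hcm n).log hb
    have h2 := h _ _ (hcm n).log hb
    have h3 : Integrable (fun x => (μ.rnDeriv ν x).toReal * Real.log (clip n (f x)) + 1
        - Real.exp (Real.log (clip n (f x)))) ν :=
      ((integrable_rnDeriv_mul hac (hcm n).log hb).add (integrable_const 1)).sub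
      (integrable_of_abs_le (μ := ν) (hcm n).log.exp fun x => abs_exp_le (hb x))
    simp only [hexp] at h1 h2 h3
    rw [← ofReal_integral_eq_lintegral_ofReal h3 (Eventually.of_forall fun x => clip_kl_nonneg _ _)]
    exact ENNReal.ofReal_le_ofReal (h1.trans_le h2)
  calc ∫⁻ x, ENNReal.ofReal (klFun (f x)) ∂ν
      = ∫⁻ x, liminf (fun n => ENNReal.ofReal (G n x)) atTop ∂ν := by
        refine lintegral_congr fun x => ?_
        exact ((ENNReal.continuous_ofReal.tendsto _).comp
          (tendsto_clip_kl ENNReal.toReal_nonneg)).liminf_eq.symm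
    _ ≤ liminf (fun n => ∫⁻ x, ENNReal.ofReal (G n x) ∂ν) atTop :=
        lintegral_liminf_le fun n => (hGm n).ennreal_ofReal
    _ ≤ ENNReal.ofReal K :=
        liminf_le_of_le (by isBoundedDefault) fun b hb => by
          obtain ⟨n, hn⟩ := hb.exists
          exact hn.trans (hle n)

/-- The Kullback-Leibler divergence of two measures with positive densities. -/
lemma klDiv_withDensity {ρ₁ ρ₂ : α → ℝ}
    [IsProbabilityMeasure (ν.withDensity fun x => .ofReal (ρ₁ x))]
    [IsProbabilityMeasure (ν.withDensity fun x => .ofReal (ρ₂ x))] [SigmaFinite ν]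
    (h₁ : Measurable ρ₁) (h₂ : Measurable ρ₂) (p₁ : ∀ x, 0 < ρ₁ x) (p₂ : ∀ x, 0 < ρ₂ x)
    (hint : Integrable (fun x => (Real.log (ρ₁ x) - Real.log (ρ₂ x)) * ρ₁ x) ν) :
    klDiv (ν.withDensity fun x => .ofReal (ρ₁ x)) (ν.withDensity fun x => .ofReal (ρ₂ x)) ≠ ⊤ ∧
    (klDiv (ν.withDensity fun x => .ofReal (ρ₁ x))
      (ν.withDensity fun x => .ofReal (ρ₂ x))).toReal
        = ∫ x, (Real.log (ρ₁ x) - Real.log (ρ₂ x)) * ρ₁ x ∂ν := by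
  set μ₁ := ν.withDensity fun x => ENNReal.ofReal (ρ₁ x) with hμ₁
  set μ₂ := ν.withDensity fun x => ENNReal.ofReal (ρ₂ x) with hμ₂
  have m₁ : Measurable fun x => ENNReal.ofReal (ρ₁ x) := h₁.ennreal_ofReal
  have m₂ : Measurable fun x => ENNReal.ofReal (ρ₂ x) := h₂.ennreal_ofReal
  have m₃ : Measurable fun x => ENNReal.ofReal (ρ₁ x / ρ₂ x) := (h₁.div h₂).ennreal_ofReal
  have e : μ₁ = μ₂.withDensity fun x => ENNReal.ofReal (ρ₁ x / ρ₂ x) := by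
    rw [hμ₂, ← withDensity_mul _ m₂ m₃]
    refine congrArg ν.withDensity (funext fun x => ?_)
    rw [Pi.mul_apply, ← ENNReal.ofReal_mul (p₂ x).le, mul_div_cancel₀ _ (p₂ x).ne']
  have hac : μ₁ ≪ μ₂ := by rw [e]; exact withDensity_absolutelyContinuous _ _
  have hr : μ₁.rnDeriv μ₂ =ᵐ[μ₁] fun x => ENNReal.ofReal (ρ₁ x / ρ₂ x) :=
    hac.ae_le (by rw [e]; exact Measure.rnDeriv_withDensity μ₂ m₃)
  have hl : llr μ₁ μ₂ =ᵐ[μ₁] fun x => Real.log (ρ₁ x) - Real.log (ρ₂ x) := by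
    filter_upwards [hr] with x hx
    rw [llr, hx, ENNReal.toReal_ofReal (div_pos (p₁ x) (p₂ x)).le,
      Real.log_div (p₁ x).ne' (p₂ x).ne']
  have hint' : Integrable (llr μ₁ μ₂) μ₁ := by
    rw [integrable_congr hl, hμ₁, integrable_withDensity_iff m₁ (by simp)]
    simpa [ENNReal.toReal_ofReal (p₁ _).le] using hint
  refine ⟨klDiv_ne_top hac hint', ?_⟩
  rw [toReal_klDiv_of_measure_eq hac (by simp), integral_congr_ae hl, hμ₁,
    integral_withDensity_eq_integral_toReal_smul m₁ (by simp)]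
  congr 1; ext x
  rw [ENNReal.toReal_ofReal (p₁ x).le, smul_eq_mul, mul_comm]

end KL

/-! ### Strongly continuous semigroups -/

/-- `T t`, `t ≥ 0`, is a strongly continuous semigroup of bounded operators. -/
structure IsC0Semigroup {X : Type*} [NormedAddCommGroup X] [NormedSpace ℝ X]
    (T : ℝ → X →L[ℝ] X) : Prop where
  map_zero : ∀ x, T 0 x = x
  map_add : ∀ s t : ℝ, 0 ≤ s → 0 ≤ t → ∀ x, T (s + t) x = T s (T t x)
  continuous : ∀ x, Tendsto (fun t : ℝ => T t x) (𝓝[>] 0) (𝓝 x)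

/-- `x` lies in the domain of the infinitesimal generator of `T`, and `y` is its image. -/
def IsGenerated {X : Type*} [NormedAddCommGroup X] [NormedSpace ℝ X]
    (T : ℝ → X →L[ℝ] X) (x y : X) : Prop :=
  Tendsto (fun t : ℝ => t⁻¹ • (T t x - x)) (𝓝[>] 0) (𝓝 y)

namespace IsC0Semigroup

section Banach

variable {X : Type*} [NormedAddCommGroup X] [NormedSpace ℝ X] {T : ℝ → X →L[ℝ] X}

lemma tendsto_zero (h : IsC0Semigroup T) (x : X) :
    Tendsto (fun t : ℝ => T t x) (𝓝[≥] 0) (𝓝 x) := by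
  rw [← Set.Ioi_insert, nhdsWithin_insert, tendsto_sup]
  refine ⟨?_, h.continuous x⟩
  rw [tendsto_pure_left]
  intro s hs
  rw [h.map_zero]
  exact mem_of_mem_nhds hs

/-- Local boundedness, by the uniform boundedness principle. -/
lemma exists_norm_le [CompleteSpace X] (h : IsC0Semigroup T) :
    ∃ δ > 0, ∃ M, 0 ≤ M ∧ ∀ t ∈ Set.Icc 0 δ, ‖T t‖ ≤ M := by
  by_contra! hcon
  choose t ht hlt using fun n : ℕ => hcon ((n : ℝ) + 1)⁻¹ (by positivity) n n.cast_nonneg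
  have h0 : Tendsto (fun n : ℕ => ((n : ℝ) + 1)⁻¹) atTop (𝓝 0) :=
    tendsto_inv_atTop_zero.comp (tendsto_natCast_atTop_atTop.atTop_add tendsto_const_nhds)
  have htn : Tendsto t atTop (𝓝[≥] 0) := by
    refine tendsto_nhdsWithin_iff.2 ⟨?_, Eventually.of_forall fun n => (ht n).1⟩
    exact squeeze_zero (fun n => (ht n).1) (fun n => (ht n).2) h0
  obtain ⟨C, hC⟩ := banach_steinhaus (g := fun n => T (t n)) fun x => by
    obtain ⟨C, hC⟩ := (Metric.isBounded_range_of_tendsto _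
      ((h.tendsto_zero x).comp htn)).exists_norm_le
    exact ⟨C, fun n => hC _ ⟨n, rfl⟩⟩
  obtain ⟨n, hn⟩ := exists_nat_gt C
  exact absurd (hC n) (not_le.2 (hn.trans (hlt n)))

variable {δ M : ℝ}

lemma norm_sub_le (h : IsC0Semigroup T) (hM : ∀ t ∈ Set.Icc 0 δ, ‖T t‖ ≤ M) (x : X) {s t : ℝ}
    (hs : s ∈ Set.Icc 0 δ) (ht : t ∈ Set.Icc 0 δ) :
    ‖T s x - T t x‖ ≤ M * ‖T |s - t| x - x‖ := by
  wlog hst : t ≤ s generalizing s t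
  · rw [norm_sub_rev, abs_sub_comm]
    exact this ht hs (le_of_not_ge hst)
  · rw [abs_of_nonneg (sub_nonneg.2 hst)]
    have : T s x = T t (T (s - t) x) := by
      rw [← h.map_add t (s - t) ht.1 (sub_nonneg.2 hst), add_sub_cancel]
    rw [this, ← map_sub]
    exact (T t).le_of_opNorm_le (hM t ht) _

lemma continuousOn (h : IsC0Semigroup T) (hM : ∀ t ∈ Set.Icc 0 δ, ‖T t‖ ≤ M) (x : X) :
    ContinuousOn (fun t => T t x) (Set.Icc 0 δ) := by
  intro t ht
  rw [ContinuousWithinAt, tendsto_iff_norm_sub_tendsto_zero]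
  refine squeeze_zero' (Eventually.of_forall fun s => norm_nonneg _)
    (eventually_mem_nhdsWithin.mono fun s hs => h.norm_sub_le hM x hs ht) ?_
  have h1 : Tendsto (fun s : ℝ => |s - t|) (𝓝[Set.Icc 0 δ] t) (𝓝[≥] 0) := by
    refine tendsto_nhdsWithin_iff.2 ⟨?_, Eventually.of_forall fun s => Set.mem_Ici.2 (abs_nonneg _)⟩
    have : Continuous fun s : ℝ => |s - t| := by fun_prop
    simpa using (this.tendsto t).mono_left nhdsWithin_le_nhds
  have h2 := (tendsto_iff_norm_sub_tendsto_zero.1 (h.tendsto_zero x)).comp h1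
  simpa using h2.const_mul M

lemma isGenerated_apply (h : IsC0Semigroup T) {x y : X} (hxy : IsGenerated T x y) {t : ℝ}
    (ht : 0 ≤ t) : IsGenerated T (T t x) (T t y) := by
  refine (((T t).continuous.tendsto y).comp hxy).congr' ?_
  filter_upwards [self_mem_nhdsWithin] with s (hs : 0 < s)
  simp only [Function.comp, map_smul, map_sub]
  rw [← h.map_add t s ht hs.le, ← h.map_add s t hs.le ht, add_comm]

lemma hasDerivWithinAt (h : IsC0Semigroup T) {x y : X} (hxy : IsGenerated T x y) {t : ℝ}
    (ht : 0 ≤ t) : HasDerivWithinAt (fun s => T s x) (T t y) (Set.Ici t) t := by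
  rw [← hasDerivWithinAt_Ioi_iff_Ici, hasDerivWithinAt_iff_tendsto_slope' (by simp)]
  have h1 : Tendsto (fun s : ℝ => s - t) (𝓝[>] t) (𝓝[>] 0) := by
    refine tendsto_nhdsWithin_iff.2
      ⟨?_, eventually_mem_nhdsWithin.mono fun s hs => Set.mem_Ioi.2 (sub_pos.2 hs)⟩
    have : Continuous fun s : ℝ => s - t := by fun_prop
    simpa using (this.tendsto t).mono_left nhdsWithin_le_nhds
  refine ((h.isGenerated_apply hxy ht).comp h1).congr' ?_
  filter_upwards [self_mem_nhdsWithin] with s (hs : t < s)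
  simp only [Function.comp, slope, vsub_eq_sub]
  rw [← h.map_add (s - t) t (sub_pos.2 hs).le ht, sub_add_cancel]

lemma hasDerivWithinAt_sub (h : IsC0Semigroup T) (hM : ∀ t ∈ Set.Icc 0 δ, ‖T t‖ ≤ M) {x y : X}
    (hxy : IsGenerated T x y) {s t : ℝ} (hs : s ∈ Set.Ico 0 t) (ht : t ≤ δ) :
    HasDerivWithinAt (fun s => T (t - s) x) (-T (t - s) y) (Set.Ici s) s := by
  rw [← hasDerivWithinAt_Ioi_iff_Ici, hasDerivWithinAt_iff_tendsto_slope' (by simp)]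
  have h1 : Tendsto (fun r : ℝ => r - s) (𝓝[>] s) (𝓝[>] 0) := by
    refine tendsto_nhdsWithin_iff.2
      ⟨?_, eventually_mem_nhdsWithin.mono fun r hr => Set.mem_Ioi.2 (sub_pos.2 hr)⟩
    have : Continuous fun r : ℝ => r - s := by fun_prop
    simpa using (this.tendsto s).mono_left nhdsWithin_le_nhds
  have hev : ∀ᶠ r in 𝓝[>] s, r ∈ Set.Ioc s t := Ioc_mem_nhdsGT hs.2
  have h2 : Tendsto (fun r : ℝ => t - r) (𝓝[>] s) (𝓝[Set.Icc 0 δ] (t - s)) := by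
    refine tendsto_nhdsWithin_iff.2 ⟨?_, hev.mono fun r hr => ⟨by linarith [hr.2], ?_⟩⟩
    · have : Continuous fun r : ℝ => t - r := by fun_prop
      exact (this.tendsto s).mono_left nhdsWithin_le_nhds
    · linarith [hr.1, hs.1]
  have h3 : Tendsto (fun r => T (t - r) y) (𝓝[>] s) (𝓝 (T (t - s) y)) :=
    (h.continuousOn hM y (t - s) ⟨by linarith [hs.2], by linarith [hs.1]⟩).tendsto.comp h2
  have h4 : Tendsto (fun r => T (t - r) ((r - s)⁻¹ • (T (r - s) x - x) - y)) (𝓝[>] s) (𝓝 0) := by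
    have h5 := (tendsto_iff_norm_sub_tendsto_zero.1 (hxy.comp h1)).const_mul M
    rw [mul_zero] at h5
    refine squeeze_zero_norm' (hev.mono fun r hr => ?_) h5
    exact (T (t - r)).le_of_opNorm_le
      (hM _ ⟨by linarith [hr.2], by linarith [hr.1, hs.1]⟩) _
  have h5 := (h4.add h3).neg
  rw [zero_add] at h5
  refine h5.congr' ?_
  filter_upwards [hev] with r hr
  have e : T (t - s) x = T (t - r) (T (r - s) x) := by
    rw [← h.map_add (t - r) (r - s) (by linarith [hr.2]) (by linarith [hr.1])]
    congr 2; ring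
  simp only [slope, vsub_eq_sub, map_sub, map_smul, e, smul_sub]
  abel

/-- A lower bound on the pairing of `T s y` with a functional, where `y` is the generator at `x`,
integrates to a lower bound for `T t x`. -/
lemma le_apply (h : IsC0Semigroup T) (hM : ∀ t ∈ Set.Icc 0 δ, ‖T t‖ ≤ M) {x y : X}
    (hxy : IsGenerated T x y) (l : X →L[ℝ] ℝ) {α β : ℝ}
    (hl : ∀ s ∈ Set.Icc 0 δ, α + s * β ≤ l (T s y)) {t : ℝ} (ht : t ∈ Set.Icc 0 δ) :
    l x + t * α + t ^ 2 / 2 * β ≤ l (T t x) := by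
  have hd : ∀ s ∈ Set.Ico 0 δ, HasDerivWithinAt (fun s => l x + s * α + s ^ 2 / 2 * β)
      (α + s * β) (Set.Ici s) s := fun s _ => by
    have h1 : HasDerivAt (fun s : ℝ => l x + s * α + s ^ 2 / 2 * β)
        (0 + 1 * α + (2 * s) / 2 * β) s :=
      (((hasDerivAt_const s (l x)).add ((hasDerivAt_id s).mul_const α))).add
        ((((hasDerivAt_pow 2 s).congr_deriv (by simp)).div_const 2).mul_const β)
    exact (h1.congr_deriv (by ring)).hasDerivWithinAt
  have := image_le_of_deriv_right_le_deriv_boundary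
    (f := fun s => l x + s * α + s ^ 2 / 2 * β) (f' := fun s => α + s * β) (a := 0) (b := δ)
    (B := fun s => l (T s x)) (B' := fun s => l (T s y)) (by fun_prop) hd
    (by simp [h.map_zero]) (l.continuous.comp_continuousOn (h.continuousOn hM x))
    (fun s hs => l.hasFDerivAt.comp_hasDerivWithinAt s (h.hasDerivWithinAt hxy hs.1))
    (fun s hs => hl s ⟨hs.1, hs.2.le⟩)
  exact this ht

end Banach

section Hilbert

variable {X : Type*} [NormedAddCommGroup X] [InnerProductSpace ℝ X] [CompleteSpace X]
  {T : ℝ → X →L[ℝ] X}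

/-- A strongly continuous semigroup with a symmetric, densely defined generator is symmetric. -/
lemma inner_symm (h : IsC0Semigroup T)
    (hsymm : ∀ x y x' y', IsGenerated T x y → IsGenerated T x' y' →
      inner ℝ y x' = inner ℝ x y')
    (hdense : Dense {x | ∃ y, IsGenerated T x y}) {t : ℝ} (ht : 0 ≤ t) (x x' : X) :
    inner ℝ (T t x) x' = inner ℝ x (T t x') := by
  obtain ⟨δ, hδ, M, -, hM⟩ := h.exists_norm_le
  have small : ∀ t ∈ Set.Icc 0 δ, ∀ x x', inner ℝ (T t x) x' = inner ℝ x (T t x') := by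
    intro t ht x x'
    refine isClosed_property (p := fun x => inner ℝ (T t x) x' = inner ℝ x (T t x'))
      hdense.denseRange_val (isClosed_eq (by fun_prop) (by fun_prop)) ?_ x
    rintro ⟨x, y, hxy⟩
    refine isClosed_property (p := fun x' => inner ℝ (T t x) x' = inner ℝ x (T t x'))
      hdense.denseRange_val (isClosed_eq (by fun_prop) (by fun_prop)) ?_ x'
    rintro ⟨x', y', hxy'⟩
    -- `s ↦ ⟨T s x, T (t - s) x'⟩` has vanishing right derivative.
    have hmaps : Set.MapsTo (fun s => t - s) (Set.Icc 0 t) (Set.Icc 0 δ) := fun s hs =>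
      ⟨by linarith [hs.2], by linarith [hs.1, ht.2]⟩
    have hc1 : ContinuousOn (fun s => T s x) (Set.Icc 0 t) :=
      (h.continuousOn hM x).mono (Set.Icc_subset_Icc_right ht.2)
    have hc2 : ContinuousOn (fun s => T (t - s) x') (Set.Icc 0 t) :=
      (h.continuousOn hM x').comp (by fun_prop) hmaps
    have := constant_of_has_deriv_right_zero (a := 0) (b := t)
      (f := fun s => (inner ℝ (T s x) (T (t - s) x') : ℝ)) (hc1.inner hc2) (fun s hs => by
        have h1 := (h.hasDerivWithinAt hxy hs.1).inner ℝ (h.hasDerivWithinAt_sub hM hxy' hs ht.2)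
        refine h1.congr_deriv ?_
        have h2 := hsymm _ _ _ _ (h.isGenerated_apply hxy hs.1)
          (h.isGenerated_apply hxy' (sub_nonneg.2 hs.2.le))
        rw [inner_neg_right, h2, neg_add_cancel]) t ⟨ht.1, le_rfl⟩
    simpa [h.map_zero] using this
  have large : ∀ n : ℕ, ∀ t ∈ Set.Icc 0 (n * δ), ∀ x x',
      inner ℝ (T t x) x' = inner ℝ x (T t x') := by
    intro n
    induction n with
    | zero => intro t ht x x'; exact small t ⟨ht.1, ht.2.trans (by simpa using hδ.le)⟩ x x'
    | succ n ih =>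
      intro t ht x x'
      rcases le_total t δ with h' | h'
      · exact small t ⟨ht.1, h'⟩ x x'
      · have hn : t - δ ∈ Set.Icc 0 (n * δ) := ⟨by linarith, by
          have := ht.2; push_cast at this; linarith⟩
        have e1 : T t x = T δ (T (t - δ) x) := by
          rw [← h.map_add _ _ hδ.le hn.1]; congr 2; ring
        have e2 : T t x' = T (t - δ) (T δ x') := by
          rw [← h.map_add _ _ hn.1 hδ.le]; congr 2; ring
        rw [e1, e2, small δ ⟨hδ.le, le_rfl⟩, ih _ hn]
  obtain ⟨n, hn⟩ := exists_nat_ge (t / δ)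
  exact large n t ⟨ht, by rwa [div_le_iff₀ hδ] at hn⟩ x x'

end Hilbert

end IsC0Semigroup

/-! ### The Langevin semigroup on bounded functions -/

section L2

variable {α : Type*} [MeasurableSpace α] {ν : Measure α}

/-- A measurable function that is bounded everywhere. -/
def IsBddMeas (g : α → ℝ) : Prop := Measurable g ∧ ∃ C, ∀ x, |g x| ≤ C

/-- The class of `g` in `L²(ν)` (zero if `g` is not square integrable). -/
noncomputable def lp2 (ν : Measure α) (g : α → ℝ) : Lp ℝ 2 ν :=
  open Classical in if h : MemLp g 2 ν then h.toLp g else 0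

lemma IsBddMeas.memLp [IsFiniteMeasure ν] {g : α → ℝ} (hg : IsBddMeas g) : MemLp g 2 ν := by
  obtain ⟨hm, C, hC⟩ := hg
  exact MemLp.of_bound hm.aestronglyMeasurable C (Eventually.of_forall hC)

lemma coeFn_lp2 [IsFiniteMeasure ν] {g : α → ℝ} (hg : IsBddMeas g) : lp2 ν g =ᵐ[ν] g := by
  rw [lp2, dif_pos hg.memLp]
  exact hg.memLp.coeFn_toLp

lemma isBddMeas_const (c : ℝ) : IsBddMeas (fun _ : α => c) :=
  ⟨measurable_const, |c|, fun _ => le_rfl⟩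

lemma IsBddMeas.add {f g : α → ℝ} (hf : IsBddMeas f) (hg : IsBddMeas g) :
    IsBddMeas (fun x => f x + g x) := by
  obtain ⟨hfm, C, hC⟩ := hf
  obtain ⟨hgm, D, hD⟩ := hg
  exact ⟨hfm.add hgm, C + D, fun x => (abs_add_le _ _).trans (add_le_add (hC x) (hD x))⟩

lemma IsBddMeas.const_mul {f : α → ℝ} (hf : IsBddMeas f) (c : ℝ) :
    IsBddMeas (fun x => c * f x) := by
  obtain ⟨hfm, C, hC⟩ := hf
  refine ⟨hfm.const_mul c, |c| * C, fun x => ?_⟩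
  rw [abs_mul]
  exact mul_le_mul_of_nonneg_left (hC x) (abs_nonneg _)

lemma IsBddMeas.sub {f g : α → ℝ} (hf : IsBddMeas f) (hg : IsBddMeas g) :
    IsBddMeas (fun x => f x - g x) := by
  simpa [sub_eq_add_neg] using hf.add (hg.const_mul (-1))

lemma IsBddMeas.exp {f : α → ℝ} (hf : IsBddMeas f) : IsBddMeas (fun x => Real.exp (f x)) := by
  obtain ⟨hfm, C, hC⟩ := hf
  exact ⟨hfm.exp, Real.exp C, fun x => abs_exp_le (hC x)⟩

lemma isBddMeas_indicator {A : Set α} (hA : MeasurableSet A) :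
    IsBddMeas (A.indicator fun _ => (1 : ℝ)) := by
  refine ⟨measurable_const.indicator hA, 1, fun x => ?_⟩
  by_cases hx : x ∈ A <;> simp [hx]

lemma lp2_add [IsFiniteMeasure ν] {f g : α → ℝ} (hf : IsBddMeas f) (hg : IsBddMeas g) :
    lp2 ν (fun x => f x + g x) = lp2 ν f + lp2 ν g := by
  apply Lp.ext
  filter_upwards [coeFn_lp2 (ν := ν) (hf.add hg), coeFn_lp2 (ν := ν) hf, coeFn_lp2 (ν := ν) hg,
    Lp.coeFn_add (lp2 ν f) (lp2 ν g)] with x h1 h2 h3 h4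
  rw [h1, h4, Pi.add_apply, h2, h3]

lemma lp2_const_mul [IsFiniteMeasure ν] {f : α → ℝ} (hf : IsBddMeas f) (c : ℝ) :
    lp2 ν (fun x => c * f x) = c • lp2 ν f := by
  apply Lp.ext
  filter_upwards [coeFn_lp2 (ν := ν) (hf.const_mul c), coeFn_lp2 (ν := ν) hf,
    Lp.coeFn_smul c (lp2 ν f)] with x h1 h2 h3
  rw [h1, h3, Pi.smul_apply, h2, smul_eq_mul]

lemma lp2_mono [IsFiniteMeasure ν] {f g : α → ℝ} (hf : IsBddMeas f) (hg : IsBddMeas g)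
    (h : f ≤ᵐ[ν] g) : lp2 ν f ≤ lp2 ν g := by
  rw [← Lp.coeFn_le]
  filter_upwards [coeFn_lp2 (ν := ν) hf, coeFn_lp2 (ν := ν) hg, h] with x h1 h2 h3
  rwa [h1, h2]

lemma inner_lp2 [IsFiniteMeasure ν] {f : α → ℝ} (hf : IsBddMeas f) (u : Lp ℝ 2 ν) :
    inner ℝ (lp2 ν f) u = ∫ x, f x * u x ∂ν := by
  rw [L2.inner_def]
  refine integral_congr_ae ?_
  filter_upwards [coeFn_lp2 (ν := ν) hf] with x hx
  rw [hx, RCLike.inner_apply, mul_comm]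
  simp

/-- The positive cone of `L²(ν)` is self-dual. -/
lemma lp_le_of_forall_inner [IsFiniteMeasure ν] {u v : Lp ℝ 2 ν}
    (h : ∀ w : Lp ℝ 2 ν, 0 ≤ w → inner ℝ w u ≤ (inner ℝ w v : ℝ)) : u ≤ v := by
  rw [← Lp.coeFn_le]
  refine ae_le_of_forall_setIntegral_le ((Lp.memLp u).integrable one_le_two)
    ((Lp.memLp v).integrable one_le_two) fun s hs hfin => ?_
  have := h (indicatorConstLp 2 hs hfin.ne 1) (by
    rw [← Lp.coeFn_nonneg]
    filter_upwards [indicatorConstLp_coeFn (p := 2) (hs := hs) (hμs := hfin.ne) (c := (1 : ℝ))]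
      with x hx
    rw [hx, Pi.zero_apply]
    exact Set.indicator_nonneg (fun _ _ => zero_le_one) x)
  rwa [L2.inner_indicatorConstLp_one, L2.inner_indicatorConstLp_one] at this

lemma inner_nonneg_of_nonneg [IsFiniteMeasure ν] {u w : Lp ℝ 2 ν} (hu : 0 ≤ u) (hw : 0 ≤ w) :
    0 ≤ (inner ℝ w u : ℝ) := by
  rw [L2.inner_def]
  refine integral_nonneg_of_ae ?_
  filter_upwards [(Lp.coeFn_nonneg u).2 hu, (Lp.coeFn_nonneg w).2 hw] with x h1 h2
  simp only [RCLike.inner_apply, Pi.zero_apply, conj_trivial] at *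
  positivity

/-- A lower bound on the time derivative of a semigroup on `L²` integrates to a lower bound on the
semigroup. -/
lemma IsC0Semigroup.le_of_isGenerated [IsFiniteMeasure ν] {T : ℝ → Lp ℝ 2 ν →L[ℝ] Lp ℝ 2 ν}
    (h : IsC0Semigroup T) {δ M : ℝ} (hM : ∀ t ∈ Set.Icc 0 δ, ‖T t‖ ≤ M) {x y a b : Lp ℝ 2 ν}
    (hxy : IsGenerated T x y) (hle : ∀ s ∈ Set.Icc 0 δ, a + s • b ≤ T s y) {t : ℝ}
    (ht : t ∈ Set.Icc 0 δ) : x + t • a + (t ^ 2 / 2) • b ≤ T t x := by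
  refine lp_le_of_forall_inner fun w hw => ?_
  have := h.le_apply hM hxy (innerSL ℝ w) (α := inner ℝ w a) (β := inner ℝ w b)
    (fun s hs => ?_) ht
  · simpa [inner_add_right, inner_smul_right] using this
  · have := inner_nonneg_of_nonneg (sub_nonneg.2 (hle s hs)) hw
    simpa [inner_add_right, inner_smul_right, inner_sub_right] using this

end L2

section Langevin

variable {d : ℕ} {q : Eucl d → ℝ}
  {H : ℝ → Lp ℝ 2 (densityMeasure q) →L[ℝ] Lp ℝ 2 (densityMeasure q)}

lemma isBddMeas_of_hasCompactSupport {φ : Eucl d → ℝ} (hs : ContDiff ℝ (⊤ : ℕ∞) φ)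
    (hc : HasCompactSupport φ) : IsBddMeas φ := by
  obtain ⟨C, -, hC⟩ := hc.exists_abs_le hs.continuous
  exact ⟨hs.continuous.measurable, C, hC⟩

lemma isBddMeas_langevinOp (hq : IsRapidDensity q) {φ : Eucl d → ℝ}
    (hs : ContDiff ℝ (⊤ : ℕ∞) φ) (hc : HasCompactSupport φ) : IsBddMeas (langevinOp q φ) :=
  isBddMeas_of_hasCompactSupport (hq.smooth_log.langevinOp hs) (hc.langevinOp q)

namespace IsLangevinSemigroup

lemma isC0Semigroup (hH : IsLangevinSemigroup q H) : IsC0Semigroup H :=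
  ⟨hH.map_zero, hH.map_add, hH.continuous⟩

lemma isGenerated (hq : IsRapidDensity q) (hH : IsLangevinSemigroup q H) {φ : Eucl d → ℝ}
    (hs : ContDiff ℝ (⊤ : ℕ∞) φ) (hc : HasCompactSupport φ) :
    IsGenerated H (lp2 _ φ) (lp2 _ (langevinOp q φ)) := by
  have := isProbabilityMeasure_densityMeasure hq
  exact (hH.generator _ _).2 (subset_closure ⟨φ, hs, hc,
    coeFn_lp2 (isBddMeas_of_hasCompactSupport hs hc), coeFn_lp2 (isBddMeas_langevinOp hq hs hc)⟩)

lemma langevinGraph_symm (hq : IsRapidDensity q)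
    {w w' : Lp ℝ 2 (densityMeasure q) × Lp ℝ 2 (densityMeasure q)}
    (hw : w ∈ langevinGraph q) (hw' : w' ∈ langevinGraph q) :
    inner ℝ w.2 w'.1 = (inner ℝ w.1 w'.2 : ℝ) := by
  obtain ⟨φ, hs, hc, h1, h2⟩ := hw
  obtain ⟨ψ, hs', hc', h1', h2'⟩ := hw'
  obtain ⟨C, hφ⟩ := hc.exists_growth2 hs
  obtain ⟨C', hψ⟩ := hc'.exists_growth2 hs'
  have e1 : inner ℝ w.2 w'.1 = ∫ x, ψ x * langevinOp q φ x * q x := by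
    rw [L2.inner_def, ← integral_densityMeasure hq]
    refine integral_congr_ae ?_
    filter_upwards [h2, h1'] with x hx hx'
    rw [hx, hx']; simp
  have e2 : inner ℝ w.1 w'.2 = ∫ x, φ x * langevinOp q ψ x * q x := by
    rw [L2.inner_def, ← integral_densityMeasure hq]
    refine integral_congr_ae ?_
    filter_upwards [h1, h2'] with x hx hx'
    rw [hx, hx']; simp [mul_comm]
  rw [e1, e2, hq.integral_mul_langevinOp hψ hφ, hq.integral_mul_langevinOp hφ hψ]
  simp only [mul_comm]

/-- Symmetry on `C_c^∞` passes to the closure, which is the generator. -/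
lemma symm (hq : IsRapidDensity q) (hH : IsLangevinSemigroup q H) {t : ℝ} (ht : 0 ≤ t)
    (u v : Lp ℝ 2 (densityMeasure q)) : inner ℝ (H t u) v = (inner ℝ u (H t v) : ℝ) := by
  have := isProbabilityMeasure_densityMeasure hq
  refine hH.isC0Semigroup.inner_symm (fun x y x' y' hxy hxy' => ?_) ?_ ht u v
  · have c1 : ∀ w' : Lp ℝ 2 (densityMeasure q) × Lp ℝ 2 (densityMeasure q),
        IsClosed {w : Lp ℝ 2 (densityMeasure q) × Lp ℝ 2 (densityMeasure q) |
          inner ℝ w.2 w'.1 = (inner ℝ w.1 w'.2 : ℝ)} := fun w' =>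
      isClosed_eq (by fun_prop) (by fun_prop)
    have c2 : IsClosed {w' : Lp ℝ 2 (densityMeasure q) × Lp ℝ 2 (densityMeasure q) |
        inner ℝ y w'.1 = (inner ℝ x w'.2 : ℝ)} := isClosed_eq (by fun_prop) (by fun_prop)
    have step : ∀ w' ∈ langevinGraph q, inner ℝ y w'.1 = (inner ℝ x w'.2 : ℝ) := fun w' hw' => by
      have := closure_minimal (fun w hw => by
        rw [Set.mem_ofPred]; exact langevinGraph_symm hq hw hw') (c1 w') ((hH.generator _ _).1 hxy)
      rwa [Set.mem_ofPred] at this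
    have := closure_minimal (fun w' hw' => by
      rw [Set.mem_ofPred]; exact step w' hw') c2 ((hH.generator _ _).1 hxy')
    rwa [Set.mem_ofPred] at this
  · refine (Lp.dense_hasCompactSupport_contDiff (F := ℝ) (μ := densityMeasure q)
      (p := 2) (by simp)).mono ?_
    rintro u ⟨φ, hu, hc, hs⟩
    have : u = lp2 _ φ :=
      Lp.ext (hu.trans (coeFn_lp2 (isBddMeas_of_hasCompactSupport hs hc)).symm)
    exact ⟨_, this ▸ hH.isGenerated hq hs hc⟩

lemma mono (hH : IsLangevinSemigroup q H) {t : ℝ} (ht : 0 ≤ t)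
    {u v : Lp ℝ 2 (densityMeasure q)} (h : u ≤ v) : H t u ≤ H t v := by
  have := hH.positive t ht (v - u) (sub_nonneg.2 h)
  rwa [map_sub, sub_nonneg] at this

lemma apply_const (hq : IsRapidDensity q) (hH : IsLangevinSemigroup q H) {t : ℝ} (ht : 0 ≤ t)
    (c : ℝ) : H t (lp2 _ fun _ => c) = lp2 _ fun _ => c := by
  have := isProbabilityMeasure_densityMeasure hq
  have h1 : H t (lp2 _ fun _ => 1) = lp2 _ fun _ => 1 :=
    Lp.ext ((hH.map_one t ht _ (coeFn_lp2 (isBddMeas_const 1))).trans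
      (coeFn_lp2 (isBddMeas_const 1)).symm)
  have h2 := lp2_const_mul (ν := densityMeasure q) (isBddMeas_const 1) c
  rw [mul_one] at h2
  rw [h2, map_smul, h1]

lemma abs_apply_le (hq : IsRapidDensity q) (hH : IsLangevinSemigroup q H) {t : ℝ} (ht : 0 ≤ t)
    {g : Eucl d → ℝ} {C : ℝ} (hg : Measurable g) (hC : ∀ x, |g x| ≤ C) :
    ∀ᵐ x, |H t (lp2 _ g) x| ≤ C := by
  have := isProbabilityMeasure_densityMeasure hq
  have hb : IsBddMeas g := ⟨hg, C, hC⟩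
  have h1 := hH.mono ht (lp2_mono (ν := densityMeasure q) hb (isBddMeas_const C)
    (Eventually.of_forall fun x => (abs_le.1 (hC x)).2))
  have h2 := hH.mono ht (lp2_mono (ν := densityMeasure q) (isBddMeas_const (-C)) hb
    (Eventually.of_forall fun x => (abs_le.1 (hC x)).1))
  rw [hH.apply_const hq ht] at h1 h2
  rw [← densityMeasure_ae_iff hq]
  filter_upwards [(Lp.coeFn_le _ _).2 h1, (Lp.coeFn_le _ _).2 h2,
    coeFn_lp2 (ν := densityMeasure q) (isBddMeas_const C),
    coeFn_lp2 (ν := densityMeasure q) (isBddMeas_const (-C))] with x h3 h4 h5 h6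
  rw [h5] at h3
  rw [h6] at h4
  exact abs_le.2 ⟨h4, h3⟩

/-- Short-time expansion in the sup norm: if `Lφ ≥ v` and `Lv ≥ -M` then
`H_t φ ≥ φ + t v - M t² / 2`. -/
lemma exists_le_apply (hq : IsRapidDensity q) (hH : IsLangevinSemigroup q H) :
    ∃ δ > 0, ∀ (φ v : Eucl d → ℝ) (M : ℝ), ContDiff ℝ (⊤ : ℕ∞) φ → HasCompactSupport φ →
      ContDiff ℝ (⊤ : ℕ∞) v → HasCompactSupport v → (∀ x, v x ≤ langevinOp q φ x) →
      (∀ x, -M ≤ langevinOp q v x) → ∀ t ∈ Set.Icc 0 δ,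
        ∀ᵐ x, φ x + t * v x - M * t ^ 2 / 2 ≤ H t (lp2 _ φ) x := by
  have := isProbabilityMeasure_densityMeasure hq
  obtain ⟨δ, hδ, B, -, hB⟩ := hH.isC0Semigroup.exists_norm_le
  refine ⟨δ, hδ, fun φ v M hφ hφc hv hvc h1 h2 t ht => ?_⟩
  have bφ := isBddMeas_of_hasCompactSupport hφ hφc
  have bv := isBddMeas_of_hasCompactSupport hv hvc
  have bLφ := isBddMeas_langevinOp hq hφ hφc
  have bLv := isBddMeas_langevinOp hq hv hvc
  have k1 : ∀ s ∈ Set.Icc 0 δ,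
      lp2 (densityMeasure q) (fun _ => -M) + s • (0 : Lp ℝ 2 (densityMeasure q))
      ≤ H s (lp2 (densityMeasure q) (langevinOp q v)) := fun s hs => by
    rw [smul_zero, add_zero, ← hH.apply_const hq hs.1]
    exact hH.mono hs.1 (lp2_mono (isBddMeas_const _) bLv (Eventually.of_forall h2))
  have k2 : ∀ s ∈ Set.Icc 0 δ, lp2 (densityMeasure q) v + s • lp2 (densityMeasure q) (fun _ => -M)
      ≤ H s (lp2 (densityMeasure q) (langevinOp q φ)) := fun s hs => by
    have := hH.isC0Semigroup.le_of_isGenerated hB (hH.isGenerated hq hv hvc) k1 hs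
    rw [smul_zero, add_zero] at this
    exact this.trans (hH.mono hs.1 (lp2_mono bv bLφ (Eventually.of_forall h1)))
  have k3 := hH.isC0Semigroup.le_of_isGenerated hB (hH.isGenerated hq hφ hφc) k2 ht
  rw [← lp2_const_mul bv, ← lp2_const_mul (isBddMeas_const _), ← lp2_add bφ (bv.const_mul t),
    ← lp2_add (bφ.add (bv.const_mul t)) ((isBddMeas_const _).const_mul _)] at k3
  rw [← densityMeasure_ae_iff hq]
  filter_upwards [(Lp.coeFn_le _ _).2 k3,
    coeFn_lp2 (ν := densityMeasure q) ((bφ.add (bv.const_mul t)).add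
    ((isBddMeas_const (-M)).const_mul (t ^ 2 / 2)))] with x hx hx'
  rw [hx'] at hx
  linarith

/-- Jensen's inequality for the Markov operator `H t`. -/
lemma exp_apply_le (hq : IsRapidDensity q) (hH : IsLangevinSemigroup q H) {t : ℝ} (ht : 0 ≤ t)
    {w : Eucl d → ℝ} (hw : IsBddMeas w) :
    ∀ᵐ x, Real.exp (H t (lp2 _ w) x) ≤ H t (lp2 _ fun x => Real.exp (w x)) x := by
  have := isProbabilityMeasure_densityMeasure hq
  -- The exponential is the supremum of its tangent lines at rational points `c`; countably many are
  -- taken so that the exceptional null sets can be combined.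
  have key : ∀ c : ℚ, ∀ᵐ x ∂densityMeasure q,
      Real.exp c * (H t (lp2 (densityMeasure q) w) x - c + 1)
      ≤ H t (lp2 (densityMeasure q) fun x => Real.exp (w x)) x := fun c => by
    have b1 : IsBddMeas fun x => Real.exp c * w x := hw.const_mul _
    have b2 : IsBddMeas fun _ : Eucl d => Real.exp c * (1 - c) := isBddMeas_const _
    have h1 := hH.mono ht (lp2_mono (ν := densityMeasure q) (b1.add b2) hw.exp
      (Eventually.of_forall fun x => by
      have h1 := Real.add_one_le_exp (w x - c)
      have h2 := mul_le_mul_of_nonneg_left h1 (Real.exp_pos c).le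
      rw [← Real.exp_add] at h2
      simp only [add_sub_cancel] at h2
      linarith))
    rw [lp2_add b1 b2, _root_.map_add, lp2_const_mul hw, map_smul, hH.apply_const hq ht,
      ← Lp.coeFn_le] at h1
    filter_upwards [h1, Lp.coeFn_add (Real.exp c • H t (lp2 (densityMeasure q) w))
      (lp2 (densityMeasure q) fun _ => Real.exp c * (1 - c)),
      Lp.coeFn_smul (Real.exp (c : ℝ)) (H t (lp2 (densityMeasure q) w)),
      coeFn_lp2 (ν := densityMeasure q) b2] with x h1 h2 h3 h4
    rw [h2, Pi.add_apply, h3, h4, Pi.smul_apply, smul_eq_mul] at h1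
    linarith
  rw [← densityMeasure_ae_iff hq]
  filter_upwards [ae_all_iff.2 key] with x hx
  set z := H t (lp2 (densityMeasure q) w) x
  have hcont : Continuous fun c : ℝ => Real.exp c * (z - c + 1) := by fun_prop
  have := Rat.isDenseEmbedding_coe_real.dense.induction
    (P := fun c => Real.exp c * (z - c + 1)
      ≤ H t (lp2 (densityMeasure q) fun x => Real.exp (w x)) x)
    (by rintro _ ⟨c, rfl⟩; exact hx c) (isClosed_le hcont continuous_const) z
  simpa using this

end IsLangevinSemigroup

end Langevin

/-! ### The law of the Langevin dynamics -/

section Evolution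

variable {d : ℕ} {p q : Eucl d → ℝ}
  {H : ℝ → Lp ℝ 2 (densityMeasure q) →L[ℝ] Lp ℝ 2 (densityMeasure q)} {P : ℝ → Measure (Eucl d)}

lemma IsRapidDensity.integrable_log_sub_mul (hp : IsRapidDensity p) (hq : IsRapidDensity q) :
    Integrable (fun x => (Real.log (p x) - Real.log (q x)) * p x) := by
  obtain ⟨A, k, ha⟩ := hp.exists_growth2
  obtain ⟨B, m, hb⟩ := hq.exists_growth2
  have h := (ha.mono le_rfl (le_max_left k m)).sub (hb.mono le_rfl (le_max_right k m))
  exact hp.integrable_mul h.smooth.continuous.aestronglyMeasurable h.bound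

lemma aestronglyMeasurable_lp (u : Lp ℝ 2 (densityMeasure q)) :
    AEStronglyMeasurable u (volume : Measure (Eucl d)) := by
  have h := Lp.stronglyMeasurable u
  exact h.aestronglyMeasurable

namespace IsLangevinSemigroup

lemma integrable_apply_mul (hp : IsRapidDensity p) (hq : IsRapidDensity q)
    (hH : IsLangevinSemigroup q H) {t : ℝ} (ht : 0 ≤ t) {g : Eucl d → ℝ} (hg : IsBddMeas g) :
    Integrable (fun x => H t (lp2 _ g) x * p x) := by
  obtain ⟨hm, C, hC⟩ := hg
  exact hp.integrable_mul_of_ae_bound (aestronglyMeasurable_lp _) (hH.abs_apply_le hq ht hm hC)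

lemma integral_apply_add (hp : IsRapidDensity p) (hq : IsRapidDensity q)
    (hH : IsLangevinSemigroup q H) {t : ℝ} (ht : 0 ≤ t) {f g : Eucl d → ℝ} (hf : IsBddMeas f)
    (hg : IsBddMeas g) :
    ∫ x, H t (lp2 _ fun x => f x + g x) x * p x
      = (∫ x, H t (lp2 _ f) x * p x) + ∫ x, H t (lp2 _ g) x * p x := by
  have := isProbabilityMeasure_densityMeasure hq
  rw [← integral_add (hH.integrable_apply_mul hp hq ht hf) (hH.integrable_apply_mul hp hq ht hg)]
  refine integral_congr_ae ?_
  rw [lp2_add hf hg, _root_.map_add]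
  filter_upwards [(densityMeasure_ae_iff hq).1
    (Lp.coeFn_add (H t (lp2 _ f)) (H t (lp2 _ g)))] with x hx
  rw [hx, Pi.add_apply, add_mul]

lemma integral_apply_const_mul (hq : IsRapidDensity q) {t : ℝ} {f : Eucl d → ℝ}
    (hf : IsBddMeas f) (c : ℝ) :
    ∫ x, H t (lp2 _ fun x => c * f x) x * p x = c * ∫ x, H t (lp2 _ f) x * p x := by
  have := isProbabilityMeasure_densityMeasure hq
  rw [← integral_const_mul]
  refine integral_congr_ae ?_
  rw [lp2_const_mul hf, map_smul]
  filter_upwards [(densityMeasure_ae_iff hq).1 (Lp.coeFn_smul c (H t (lp2 _ f)))] with x hx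
  rw [hx, Pi.smul_apply, smul_eq_mul, mul_assoc]

lemma integral_apply_sub (hp : IsRapidDensity p) (hq : IsRapidDensity q)
    (hH : IsLangevinSemigroup q H) {t : ℝ} (ht : 0 ≤ t) {f g : Eucl d → ℝ} (hf : IsBddMeas f)
    (hg : IsBddMeas g) :
    ∫ x, H t (lp2 _ fun x => f x - g x) x * p x
      = (∫ x, H t (lp2 _ f) x * p x) - ∫ x, H t (lp2 _ g) x * p x := by
  have h1 := hH.integral_apply_add hp hq ht hf (hg.const_mul (-1))
  rw [integral_apply_const_mul hq hg] at h1
  simpa [sub_eq_add_neg] using h1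

lemma abs_integral_apply_le (hp : IsRapidDensity p) (hq : IsRapidDensity q)
    (hH : IsLangevinSemigroup q H) {t : ℝ} (ht : 0 ≤ t) {g : Eucl d → ℝ} {C : ℝ}
    (hg : Measurable g) (hC : ∀ x, |g x| ≤ C) : |∫ x, H t (lp2 _ g) x * p x| ≤ C := by
  have h := norm_integral_le_of_norm_le (f := fun x => H t (lp2 _ g) x * p x)
    (hp.integrable.const_mul C) ((hH.abs_apply_le hq ht hg hC).mono fun x hx => by
      rw [Real.norm_eq_abs, abs_mul, abs_of_pos (hp.pos x)]
      exact mul_le_mul_of_nonneg_right hx (hp.pos x).le)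
  rwa [integral_const_mul, hp.integral_eq_one, mul_one] at h

lemma integral_apply_const (hp : IsRapidDensity p) (hq : IsRapidDensity q)
    (hH : IsLangevinSemigroup q H) {t : ℝ} (ht : 0 ≤ t) (c : ℝ) :
    ∫ x, H t (lp2 _ fun _ => c) x * p x = c := by
  have := isProbabilityMeasure_densityMeasure hq
  rw [hH.apply_const hq ht]
  have : ∫ x, lp2 (densityMeasure q) (fun _ => c) x * p x = ∫ x, c * p x := by
    refine integral_congr_ae ?_
    filter_upwards [(densityMeasure_ae_iff hq).1
      (coeFn_lp2 (ν := densityMeasure q) (isBddMeas_const c))] with x hx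
    rw [hx]
  rw [this, integral_const_mul, hp.integral_eq_one, mul_one]

end IsLangevinSemigroup

namespace IsLangevinEvolution

lemma apply_eq (hq : IsRapidDensity q) (hP : IsLangevinEvolution p q H P) {t : ℝ} (ht : 0 ≤ t)
    {A : Set (Eucl d)} (hA : MeasurableSet A) :
    P t A = ENNReal.ofReal (∫ x, H t (lp2 _ (A.indicator fun _ => 1)) x * p x) := by
  have := isProbabilityMeasure_densityMeasure hq
  exact hP t ht A hA _ (coeFn_lp2 (isBddMeas_indicator hA))

lemma isProbabilityMeasure (hp : IsRapidDensity p) (hq : IsRapidDensity q)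
    (hH : IsLangevinSemigroup q H) (hP : IsLangevinEvolution p q H P) {t : ℝ} (ht : 0 ≤ t) :
    IsProbabilityMeasure (P t) := by
  refine ⟨?_⟩
  rw [hP.apply_eq hq ht MeasurableSet.univ, Set.indicator_univ,
    hH.integral_apply_const hp hq ht, ENNReal.ofReal_one]

lemma absolutelyContinuous (hq : IsRapidDensity q) (hP : IsLangevinEvolution p q H P) {t : ℝ}
    (ht : 0 ≤ t) : P t ≪ densityMeasure q := by
  have := isProbabilityMeasure_densityMeasure hq
  refine Measure.AbsolutelyContinuous.mk fun A hA h0 => ?_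
  have h1 : ((0 : Lp ℝ 2 (densityMeasure q)) : Eucl d → ℝ)
      =ᵐ[densityMeasure q] A.indicator fun _ => (1 : ℝ) := by
    filter_upwards [Lp.coeFn_zero ℝ 2 (densityMeasure q), measure_eq_zero_iff_ae_notMem.1 h0]
      with x hx hxA
    rw [hx, Set.indicator_of_notMem hxA]; rfl
  rw [hP t ht A hA 0 h1, map_zero]
  have : ∫ x, (0 : Lp ℝ 2 (densityMeasure q)) x * p x = 0 := by
    rw [← integral_zero (Eucl d) ℝ]
    refine integral_congr_ae ?_
    filter_upwards [(densityMeasure_ae_iff hq).1 (Lp.coeFn_zero ℝ 2 (densityMeasure q))] with x hx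
    rw [hx]; simp
  rw [this, ENNReal.ofReal_zero]

lemma zero_eq (hp : IsRapidDensity p) (hq : IsRapidDensity q) (hH : IsLangevinSemigroup q H)
    (hP : IsLangevinEvolution p q H P) : P 0 = densityMeasure p := by
  have := isProbabilityMeasure_densityMeasure hq
  ext A hA
  rw [hP.apply_eq hq le_rfl hA, densityMeasure_apply hp hA, hH.map_zero]
  congr 1
  refine integral_congr_ae ?_
  filter_upwards [(densityMeasure_ae_iff hq).1
    (coeFn_lp2 (ν := densityMeasure q) (isBddMeas_indicator hA))] with x hx
  rw [hx]

lemma integral_simpleFunc (hp : IsRapidDensity p) (hq : IsRapidDensity q)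
    (hH : IsLangevinSemigroup q H) (hP : IsLangevinEvolution p q H P) {t : ℝ} (ht : 0 ≤ t)
    (s : SimpleFunc (Eucl d) ℝ) :
    IsBddMeas s ∧ ∫ x, s x ∂P t = ∫ x, H t (lp2 _ s) x * p x := by
  have := hP.isProbabilityMeasure hp hq hH ht
  have := isProbabilityMeasure_densityMeasure hq
  have hb : ∀ s : SimpleFunc (Eucl d) ℝ, IsBddMeas s := fun s =>
    ⟨s.measurable, s.exists_forall_norm_le⟩
  refine ⟨hb s, ?_⟩
  induction s using SimpleFunc.induction with
  | const c hA =>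
    rename_i A
    have e : ⇑(SimpleFunc.piecewise A hA (SimpleFunc.const (Eucl d) c)
        (SimpleFunc.const (Eucl d) 0)) = fun x => c * A.indicator (fun _ => (1 : ℝ)) x := by
      ext x
      by_cases hx : x ∈ A <;> simp [hx]
    rw [e, IsLangevinSemigroup.integral_apply_const_mul hq (isBddMeas_indicator hA),
      integral_const_mul]
    congr 1
    have h1 : ∫ x, A.indicator (fun _ => (1 : ℝ)) x ∂P t = (P t).real A :=
      integral_indicator_one hA
    rw [h1, Measure.real, hP.apply_eq hq ht hA, ENNReal.toReal_ofReal]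
    refine integral_nonneg_of_ae ?_
    have h2 : lp2 (densityMeasure q) (fun _ => 0) ≤
        lp2 (densityMeasure q) (A.indicator fun _ => (1 : ℝ)) :=
      lp2_mono (isBddMeas_const 0) (isBddMeas_indicator hA)
        (Eventually.of_forall fun x => Set.indicator_nonneg (fun _ _ => zero_le_one) x)
    have h3 := hH.mono ht h2
    rw [hH.apply_const hq ht] at h3
    filter_upwards [(densityMeasure_ae_iff hq).1 ((Lp.coeFn_le _ _).2 h3),
      (densityMeasure_ae_iff hq).1 (coeFn_lp2 (ν := densityMeasure q) (isBddMeas_const 0))]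
      with x h4 h5
    rw [h5] at h4
    exact mul_nonneg h4 (hp.pos x).le
  | add _ hf hg =>
    rename_i f g _
    have e : ⇑(f + g) = fun x => f x + g x := rfl
    have e' : ∀ x, (f + g) x = f x + g x := fun x => rfl
    obtain ⟨C, hC⟩ := (hb f).2
    obtain ⟨C', hC'⟩ := (hb g).2
    simp only [e']
    rw [e, hH.integral_apply_add hp hq ht (hb f) (hb g), ← hf, ← hg,
      integral_add (integrable_of_abs_le f.measurable hC) (integrable_of_abs_le g.measurable hC')]

/-- Bounded measurable functions are uniform limits of simple functions. -/
lemma _root_.IsBddMeas.exists_simpleFunc {α : Type*} [MeasurableSpace α] {g : α → ℝ}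
    (hg : IsBddMeas g) {ε : ℝ} (hε : 0 < ε) :
    ∃ s : SimpleFunc α ℝ, ∀ x, |g x - s x| ≤ ε := by
  obtain ⟨hm, C, hC⟩ := hg
  refine ⟨⟨fun x => ε * ⌊g x / ε⌋, fun y => ?_, ?_⟩, fun x => ?_⟩
  · have : Measurable fun x => ε * (⌊g x / ε⌋ : ℝ) := by fun_prop
    exact this (measurableSet_singleton y)
  · refine ((Set.finite_Icc ⌊-C / ε⌋ ⌊C / ε⌋).image fun n : ℤ => ε * (n : ℝ)).subset ?_
    rintro _ ⟨x, rfl⟩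
    refine ⟨⌊g x / ε⌋, ⟨Int.floor_le_floor ?_, Int.floor_le_floor ?_⟩, rfl⟩
    · exact div_le_div_of_nonneg_right (abs_le.1 (hC x)).1 hε.le
    · exact div_le_div_of_nonneg_right (abs_le.1 (hC x)).2 hε.le
  · have h1 : g x - ε * ⌊g x / ε⌋ = ε * Int.fract (g x / ε) := by
      rw [Int.fract, mul_sub, mul_div_cancel₀ _ hε.ne']
    change |g x - ε * ⌊g x / ε⌋| ≤ ε
    rw [h1, abs_of_nonneg (mul_nonneg hε.le (Int.fract_nonneg _))]
    exact mul_le_of_le_one_right hε.le (Int.fract_lt_one _).le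

/-- The defining formula of `P t` on Borel sets extends to bounded measurable functions. -/
lemma integral_eq (hp : IsRapidDensity p) (hq : IsRapidDensity q)
    (hH : IsLangevinSemigroup q H) (hP : IsLangevinEvolution p q H P) {t : ℝ} (ht : 0 ≤ t)
    {g : Eucl d → ℝ} (hg : IsBddMeas g) : ∫ x, g x ∂P t = ∫ x, H t (lp2 _ g) x * p x := by
  have := hP.isProbabilityMeasure hp hq hH ht
  refine eq_of_abs_sub_le_all fun ε hε => ?_
  obtain ⟨s, hs⟩ := hg.exists_simpleFunc (half_pos hε)
  obtain ⟨hsb, hse⟩ := hP.integral_simpleFunc hp hq hH ht s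
  have ig : Integrable g (P t) := integrable_of_abs_le hg.1 hg.2.choose_spec
  have is : Integrable s (P t) := integrable_of_abs_le hsb.1 hsb.2.choose_spec
  have h1 : |∫ x, g x ∂P t - ∫ x, s x ∂P t| ≤ ε / 2 := by
    rw [← integral_sub ig is, ← Real.norm_eq_abs]
    refine (norm_integral_le_of_norm_le_const (Eventually.of_forall hs)).trans ?_
    simp
  have h2 := hH.abs_integral_apply_le hp hq ht (hg.1.sub hsb.1) hs
  have h3 := hH.integral_apply_sub hp hq ht hg hsb
  rw [show (g - ⇑s) = fun x => g x - s x from rfl, h3, ← hse] at h2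
  have := abs_sub_le (∫ x, g x ∂P t) (∫ x, s x ∂P t) (∫ x, H t (lp2 _ g) x * p x)
  rw [abs_sub_comm (∫ x, s x ∂P t)] at this
  linarith

/-- Refined data-processing inequality: if `H_t e^g ≤ e^k`, then
`KL(p_t, q) ≤ KL(p, q) - ∫ g dp + ∫ k dp_t`. For `g = k = 0` this is the data-processing
inequality; in general it accounts for the divergence of the backward transition kernels. -/
lemma klDiv_le (hp : IsRapidDensity p) (hq : IsRapidDensity q)
    (hH : IsLangevinSemigroup q H) (hP : IsLangevinEvolution p q H P) {t : ℝ} (ht : 0 ≤ t)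
    {g k : Eucl d → ℝ} (hg : IsBddMeas g) (hk : IsBddMeas k)
    (hgk : ∀ᵐ x, H t (lp2 _ fun x => Real.exp (g x)) x ≤ Real.exp (k x)) :
    InformationTheory.klDiv (P t) (densityMeasure q) ≠ ⊤ ∧
    (InformationTheory.klDiv (P t) (densityMeasure q)).toReal ≤
      (∫ x, (Real.log (p x) - Real.log (q x)) * p x) - (∫ x, g x * p x)
        + ∫ x, H t (lp2 _ k) x * p x := by
  have := hP.isProbabilityMeasure hp hq hH ht
  have := isProbabilityMeasure_densityMeasure hq
  refine klDiv_le_of_forall (hP.absolutelyContinuous hq ht) fun h C hm hC => ?_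
  have hh : IsBddMeas h := ⟨hm, C, hC⟩
  have hw : IsBddMeas fun x => h x - k x := hh.sub hk
  rw [hP.integral_eq hp hq hH ht hh, integral_densityMeasure hq]
  have e1 := hH.integral_apply_sub hp hq ht hh hk
  set w : Eucl d → ℝ := fun x => h x - k x with hwdef
  set Hw : Eucl d → ℝ := ⇑(H t (lp2 _ w)) with hHw
  have Hwm : AEStronglyMeasurable Hw volume := aestronglyMeasurable_lp _
  obtain ⟨Cw, hCw⟩ := hw.2
  obtain ⟨Cg, hCg⟩ := hg.2
  have Hwb : ∀ᵐ x, |Hw x| ≤ Cw := hH.abs_apply_le hq ht hw.1 hCw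
  -- A test function `h` for `p_t` is turned into the test function `g + H_t (h - k)` for `p`:
  -- by Jensen and symmetry, `∫ e^g e^{H_t (h - k)} dq ≤ ∫ (H_t e^g) e^{h - k} dq ≤ ∫ e^h dq`.
  have ψb : ∀ᵐ x, |g x + Hw x| ≤ Cg + Cw := Hwb.mono fun x hx =>
    (abs_add_le _ _).trans (add_le_add (hCg x) hx)
  have ψm : AEStronglyMeasurable (fun x => g x + Hw x) volume :=
    hg.1.aestronglyMeasurable.add Hwm
  have i1 : Integrable fun x => (g x + Hw x) * p x := hp.integrable_mul_of_ae_bound ψm ψb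
  have i2 : Integrable fun x => Real.exp (g x + Hw x) * q x :=
    hq.integrable_mul_of_ae_bound (Real.continuous_exp.comp_aestronglyMeasurable ψm)
      (ψb.mono fun x hx => abs_exp_le hx)
  have ig : Integrable fun x => g x * p x :=
    hp.integrable_mul_of_ae_bound hg.1.aestronglyMeasurable (Eventually.of_forall hCg)
  have iH : Integrable fun x => Hw x * p x := hp.integrable_mul_of_ae_bound Hwm Hwb
  have young : (∫ x, (g x + Hw x) * p x) - ∫ x, Real.exp (g x + Hw x) * q x
      ≤ (∫ x, (Real.log (p x) - Real.log (q x)) * p x) - 1 := by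
    rw [← integral_sub i1 i2]
    conv_rhs => rw [← hp.integral_eq_one]
    rw [← integral_sub (hp.integrable_log_sub_mul hq) hp.integrable]
    refine integral_mono (i1.sub i2) ((hp.integrable_log_sub_mul hq).sub hp.integrable) fun x => ?_
    have h0 := le_klFun (x := p x / q x) (div_pos (hp.pos x) (hq.pos x)).le (g x + Hw x)
    rw [InformationTheory.klFun_apply, Real.log_div (hp.pos x).ne' (hq.pos x).ne'] at h0
    have h1 := mul_le_mul_of_nonneg_right h0 (hq.pos x).le
    have h2 : p x / q x * q x = p x := div_mul_cancel₀ _ (hq.pos x).ne'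
    simp only
    linear_combination h1 + (Real.log (p x) - Real.log (q x) - 1 - (g x + Hw x)) * h2
  have e2 : ∫ x, (g x + Hw x) * p x = (∫ x, g x * p x) + ∫ x, Hw x * p x := by
    simp only [add_mul]
    exact integral_add ig iH
  have e3 : ∫ x, Real.exp (g x + Hw x) * q x ≤ ∫ x, Real.exp (h x) * q x := by
    rw [← integral_densityMeasure hq, ← integral_densityMeasure hq]
    have hs := hH.symm hq ht (lp2 _ fun x => Real.exp (g x)) (lp2 _ fun x => Real.exp (w x))
    rw [real_inner_comm, inner_lp2 hw.exp, inner_lp2 hg.exp] at hs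
    have jensen := (densityMeasure_ae_iff hq).2 (hH.exp_apply_le hq ht hw)
    have int1 : ∀ {f : Eucl d → ℝ} (u : Lp ℝ 2 (densityMeasure q)), IsBddMeas f →
        Integrable (fun x => f x * u x) (densityMeasure q) := fun {f} u hf => by
      obtain ⟨C, hC⟩ := hf.2
      exact ((Lp.memLp u).integrable one_le_two).bdd_mul hf.1.aestronglyMeasurable
        (Eventually.of_forall hC)
    calc ∫ x, Real.exp (g x + Hw x) ∂densityMeasure q
        ≤ ∫ x, Real.exp (g x) * H t (lp2 _ fun x => Real.exp (w x)) x ∂densityMeasure q := by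
          refine integral_mono_of_nonneg (Eventually.of_forall fun x => (Real.exp_pos _).le)
            (int1 _ hg.exp) ?_
          filter_upwards [jensen] with x hx
          rw [Real.exp_add]
          exact mul_le_mul_of_nonneg_left hx (Real.exp_pos _).le
      _ = ∫ x, Real.exp (w x) * H t (lp2 _ fun x => Real.exp (g x)) x ∂densityMeasure q := hs.symm
      _ ≤ ∫ x, Real.exp (h x) ∂densityMeasure q := by
          refine integral_mono_ae (int1 _ hw.exp)
            (integrable_of_abs_le hm.exp fun x => abs_exp_le (hC x)) ?_
          filter_upwards [(densityMeasure_ae_iff hq).2 hgk] with x hx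
          calc _ ≤ Real.exp (w x) * Real.exp (k x) :=
                mul_le_mul_of_nonneg_left hx (Real.exp_pos _).le
            _ = Real.exp (h x) := by rw [← Real.exp_add, hwdef]; simp
  linarith

/-- Finiteness by the data-processing inequality. -/
lemma klDiv_ne_top (hp : IsRapidDensity p) (hq : IsRapidDensity q)
    (hH : IsLangevinSemigroup q H) (hP : IsLangevinEvolution p q H P) {t : ℝ} (ht : 0 ≤ t) :
    InformationTheory.klDiv (P t) (densityMeasure q) ≠ ⊤ := by
  have := isProbabilityMeasure_densityMeasure hq
  refine (hP.klDiv_le hp hq hH ht (isBddMeas_const 0) (isBddMeas_const 0) ?_).1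
  rw [hH.apply_const hq ht]
  filter_upwards [(densityMeasure_ae_iff hq).1
    (coeFn_lp2 (ν := densityMeasure q) (isBddMeas_const (Real.exp 0)))] with x hx
  rw [hx]

end IsLangevinEvolution

end Evolution

/-! ### Cutoff functions and truncations of the log-density ratio -/

section Cutoff

variable {d : ℕ}

/-- A smooth function equal to `1` on the ball of radius `1` and supported in the ball of
radius `2`. -/
noncomputable def baseBump (d : ℕ) : ContDiffBump (0 : Eucl d) := ⟨1, 2, one_pos, one_lt_two⟩

/-- A smooth function equal to `1` on the ball of radius `R` and supported in the ball of
radius `2 R`. -/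
noncomputable def cutoff (R : ℝ) (x : Eucl d) : ℝ := baseBump d (R⁻¹ • x)

lemma cutoff_nonneg (R : ℝ) (x : Eucl d) : 0 ≤ cutoff R x := (baseBump d).nonneg

lemma cutoff_le_one (R : ℝ) (x : Eucl d) : cutoff R x ≤ 1 := (baseBump d).le_one

lemma cutoff_eq_one {R : ℝ} (hR : 0 < R) {x : Eucl d} (hx : ‖x‖ ≤ R) : cutoff R x = 1 := by
  refine (baseBump d).one_of_mem_closedBall ?_
  rw [mem_closedBall_zero_iff, norm_smul, norm_inv, Real.norm_of_nonneg hR.le]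
  exact (inv_mul_le_one₀ hR).2 hx

lemma cutoff_eq_zero {R : ℝ} (hR : 0 < R) {x : Eucl d} (hx : 2 * R ≤ ‖x‖) : cutoff R x = 0 := by
  refine (baseBump d).zero_of_le_dist ?_
  rw [dist_zero_right, norm_smul, norm_inv, Real.norm_of_nonneg hR.le]
  change 2 ≤ _
  rw [inv_mul_eq_div, le_div_iff₀ hR]
  exact hx

lemma contDiff_cutoff (R : ℝ) : ContDiff ℝ (⊤ : ℕ∞) (cutoff (d := d) R) :=
  (baseBump d).contDiff.comp (contDiff_const_smul R⁻¹)

lemma hasCompactSupport_cutoff {R : ℝ} (hR : 0 < R) : HasCompactSupport (cutoff (d := d) R) :=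
  HasCompactSupport.intro (isCompact_closedBall 0 (2 * R)) fun x hx => cutoff_eq_zero hR (by
    rw [mem_closedBall_zero_iff, not_le] at hx
    exact hx.le)

lemma exists_growth2_cutoff (d : ℕ) : ∃ C, ∀ R : ℝ, 1 ≤ R → Growth2 C 0 (cutoff (d := d) R) := by
  obtain ⟨C, hC⟩ := (baseBump d).hasCompactSupport.exists_growth2 (baseBump d).contDiff
  refine ⟨C, fun R hR => ⟨contDiff_cutoff R, fun x => ?_, fun i x => ?_, fun i j x => ?_⟩⟩
  · exact hC.bound (R⁻¹ • x)
  · have h0 : 0 ≤ R⁻¹ := by positivity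
    have h1 : R⁻¹ ≤ 1 := inv_le_one_of_one_le₀ hR
    change |pd i (fun y => baseBump d (R⁻¹ • y)) x| ≤ _
    rw [pd_comp_smul i (baseBump d).contDiff, abs_mul, abs_of_nonneg h0]
    have := hC.bound_pd i (R⁻¹ • x)
    simp only [pow_zero, mul_one] at *
    exact (mul_le_of_le_one_left (abs_nonneg _) h1).trans this
  · have h0 : 0 ≤ R⁻¹ := by positivity
    have h1 : R⁻¹ ≤ 1 := inv_le_one_of_one_le₀ hR
    change |pd i (pd j (fun y => baseBump d (R⁻¹ • y))) x| ≤ _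
    have hs : ContDiff ℝ (⊤ : ℕ∞) fun y : Eucl d => pd j (baseBump d) (R⁻¹ • y) :=
      ((baseBump d).contDiff.pd j).comp (contDiff_const_smul R⁻¹)
    rw [pd_comp_smul j (baseBump d).contDiff, pd_mul i contDiff_const hs, pd_const,
      pd_comp_smul i ((baseBump d).contDiff.pd j)]
    simp only [zero_mul, add_zero]
    rw [abs_mul, abs_mul, abs_of_nonneg h0]
    have := hC.bound_pd_pd i j (R⁻¹ • x)
    simp only [pow_zero, mul_one] at *
    exact (mul_le_of_le_one_left (by positivity) h1).trans
      ((mul_le_of_le_one_left (abs_nonneg _) h1).trans this)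

/-- A smooth majorant of `(1 + ‖x‖) ^ m`, up to a constant. -/
noncomputable def smoothWeight (m : ℕ) (x : Eucl d) : ℝ := (1 + ‖x‖ ^ 2) ^ m

lemma exists_growth2_smoothWeight (m : ℕ) : ∃ C k, Growth2 C k (smoothWeight (d := d) m) := by
  have h : Function.HasTemperateGrowth (smoothWeight (d := d) m) := by
    unfold smoothWeight
    fun_prop
  refine exists_growth2_of_iteratedFDeriv h.1 fun j _ => ?_
  obtain ⟨k, C, hC⟩ := h.2 j
  exact ⟨C, k, hC⟩

lemma pow_le_smoothWeight (m : ℕ) (x : Eucl d) : (1 + ‖x‖) ^ m ≤ 2 ^ m * smoothWeight m x := by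
  rw [smoothWeight, ← mul_pow]
  gcongr
  nlinarith [sq_nonneg (‖x‖ - 1), sq_nonneg ‖x‖]

lemma smoothWeight_nonneg (m : ℕ) (x : Eucl d) : 0 ≤ smoothWeight m x := by
  unfold smoothWeight; positivity

lemma langevinOp_const (q : Eucl d → ℝ) (c : ℝ) (x : Eucl d) :
    langevinOp q (fun _ => c) x = 0 := by
  simp [langevinOp, gradient]

/-- The logarithm of the density ratio `p / q`. -/
noncomputable def logRatio (p q : Eucl d → ℝ) (x : Eucl d) : ℝ := Real.log (p x) - Real.log (q x)

/-- The relative Fisher information `∫ ‖∇ log (p / q)‖² p`. -/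
noncomputable def fisherInfo (p q : Eucl d → ℝ) : ℝ := ∫ x, (∑ i, pd i (logRatio p q) x ^ 2) * p x

variable {p q : Eucl d → ℝ}

lemma exists_growth2_logRatio (hp : IsRapidDensity p) (hq : IsRapidDensity q) :
    ∃ C k, Growth2 C k (logRatio p q) := by
  obtain ⟨A, k, ha⟩ := hp.exists_growth2
  obtain ⟨B, m, hb⟩ := hq.exists_growth2
  exact ⟨_, _, (ha.mono le_rfl (le_max_left k m)).sub (hb.mono le_rfl (le_max_right k m))⟩

lemma exp_logRatio (hp : IsRapidDensity p) (hq : IsRapidDensity q) (x : Eucl d) :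
    Real.exp (logRatio p q x) * q x = p x := by
  rw [logRatio, Real.exp_sub, Real.exp_log (hp.pos x), Real.exp_log (hq.pos x),
    div_mul_cancel₀ _ (hq.pos x).ne']

lemma Growth2.sum_sq_pd_le {u : Eucl d → ℝ} {C : ℝ} {k : ℕ} (hu : Growth2 C k u) (x : Eucl d) :
    |∑ i, pd i u x ^ 2| ≤ d * C ^ 2 * (1 + ‖x‖) ^ (2 * k) := by
  rw [abs_of_nonneg (Finset.sum_nonneg fun i _ => sq_nonneg _)]
  refine (Finset.sum_le_sum fun i _ => (?_ : pd i u x ^ 2 ≤ C ^ 2 * (1 + ‖x‖) ^ (2 * k))).trans ?_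
  · rw [← sq_abs, pow_mul', ← mul_pow]
    exact pow_le_pow_left₀ (abs_nonneg _) (hu.bound_pd i x) 2
  · simp [mul_assoc]

lemma integrable_sum_sq_pd_mul (hp : IsRapidDensity p) {u : Eucl d → ℝ} {C : ℝ} {k : ℕ}
    (hu : Growth2 C k u) : Integrable (fun x => (∑ i, pd i u x ^ 2) * p x) :=
  hp.integrable_mul (continuous_finsetSum _ fun i _ =>
    ((hu.smooth.pd i).continuous.pow 2)).aestronglyMeasurable hu.sum_sq_pd_le

lemma integrable_langevinOp_mul (hp : IsRapidDensity p) (hq : IsRapidDensity q) {u : Eucl d → ℝ}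
    {C : ℝ} {k : ℕ} (hu : Growth2 C k u) : Integrable (fun x => langevinOp q u x * p x) := by
  obtain ⟨B, m, hb⟩ := hq.exists_growth2
  exact hp.integrable_mul (hq.smooth_log.langevinOp hu.smooth).continuous.aestronglyMeasurable
    (hb.abs_langevinOp_le hu)

/-- The Langevin operators of `q` and `p` differ by the first-order term `⟨∇ log (p / q), ∇ ·⟩`, and
the image of the operator of `p` integrates to zero against `p`. -/
lemma integral_langevinOp_logRatio (hp : IsRapidDensity p) (hq : IsRapidDensity q) :
    ∫ x, langevinOp q (logRatio p q) x * p x = -fisherInfo p q := by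
  obtain ⟨C, k, hl⟩ := exists_growth2_logRatio hp hq
  have h1 : ∀ x, langevinOp q (logRatio p q) x
      = langevinOp p (logRatio p q) x - ∑ i, pd i (logRatio p q) x ^ 2 := fun x => by
    rw [langevinOp_eq_sum q hl.smooth, langevinOp_eq_sum p hl.smooth, ← Finset.sum_sub_distrib]
    refine Finset.sum_congr rfl fun i _ => ?_
    have : pd i (logRatio p q) x
        = pd i (fun y => Real.log (p y)) x - pd i (fun y => Real.log (q y)) x :=
      congrFun (pd_sub i hp.smooth_log hq.smooth_log) x
    rw [sq]
    nth_rw 4 [this]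
    ring
  have hone : Growth2 (d := d) 1 0 fun _ => 1 :=
    ⟨contDiff_const, by simp, by simp [pd_const], by simp [pd_const]⟩
  have h2 := hp.integral_mul_langevinOp hone hl
  simp only [pd_const, zero_mul, Finset.sum_const_zero, integral_zero, neg_zero, one_mul] at h2
  simp only [h1, sub_mul]
  rw [integral_sub (integrable_langevinOp_mul hp hp hl) (integrable_sum_sq_pd_mul hp hl), h2,
    fisherInfo, zero_sub]

/-- The truncated log-ratios `χ_R log (p / q)` grow polynomially, uniformly in `R ≥ 1`. -/
lemma exists_growth2_cutoff_mul {u : Eucl d → ℝ} {C : ℝ} {k : ℕ} (hu : Growth2 C k u) :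
    ∃ C', ∀ R : ℝ, 1 ≤ R → Growth2 C' k fun x => cutoff R x * u x := by
  obtain ⟨B, hB⟩ := exists_growth2_cutoff d
  refine ⟨4 * (B * C), fun R hR => ?_⟩
  simpa using (hB R hR).mul hu

lemma cutoff_mul_eventuallyEq {u : Eucl d → ℝ} {R : ℝ} (hR : 0 < R) {x : Eucl d} (hx : ‖x‖ < R) :
    (fun x => cutoff R x * u x) =ᶠ[𝓝 x] u := by
  filter_upwards [(continuous_norm.tendsto x).eventually_lt_const hx] with y hy
  rw [cutoff_eq_one hR hy.le, one_mul]

lemma cutoff_mul_eventuallyEq_zero {u : Eucl d → ℝ} {R : ℝ} (hR : 0 < R) {x : Eucl d}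
    (hx : 2 * R < ‖x‖) : (fun x => cutoff R x * u x) =ᶠ[𝓝 x] fun _ => 0 := by
  filter_upwards [(continuous_norm.tendsto x).eventually_const_lt hx] with y hy
  rw [cutoff_eq_zero hR hy.le, zero_mul]

/-- One-sided derivatives at `0` from first-order upper and lower bounds. -/
lemma hasDerivWithinAt_of_bounds {F : ℝ → ℝ} {c : ℝ}
    (hu : ∀ ε > 0, ∀ᶠ t in 𝓝[>] 0, F t ≤ F 0 + t * (c + ε))
    (hl : ∀ ε > 0, ∀ᶠ t in 𝓝[>] 0, F 0 + t * (c - ε) ≤ F t) :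
    HasDerivWithinAt F c (Set.Ici 0) 0 := by
  rw [← hasDerivWithinAt_Ioi_iff_Ici, hasDerivWithinAt_iff_tendsto_slope' (by simp),
    Metric.tendsto_nhds]
  intro ε hε
  filter_upwards [hu (ε / 2) (half_pos hε), hl (ε / 2) (half_pos hε), self_mem_nhdsWithin]
    with t h1 h2 (ht : 0 < t)
  have h3 : slope F 0 t * t = F t - F 0 := by
    rw [slope_def_field, sub_zero, div_mul_cancel₀ _ ht.ne']
  rw [Real.dist_eq, abs_lt]
  constructor
  · by_contra! hcon
    nlinarith
  · by_contra! hcon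
    nlinarith

end Cutoff

/-! ### Upper bound for the entropy of the Langevin dynamics -/

section LangevinDerivative

variable {d : ℕ} {p q : Eucl d → ℝ}
  {H : ℝ → Lp ℝ 2 (densityMeasure q) →L[ℝ] Lp ℝ 2 (densityMeasure q)} {P : ℝ → Measure (Eucl d)}

lemma HasCompactSupport.integrable_mul (hp : IsRapidDensity p) {u : Eucl d → ℝ}
    (hc : HasCompactSupport u) (hs : ContDiff ℝ (⊤ : ℕ∞) u) : Integrable (fun x => u x * p x) := by
  obtain ⟨C, -, hC⟩ := hc.exists_abs_le hs.continuous
  exact hp.integrable_mul_of_ae_bound hs.continuous.aestronglyMeasurable (Eventually.of_forall hC)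

/-- Short-time upper bound in the sup norm: `H_t φ ≤ φ + t Lφ + O(t²)`. -/
lemma IsLangevinSemigroup.exists_apply_le (hq : IsRapidDensity q) (hH : IsLangevinSemigroup q H) :
    ∃ δ > 0, ∀ φ : Eucl d → ℝ, ContDiff ℝ (⊤ : ℕ∞) φ → HasCompactSupport φ →
      ∃ C, 0 ≤ C ∧ ∀ t ∈ Set.Icc 0 δ,
        ∀ᵐ x, H t (lp2 _ φ) x ≤ φ x + t * langevinOp q φ x + C * t ^ 2 := by
  have := isProbabilityMeasure_densityMeasure hq
  obtain ⟨δ, hδ, h⟩ := hH.exists_le_apply hq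
  refine ⟨δ, hδ, fun φ hs hc => ?_⟩
  have hLs := hq.smooth_log.langevinOp hs
  have hLc := hc.langevinOp q
  have hneg : ∀ {u : Eucl d → ℝ}, ContDiff ℝ (⊤ : ℕ∞) u → ∀ x,
      langevinOp q (fun y => 0 - u y) x = -langevinOp q u x := fun {u} hu x => by
    rw [langevinOp_sub q contDiff_const hu, langevinOp_const, zero_sub]
  obtain ⟨C, hC0, hC⟩ := (hLc.langevinOp q).exists_abs_le (hq.smooth_log.langevinOp hLs).continuous
  refine ⟨C / 2, by positivity, fun t ht => ?_⟩
  have hcn : ∀ {u : Eucl d → ℝ}, HasCompactSupport u → HasCompactSupport fun y => 0 - u y :=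
    fun {u} hu => by simpa using! hu.neg
  have h1 := h (fun x => 0 - φ x) (fun x => 0 - langevinOp q φ x) C (contDiff_const.sub hs)
    (hcn hc) (contDiff_const.sub hLs) (hcn hLc) (fun x => by rw [hneg hs, zero_sub])
    (fun x => by rw [hneg hLs]; exact neg_le_neg ((le_abs_self _).trans (hC x))) t ht
  have hb := isBddMeas_of_hasCompactSupport hs hc
  have e : lp2 (densityMeasure q) (fun x => 0 - φ x) = -lp2 _ φ := by
    have := lp2_const_mul (ν := densityMeasure q) hb (-1)
    simpa using this
  rw [e, map_neg] at h1
  filter_upwards [h1, (densityMeasure_ae_iff hq).1 (Lp.coeFn_neg (H t (lp2 _ φ)))] with x h2 h3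
  rw [h3, Pi.neg_apply] at h2
  linarith

lemma IsLangevinSemigroup.exists_integral_apply_le (hp : IsRapidDensity p) (hq : IsRapidDensity q)
    (hH : IsLangevinSemigroup q H) :
    ∃ δ > 0, ∀ φ : Eucl d → ℝ, ContDiff ℝ (⊤ : ℕ∞) φ → HasCompactSupport φ →
      ∃ C, 0 ≤ C ∧ ∀ t ∈ Set.Icc 0 δ, ∫ x, H t (lp2 _ φ) x * p x ≤
        (∫ x, φ x * p x) + t * (∫ x, langevinOp q φ x * p x) + C * t ^ 2 := by
  obtain ⟨δ, hδ, h⟩ := hH.exists_apply_le hq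
  refine ⟨δ, hδ, fun φ hs hc => ?_⟩
  obtain ⟨C, hC0, hC⟩ := h φ hs hc
  refine ⟨C, hC0, fun t ht => ?_⟩
  have i1 := hc.integrable_mul hp hs
  have i2 := (hc.langevinOp q).integrable_mul hp (hq.smooth_log.langevinOp hs)
  have i3 : Integrable fun x => φ x * p x + t * (langevinOp q φ x * p x) := i1.add (i2.const_mul t)
  have i4 : Integrable fun x => φ x * p x + t * (langevinOp q φ x * p x) + C * t ^ 2 * p x :=
    i3.add (hp.integrable.const_mul _)
  calc ∫ x, H t (lp2 _ φ) x * p x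
      ≤ ∫ x, φ x * p x + t * (langevinOp q φ x * p x) + C * t ^ 2 * p x := by
        refine integral_mono_ae (hH.integrable_apply_mul hp hq ht.1
          (isBddMeas_of_hasCompactSupport hs hc)) i4 ((hC t ht).mono fun x hx => ?_)
        have := mul_le_mul_of_nonneg_right hx (hp.pos x).le
        simp only
        linarith
    _ = _ := by
        rw [integral_add i3 (hp.integrable.const_mul _), integral_add i1 (i2.const_mul t),
          integral_const_mul, integral_const_mul, hp.integral_eq_one, mul_one]

/-- For every test function `g`, the divergence decreases at rate at least
`-∫ (2 Lg + ‖∇g‖²) dp = ∫ (2 ⟨∇ log (p / q), ∇g⟩ - ‖∇g‖²) dp`. -/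
lemma IsLangevinEvolution.exists_toReal_klDiv_le (hp : IsRapidDensity p) (hq : IsRapidDensity q)
    (hH : IsLangevinSemigroup q H) (hP : IsLangevinEvolution p q H P) {g : Eucl d → ℝ}
    (hs : ContDiff ℝ (⊤ : ℕ∞) g) (hc : HasCompactSupport g) :
    ∃ δ > 0, ∃ C, ∀ t ∈ Set.Icc 0 δ,
      (InformationTheory.klDiv (P t) (densityMeasure q)).toReal ≤
        (∫ x, logRatio p q x * p x) + t * (∫ x, (2 * langevinOp q g x + ∑ i, pd i g x ^ 2) * p x)
          + C * t ^ 2 := by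
  have := isProbabilityMeasure_densityMeasure hq
  obtain ⟨δ₁, hδ₁, h1⟩ := hH.exists_apply_le hq
  obtain ⟨δ₂, hδ₂, h2⟩ := hH.exists_integral_apply_le hp hq
  have hLs := hq.smooth_log.langevinOp hs
  have hLc := hc.langevinOp q
  set S : Eucl d → ℝ := fun x => ∑ i, pd i g x ^ 2 with hS
  have hSs : ContDiff ℝ (⊤ : ℕ∞) S := ContDiff.sum fun i _ => (hs.pd i).pow 2
  have hSc : HasCompactSupport S := by
    refine HasCompactSupport.intro hc fun x hx => ?_
    refine Finset.sum_eq_zero fun i _ => ?_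
    rw [pd_congr i (notMem_tsupport_iff_eventuallyEq.1 hx)]
    simp [pd]
  set v : Eucl d → ℝ := fun x => langevinOp q g x + S x with hv
  have hvs : ContDiff ℝ (⊤ : ℕ∞) v := hLs.add hSs
  have hvc : HasCompactSupport v := hLc.add hSc
  -- The semigroup expansion applies to `e^g - 1`, which is compactly supported, unlike `e^g`, and
  -- satisfies `L (e^g - 1) = e^g v`.
  set φ : Eucl d → ℝ := fun x => Real.exp (g x) - 1 with hφ
  have hφs : ContDiff ℝ (⊤ : ℕ∞) φ := hs.exp.sub contDiff_const
  have hφc : HasCompactSupport φ := HasCompactSupport.intro hc fun x hx => by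
    rw [hφ]; simp [image_eq_zero_of_notMem_tsupport hx]
  have hLφ : ∀ x, langevinOp q φ x = Real.exp (g x) * v x := fun x => by
    rw [hφ, langevinOp_sub q hs.exp contDiff_const, langevinOp_const, langevinOp_exp q hs, sub_zero]
  have bg := isBddMeas_of_hasCompactSupport hs hc
  have bv := isBddMeas_of_hasCompactSupport hvs hvc
  have bφ := isBddMeas_of_hasCompactSupport hφs hφc
  obtain ⟨G, hG0, hG⟩ := hc.exists_abs_le hs.continuous
  obtain ⟨C₁, hC₁0, hC₁⟩ := h1 φ hφs hφc
  obtain ⟨C₂, hC₂0, hC₂⟩ := h2 g hs hc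
  obtain ⟨C₃, hC₃0, hC₃⟩ := h2 v hvs hvc
  set A := C₁ * Real.exp G with hA
  set K := ∫ x, langevinOp q v x * p x
  refine ⟨min δ₁ δ₂, lt_min hδ₁ hδ₂, C₂ + K + C₃ * δ₂ + A, fun t ht => ?_⟩
  have ht1 : t ∈ Set.Icc 0 δ₁ := ⟨ht.1, ht.2.trans (min_le_left _ _)⟩
  have ht2 : t ∈ Set.Icc 0 δ₂ := ⟨ht.1, ht.2.trans (min_le_right _ _)⟩
  have bk : IsBddMeas fun x => g x + (t * v x + A * t ^ 2) :=
    bg.add ((bv.const_mul t).add (isBddMeas_const _))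
  have hgk : ∀ᵐ x, H t (lp2 _ fun x => Real.exp (g x)) x
      ≤ Real.exp (g x + (t * v x + A * t ^ 2)) := by
    have e1 : lp2 (densityMeasure q) (fun x => Real.exp (g x))
        = lp2 _ φ + lp2 _ fun _ => (1 : ℝ) := by
      rw [← lp2_add bφ (isBddMeas_const 1), hφ]; simp
    rw [e1, map_add, hH.apply_const hq ht.1]
    filter_upwards [hC₁ t ht1, (densityMeasure_ae_iff hq).1 (Lp.coeFn_add (H t (lp2 _ φ))
      (lp2 _ fun _ => (1 : ℝ))), (densityMeasure_ae_iff hq).1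
      (coeFn_lp2 (ν := densityMeasure q) (isBddMeas_const 1))] with x h3 h4 h5
    rw [h4, Pi.add_apply, h5]
    rw [hLφ] at h3
    have h6 := Real.add_one_le_exp (t * v x + A * t ^ 2)
    have h7 : 1 ≤ Real.exp (g x) * Real.exp G := by
      rw [← Real.exp_add]
      exact Real.one_le_exp (by linarith [(abs_le.1 (hG x)).1])
    have h8 := mul_le_mul_of_nonneg_left h7 (mul_nonneg hC₁0 (sq_nonneg t))
    have h9 := mul_le_mul_of_nonneg_left h6 (Real.exp_pos (g x)).le
    rw [Real.exp_add]
    have h10 : φ x = Real.exp (g x) - 1 := rfl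
    rw [h10] at h3
    refine le_trans ?_ h9
    rw [hA]
    linarith
  refine (hP.klDiv_le hp hq hH ht.1 bg bk hgk).2.trans ?_
  rw [hH.integral_apply_add hp hq ht.1 bg ((bv.const_mul t).add (isBddMeas_const _)),
    hH.integral_apply_add hp hq ht.1 (bv.const_mul t) (isBddMeas_const _),
    IsLangevinSemigroup.integral_apply_const_mul hq bv, hH.integral_apply_const hp hq ht.1]
  have e2 : ∫ x, (2 * langevinOp q g x + ∑ i, pd i g x ^ 2) * p x
      = (∫ x, langevinOp q g x * p x) + ∫ x, v x * p x := by
    rw [← integral_add (hLc.integrable_mul hp hLs) (hvc.integrable_mul hp hvs)]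
    congr 1; ext x; simp only [hv, hS]; ring
  have e3 : ∫ x, (Real.log (p x) - Real.log (q x)) * p x = ∫ x, logRatio p q x * p x := rfl
  rw [e2, e3]
  have h3 := hC₂ t ht2
  have h4 := mul_le_mul_of_nonneg_left (hC₃ t ht2) ht.1
  have h5 : C₃ * t ^ 2 * t ≤ C₃ * t ^ 2 * δ₂ :=
    mul_le_mul_of_nonneg_left ht2.2 (by positivity)
  linarith

/-- The rate of `exists_toReal_klDiv_le` is optimal at `g = log (p / q)`, where it equals
`-fisherInfo p q`. -/
lemma IsLangevinEvolution.eventually_toReal_klDiv_le (hp : IsRapidDensity p)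
    (hq : IsRapidDensity q) (hH : IsLangevinSemigroup q H) (hP : IsLangevinEvolution p q H P)
    {ε : ℝ} (hε : 0 < ε) :
    ∀ᶠ t in 𝓝[>] 0, (InformationTheory.klDiv (P t) (densityMeasure q)).toReal ≤
      (∫ x, logRatio p q x * p x) + t * (-fisherInfo p q + ε) := by
  obtain ⟨A, k, hl⟩ := exists_growth2_logRatio hp hq
  obtain ⟨B, m, hb⟩ := hq.exists_growth2
  obtain ⟨C, hC⟩ := exists_growth2_cutoff_mul hl
  -- The rate for `g = χ_R log (p / q)` converges to `-fisherInfo p q` as `R → ∞`.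
  set U : (Eucl d → ℝ) → Eucl d → ℝ := fun u x => 2 * langevinOp q u x + ∑ i, pd i u x ^ 2 with hU
  have hUb : ∀ {u : Eucl d → ℝ} {D : ℝ}, Growth2 D k u → ∀ x,
      |U u x| ≤ (2 * (d * (B * D + D)) + d * D ^ 2) * (1 + ‖x‖) ^ (m + 2 * k) := by
    intro u D hu x
    have hB := hb.nonneg
    have hD := hu.nonneg
    have h1 := hb.abs_langevinOp_le hu x
    have h2 := hu.sum_sq_pd_le x
    have h3 : (1 : ℝ) ≤ 1 + ‖x‖ := by linarith [norm_nonneg x]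
    have h4 := h1.trans (mul_le_mul_of_nonneg_left (pow_le_pow_right₀ h3
      (show m + k ≤ m + 2 * k by omega)) (by positivity))
    have h5 := h2.trans (mul_le_mul_of_nonneg_left (pow_le_pow_right₀ h3
      (show 2 * k ≤ m + 2 * k by omega)) (by positivity))
    calc |U u x| ≤ |2 * langevinOp q u x| + |∑ i, pd i u x ^ 2| := abs_add_le _ _
      _ = 2 * |langevinOp q u x| + |∑ i, pd i u x ^ 2| := by rw [abs_mul, abs_two]
      _ ≤ _ := by linarith
  have hUi : ∀ {u : Eucl d → ℝ} {D : ℝ}, Growth2 D k u → Integrable fun x => U u x * p x := by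
    intro u D hu
    have h1 := ((integrable_langevinOp_mul hp hq hu).const_mul 2).add
      (integrable_sum_sq_pd_mul hp hu)
    refine h1.congr (Eventually.of_forall fun x => ?_)
    simp only [hU, Pi.add_apply]; ring
  have hUl : ∫ x, U (logRatio p q) x * p x = -fisherInfo p q := by
    have h1 := integral_add ((integrable_langevinOp_mul hp hq hl).const_mul 2)
      (integrable_sum_sq_pd_mul hp hl)
    rw [integral_const_mul, integral_langevinOp_logRatio hp hq] at h1
    calc ∫ x, U (logRatio p q) x * p x = _ := by
          congr 1; ext x; simp only [hU]; rw [add_mul, mul_assoc]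
      _ = _ := h1
      _ = -fisherInfo p q := by rw [← fisherInfo]; ring
  set D₁ := 2 * (d * (B * C + C)) + d * C ^ 2 with hD₁
  set D₂ := 2 * (d * (B * A + A)) + d * A ^ 2 with hD₂
  have hA := hl.nonneg
  have hB := hb.nonneg
  have hC0 := (hC 1 le_rfl).nonneg
  obtain ⟨M, hM0, hM⟩ := hp.exists_tail_bound (m + 2 * k) 1
  have tail : ∀ R : ℝ, 1 ≤ R → ∫ x, U (fun x => cutoff R x * logRatio p q x) x * p x
      ≤ -fisherInfo p q + (D₁ + D₂) * M / R := by
    intro R hR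
    have hR0 : 0 < R := by linarith
    have h1 := hM R (D₁ + D₂)
      (fun x => U (fun x => cutoff R x * logRatio p q x) x - U (logRatio p q) x) hR0
      (by positivity) (fun x => ?_) (fun x hx => ?_)
    · simp only [sub_mul] at h1
      rw [integral_sub (hUi (hC R hR)) (hUi hl), hUl, pow_one] at h1
      linarith [le_abs_self
        ((∫ x, U (fun x => cutoff R x * logRatio p q x) x * p x) - -fisherInfo p q)]
    · rw [add_mul]
      exact (abs_sub _ _).trans (add_le_add (hUb (hC R hR) x) (hUb hl x))
    · have h2 := cutoff_mul_eventuallyEq (u := logRatio p q) hR0 hx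
      simp only [hU]
      rw [langevinOp_congr q h2, sub_eq_zero]
      simp only [pd_congr _ h2]
  obtain ⟨R, hR1, hR⟩ : ∃ R : ℝ, 1 ≤ R ∧ (D₁ + D₂) * M / R ≤ ε / 2 := by
    refine ⟨max 1 ((D₁ + D₂) * M / (ε / 2)), le_max_left _ _, ?_⟩
    rw [div_le_iff₀ (lt_of_lt_of_le one_pos (le_max_left _ _)), ← div_le_iff₀' (half_pos hε)]
    exact le_max_right _ _
  have hR0 : 0 < R := by linarith
  obtain ⟨δ, hδ, E, hE⟩ := hP.exists_toReal_klDiv_le hp hq hH (hC R hR1).smooth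
    ((hasCompactSupport_cutoff hR0).mul_right)
  have hEt : ∀ᶠ t : ℝ in 𝓝[>] 0, E * t ≤ ε / 2 := by
    have : Tendsto (fun t : ℝ => E * t) (𝓝[>] 0) (𝓝 0) := by
      have : Continuous fun t : ℝ => E * t := by fun_prop
      simpa using (this.tendsto 0).mono_left nhdsWithin_le_nhds
    exact this.eventually_le_const (half_pos hε)
  filter_upwards [hEt, Ioc_mem_nhdsGT hδ] with t h1 h2
  refine (hE t ⟨h2.1.le, h2.2⟩).trans ?_
  have h3 := mul_le_mul_of_nonneg_left ((tail R hR1).trans (add_le_add_right hR _)) h2.1.le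
  have h4 := mul_le_mul_of_nonneg_left h1 h2.1.le
  simp only [hU] at h3
  nlinarith

end LangevinDerivative

/-! ### Lower bound for the entropy of the Langevin dynamics -/

section LangevinDerivative

variable {d : ℕ} {p q : Eucl d → ℝ}
  {H : ℝ → Lp ℝ 2 (densityMeasure q) →L[ℝ] Lp ℝ 2 (densityMeasure q)} {P : ℝ → Measure (Eucl d)}

/-- A minorant of `L (χ_R log (p / q))` that is smooth and compactly supported, equals
`L log (p / q)` on the ball of radius `r ≤ R`. Derivatives of `log p` and `log q` of order three and
four enter its image under `L` only on the ball of radius `2 r`, through a term independent of `R`;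
the term depending on `R` is a truncated polynomial weight. -/
noncomputable def dissipationMinorant (p q : Eucl d → ℝ) (D : ℝ) (m : ℕ) (r R : ℝ) (x : Eucl d) :
    ℝ :=
  cutoff r x * (langevinOp q (logRatio p q) x + D * smoothWeight m x)
    - D * (cutoff (2 * R) x * smoothWeight m x)

lemma contDiff_smoothWeight (m : ℕ) : ContDiff ℝ (⊤ : ℕ∞) (smoothWeight (d := d) m) :=
  (exists_growth2_smoothWeight m).choose_spec.choose_spec.smooth

lemma contDiff_logRatio (hp : IsRapidDensity p) (hq : IsRapidDensity q) :
    ContDiff ℝ (⊤ : ℕ∞) (logRatio p q) := hp.smooth_log.sub hq.smooth_log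

lemma contDiff_minorant_left (hp : IsRapidDensity p) (hq : IsRapidDensity q) (D : ℝ) (m : ℕ)
    (r : ℝ) : ContDiff ℝ (⊤ : ℕ∞) fun x =>
      cutoff r x * (langevinOp q (logRatio p q) x + D * smoothWeight m x) :=
  (contDiff_cutoff r).mul ((hq.smooth_log.langevinOp (contDiff_logRatio hp hq)).add
    (contDiff_const.mul (contDiff_smoothWeight m)))

lemma contDiff_minorant_right (D : ℝ) (m : ℕ) (R : ℝ) : ContDiff ℝ (⊤ : ℕ∞) fun x : Eucl d =>
    D * (cutoff (2 * R) x * smoothWeight m x) :=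
  contDiff_const.mul ((contDiff_cutoff _).mul (contDiff_smoothWeight m))

lemma hasCompactSupport_dissipationMinorant (D : ℝ) (m : ℕ) {r R : ℝ} (hr : 0 < r) (hR : 0 < R) :
    HasCompactSupport (dissipationMinorant p q D m r R) :=
  HasCompactSupport.sub ((hasCompactSupport_cutoff hr).mul_right)
    (((hasCompactSupport_cutoff (by linarith)).mul_right).mul_left)

/-- The image of the minorant under `L` grows at most polynomially in `R`: the term depending on `R`
vanishes outside the ball of radius `4 R`. -/
lemma exists_le_langevinOp_minorant (hp : IsRapidDensity p) (hq : IsRapidDensity q) {D : ℝ}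
    (m : ℕ) :
    ∃ (C : ℝ) (K : ℕ), 0 ≤ C ∧ ∀ r : ℝ, 1 ≤ r → ∃ Cr : ℝ, ∀ R : ℝ, 1 ≤ R → ∀ x,
      -(Cr + C * R ^ K) ≤ langevinOp q (dissipationMinorant p q D m r R) x := by
  obtain ⟨W, k, hW⟩ := exists_growth2_smoothWeight (d := d) m
  obtain ⟨W', hW'⟩ := exists_growth2_cutoff_mul hW
  obtain ⟨B, n, hb⟩ := hq.exists_growth2
  have hW0 := (hW' 1 le_rfl).nonneg
  have hB := hb.nonneg
  have hD : Growth2 (d := d) |D| 0 fun _ => D :=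
    ⟨contDiff_const, by simp, by simp [pd_const], by simp [pd_const]⟩
  set W'' := 4 * (|D| * W') with hW''
  have hDW : ∀ R : ℝ, 1 ≤ R →
      Growth2 W'' k fun x : Eucl d => D * (cutoff (2 * R) x * smoothWeight m x) := fun R hR => by
    simpa using hD.mul (hW' (2 * R) (by linarith))
  have hW''0 : 0 ≤ W'' := by positivity
  set E := d * (B * W'' + W'') with hE
  have hE0 : 0 ≤ E := by positivity
  refine ⟨E * 5 ^ (n + k), n + k, by positivity, fun r hr => ?_⟩
  have hl := contDiff_minorant_left hp hq D m r
  have hlc : HasCompactSupport fun x =>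
      cutoff r x * (langevinOp q (logRatio p q) x + D * smoothWeight m x) :=
    (hasCompactSupport_cutoff (by linarith)).mul_right
  obtain ⟨Cr, -, hCr⟩ := (hlc.langevinOp q).exists_abs_le (hq.smooth_log.langevinOp hl).continuous
  refine ⟨Cr, fun R hR x => ?_⟩
  unfold dissipationMinorant
  rw [langevinOp_sub q hl (contDiff_minorant_right D m R)]
  have h1 := (abs_le.1 (hCr x)).1
  have h2 : |langevinOp q (fun x => D * (cutoff (2 * R) x * smoothWeight m x)) x|
      ≤ E * 5 ^ (n + k) * R ^ (n + k) := by
    rcases le_or_gt ‖x‖ (4 * R) with hx | hx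
    · refine (hb.abs_langevinOp_le (hDW R hR) x).trans ?_
      rw [mul_assoc E, ← mul_pow]
      refine mul_le_mul_of_nonneg_left (pow_le_pow_left₀ (by positivity) (by linarith) _) hE0
    · have h3 : (fun x => D * (cutoff (2 * R) x * smoothWeight m x)) =ᶠ[𝓝 x] fun _ => 0 := by
        filter_upwards [cutoff_mul_eventuallyEq_zero (u := smoothWeight m) (R := 2 * R)
          (by linarith) (by linarith : 2 * (2 * R) < ‖x‖)] with y hy
        rw [hy, mul_zero]
      rw [langevinOp_congr q h3, langevinOp_const, abs_zero]
      positivity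
  linarith [(abs_le.1 h2).2]

/-- The minorant property uses a bound on `L (χ_R log (p / q))` that is uniform in `R`. -/
lemma dissipationMinorant_le {D : ℝ} {m : ℕ} (hD : 0 ≤ D)
    (hLb : ∀ R : ℝ, 1 ≤ R → ∀ x : Eucl d,
      |langevinOp q (fun x => cutoff R x * logRatio p q x) x| ≤ D * smoothWeight m x)
    {r R : ℝ} (hr : 1 ≤ r) (hR : 2 * r ≤ R) (x : Eucl d) :
    dissipationMinorant p q D m r R x ≤ langevinOp q (fun x => cutoff R x * logRatio p q x) x := by
  have hR1 : 1 ≤ R := by linarith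
  have hw : 0 ≤ D * smoothWeight m x := mul_nonneg hD (smoothWeight_nonneg m x)
  unfold dissipationMinorant
  rcases lt_or_ge ‖x‖ R with hx | hx
  · have h1 := hLb R hR1 x
    rw [langevinOp_congr q (cutoff_mul_eventuallyEq (by linarith) hx)] at h1 ⊢
    rw [cutoff_eq_one (R := 2 * R) (by linarith) (by linarith)]
    have h2 : 0 ≤ langevinOp q (logRatio p q) x + D * smoothWeight m x := by
      linarith [(abs_le.1 h1).1]
    have h3 := mul_le_mul_of_nonneg_right (cutoff_le_one r x) h2
    linarith
  · rw [cutoff_eq_zero (R := r) (by linarith) (by linarith), zero_mul, zero_sub]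
    rcases le_or_gt ‖x‖ (2 * R) with hx' | hx'
    · rw [cutoff_eq_one (R := 2 * R) (by linarith) hx', one_mul]
      exact (abs_le.1 (hLb R hR1 x)).1
    · rw [langevinOp_congr q (cutoff_mul_eventuallyEq_zero (by linarith) hx'), langevinOp_const]
      have := mul_nonneg (cutoff_nonneg (2 * R) x) hw
      linarith

/-- Quantitative lower bound for the divergence. The radius `r` controls the error in the
dissipation rate; the radius `R` at which `log (p / q)` is truncated remains free, to be coupled to `t`. -/
lemma IsLangevinEvolution.exists_le_toReal_klDiv (hp : IsRapidDensity p)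
    (hq : IsRapidDensity q) (hH : IsLangevinSemigroup q H) (hP : IsLangevinEvolution p q H P) :
    ∃ δ > 0, ∃ (B₀ C A : ℝ) (K : ℕ), 0 ≤ B₀ ∧ 0 ≤ C ∧ ∀ r : ℝ, 1 ≤ r → ∃ Cr : ℝ, ∀ R : ℝ,
      2 * r ≤ R → ∀ t ∈ Set.Icc 0 δ,
      (∫ x, logRatio p q x * p x) + t * (-fisherInfo p q - B₀ / r)
        - (Cr + C * R ^ K) * t ^ 2 / 2 - A / R ^ (2 * (K + 1))
        ≤ (InformationTheory.klDiv (P t) (densityMeasure q)).toReal := by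
  have := isProbabilityMeasure_densityMeasure hq
  obtain ⟨A, k, hl⟩ := exists_growth2_logRatio hp hq
  obtain ⟨B, n, hb⟩ := hq.exists_growth2
  obtain ⟨G, hG⟩ := exists_growth2_cutoff_mul hl
  have hA := hl.nonneg
  have hB := hb.nonneg
  have hG0 := (hG 1 le_rfl).nonneg
  set m := n + k with hm
  set D := d * (B * G + G) * 2 ^ m with hDdef
  have hD : 0 ≤ D := by positivity
  have hLb : ∀ R : ℝ, 1 ≤ R → ∀ x : Eucl d,
      |langevinOp q (fun x => cutoff R x * logRatio p q x) x| ≤ D * smoothWeight m x := by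
    intro R hR x
    refine (hb.abs_langevinOp_le (hG R hR) x).trans ?_
    rw [hDdef, mul_assoc _ (2 ^ m)]
    exact mul_le_mul_of_nonneg_left (pow_le_smoothWeight m x) (by positivity)
  have hLl : ∀ x : Eucl d, |langevinOp q (logRatio p q) x| ≤ D * smoothWeight m x := fun x => by
    have hx : ‖x‖ < 1 + ‖x‖ := by linarith
    have := hLb (1 + ‖x‖) (by linarith [norm_nonneg x]) x
    rwa [langevinOp_congr q (cutoff_mul_eventuallyEq (by linarith [norm_nonneg x]) hx)] at this
  obtain ⟨C, K, hC0, hC⟩ := exists_le_langevinOp_minorant hp hq (D := D) m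
  obtain ⟨δ, hδ, hexp⟩ := hH.exists_le_apply hq
  obtain ⟨W, w, hW⟩ := exists_growth2_smoothWeight (d := d) m
  have hW0 := hW.nonneg
  obtain ⟨M₀, hM₀, htail₀⟩ := hp.exists_tail_bound w 1
  obtain ⟨M₁, hM₁, htail₁⟩ := hp.exists_tail_bound k (2 * (K + 1))
  obtain ⟨M₂, hM₂, htail₂⟩ := hq.exists_tail_bound 0 (2 * (K + 1))
  refine ⟨δ, hδ, 2 * D * W * M₀, C, A * M₁ + 1 * M₂, K, by positivity, hC0, fun r hr => ?_⟩
  obtain ⟨Cr, hCr⟩ := hC r hr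
  refine ⟨Cr, fun R hR t ht => ?_⟩
  have hr0 : 0 < r := by linarith
  have hR1 : 1 ≤ R := by linarith
  have hR0 : 0 < R := by linarith
  set g : Eucl d → ℝ := fun x => cutoff R x * logRatio p q x with hg
  set v := dissipationMinorant p q D m r R with hv
  have hgs : ContDiff ℝ (⊤ : ℕ∞) g := (hG R hR1).smooth
  have hgc : HasCompactSupport g := (hasCompactSupport_cutoff hR0).mul_right
  have hvs : ContDiff ℝ (⊤ : ℕ∞) v :=
    (contDiff_minorant_left hp hq D m r).sub (contDiff_minorant_right D m R)
  have hvc : HasCompactSupport v := hasCompactSupport_dissipationMinorant D m hr0 hR0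
  have bg := isBddMeas_of_hasCompactSupport hgs hgc
  obtain ⟨G', -, hG'⟩ := hgc.exists_abs_le hgs.continuous
  have ig := hgc.integrable_mul hp hgs
  have iv := hvc.integrable_mul hp hvs
  have il : Integrable fun x => logRatio p q x * p x := hp.integrable_log_sub_mul hq
  have iL := integrable_langevinOp_mul hp hq hl
  -- The test function `g` gives `∫ g dP_t`, expanded in `t`, on the left.
  have s1 : (∫ x, g x * p x) + t * (∫ x, v x * p x) - (Cr + C * R ^ K) * t ^ 2 / 2
      ≤ ∫ x, g x ∂P t := by
    rw [hP.integral_eq hp hq hH ht.1 bg]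
    have i1 : Integrable fun x => g x * p x + t * (v x * p x) := ig.add (iv.const_mul t)
    have i2 : Integrable fun x => g x * p x + t * (v x * p x)
      - (Cr + C * R ^ K) * t ^ 2 / 2 * p x := i1.sub (hp.integrable.const_mul _)
    calc _ = ∫ x, g x * p x + t * (v x * p x) - (Cr + C * R ^ K) * t ^ 2 / 2 * p x := by
          rw [integral_sub i1 (hp.integrable.const_mul _), integral_add ig (iv.const_mul t),
            integral_const_mul, integral_const_mul, hp.integral_eq_one, mul_one]
      _ ≤ _ := by
          refine integral_mono_ae i2 (hH.integrable_apply_mul hp hq ht.1 bg) ?_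
          filter_upwards [hexp g v (Cr + C * R ^ K) hgs hgc hvs hvc
            (dissipationMinorant_le hD hLb hr hR) (hCr R hR1) t ht] with x hx
          have := mul_le_mul_of_nonneg_right hx (hp.pos x).le
          linarith
  have := hP.isProbabilityMeasure hp hq hH ht.1
  have s2 := le_toReal_klDiv (hP.klDiv_ne_top hp hq hH ht.1) bg.1 hG'
  rw [integral_densityMeasure hq] at s2
  -- Truncation errors at time zero, for `∫ g dp` and `∫ e^g dq`.
  have s3 : (∫ x, logRatio p q x * p x) - A * M₁ / R ^ (2 * (K + 1)) ≤ ∫ x, g x * p x := by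
    have h1 := htail₁ R A (fun x => logRatio p q x - g x) hR0 hA (fun x => ?_) (fun x hx => ?_)
    · simp only [sub_mul] at h1
      rw [integral_sub il ig] at h1
      linarith [(abs_le.1 h1).2]
    · have h2 : logRatio p q x - g x = (1 - cutoff R x) * logRatio p q x := by rw [hg]; ring
      rw [h2, abs_mul, abs_of_nonneg (sub_nonneg.2 (cutoff_le_one R x))]
      exact (mul_le_of_le_one_left (abs_nonneg _) (by linarith [cutoff_nonneg R x])).trans
        (hl.bound x)
    · rw [hg]; simp only; rw [cutoff_eq_one hR0 hx.le, one_mul, sub_self]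
  have s4 : ∫ x, Real.exp (g x) * q x ≤ 1 + 1 * M₂ / R ^ (2 * (K + 1)) := by
    set F : Eucl d → ℝ := fun x => if ‖x‖ < R then 0 else 1 with hF
    have hFm : Measurable F := Measurable.ite
      (measurableSet_lt continuous_norm.measurable measurable_const) measurable_const
      measurable_const
    have hFb : ∀ x, |F x| ≤ 1 * (1 + ‖x‖) ^ 0 := fun x => by
      by_cases hx : ‖x‖ < R <;> simp [hF, hx]
    have h1 := htail₂ R 1 F hR0 zero_le_one hFb (fun x hx => by simp [hF, hx])
    have iF : Integrable fun x => F x * q x := hq.integrable_mul hFm.aestronglyMeasurable hFb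
    have h2 : ∫ x, Real.exp (g x) * q x ≤ ∫ x, p x + F x * q x := by
      refine integral_mono (hq.integrable_mul_of_ae_bound hgs.exp.continuous.aestronglyMeasurable
        (Eventually.of_forall fun x => abs_exp_le (hG' x))) (hp.integrable.add iF) fun x => ?_
      simp only [hF]
      split_ifs with hx
      · simp only [hg]
        rw [cutoff_eq_one hR0 hx.le, one_mul, exp_logRatio hp hq]
        simp
      · rw [← exp_logRatio hp hq x, ← add_mul]
        refine mul_le_mul_of_nonneg_right ?_ (hq.pos x).le
        simp only [hg]
        have c0 := cutoff_nonneg R x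
        have c1 := cutoff_le_one R x
        rcases le_total 0 (logRatio p q x) with h | h
        · have := Real.exp_le_exp.2 (mul_le_of_le_one_left h c1)
          linarith
        · have := Real.exp_le_one_iff.2 (mul_nonpos_of_nonneg_of_nonpos c0 h)
          linarith [Real.exp_pos (logRatio p q x)]
    rw [integral_add hp.integrable iF, hp.integral_eq_one] at h2
    linarith [(abs_le.1 h1).2]
  -- The minorant integrates to the dissipation, up to `O(1 / r)`.
  have s5 : -fisherInfo p q - 2 * D * W * M₀ / r ≤ ∫ x, v x * p x := by
    rw [← integral_langevinOp_logRatio hp hq]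
    set F : Eucl d → ℝ := fun x =>
      (1 - cutoff r x) * (langevinOp q (logRatio p q) x + D * smoothWeight m x) with hF
    have hFb : ∀ x, |F x| ≤ 2 * D * W * (1 + ‖x‖) ^ w := fun x => by
      have h0 := smoothWeight_nonneg m x
      rw [hF]; simp only
      rw [abs_mul, abs_of_nonneg (sub_nonneg.2 (cutoff_le_one r x))]
      refine (mul_le_of_le_one_left (abs_nonneg _) (by linarith [cutoff_nonneg r x])).trans ?_
      refine (abs_add_le _ _).trans ?_
      rw [abs_of_nonneg (mul_nonneg hD h0)]
      have h1 := hLl x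
      have h2 := mul_le_mul_of_nonneg_left ((le_abs_self _).trans (hW.bound x)) hD
      linarith
    have hFc : Continuous F := (continuous_const.sub (contDiff_cutoff r).continuous).mul
      ((hq.smooth_log.langevinOp (contDiff_logRatio hp hq)).continuous.add
        (continuous_const.mul (contDiff_smoothWeight m).continuous))
    have iF : Integrable fun x => F x * p x := hp.integrable_mul hFc.aestronglyMeasurable hFb
    have h1 := htail₀ r (2 * D * W) F hr0 (by positivity) hFb (fun x hx => by
      rw [hF]; simp only; rw [cutoff_eq_one hr0 hx.le, sub_self, zero_mul])
    rw [pow_one] at h1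
    have h2 : ∫ x, langevinOp q (logRatio p q) x * p x - F x * p x ≤ ∫ x, v x * p x := by
      refine integral_mono (iL.sub iF) iv fun x => ?_
      simp only [← sub_mul]
      refine mul_le_mul_of_nonneg_right ?_ (hp.pos x).le
      have h0 := mul_nonneg hD (smoothWeight_nonneg m x)
      have h3 := mul_le_mul_of_nonneg_right (cutoff_le_one (2 * R) x) h0
      simp only [hF, hv, dissipationMinorant]
      linarith
    rw [integral_sub iL iF] at h2
    linarith [(abs_le.1 h1).2]
  have s6 := mul_le_mul_of_nonneg_left s5 ht.1
  rw [add_div]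
  linarith

/-- Lower half of the entropy dissipation identity. -/
lemma IsLangevinEvolution.eventually_le_toReal_klDiv (hp : IsRapidDensity p)
    (hq : IsRapidDensity q) (hH : IsLangevinSemigroup q H) (hP : IsLangevinEvolution p q H P)
    {ε : ℝ} (hε : 0 < ε) :
    ∀ᶠ t in 𝓝[>] 0, (∫ x, logRatio p q x * p x) + t * (-fisherInfo p q - ε) ≤
      (InformationTheory.klDiv (P t) (densityMeasure q)).toReal := by
  obtain ⟨δ, hδ, B₀, C, A, K, hB₀, hC, h⟩ := hP.exists_le_toReal_klDiv hp hq hH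
  obtain ⟨r, hr1, hr⟩ : ∃ r : ℝ, 1 ≤ r ∧ B₀ / r ≤ ε / 2 := by
    refine ⟨max 1 (B₀ / (ε / 2)), le_max_left _ _, ?_⟩
    rw [div_le_iff₀ (lt_of_lt_of_le one_pos (le_max_left _ _)), ← div_le_iff₀' (half_pos hε)]
    exact le_max_right _ _
  obtain ⟨Cr, hCr⟩ := h r hr1
  -- For `R = t ^ (-1 / (K + 1))`, both `R ^ K * t ^ 2 = t / R` and `R ^ (-2 (K + 1)) = t ^ 2` are
  -- `o(t)`.
  have hR : Tendsto (fun t : ℝ => t⁻¹ ^ (((K + 1 : ℕ) : ℝ)⁻¹)) (𝓝[>] 0) atTop :=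
    (tendsto_rpow_atTop (by positivity)).comp tendsto_inv_nhdsGT_zero
  have h0 : Tendsto (fun t : ℝ => t) (𝓝[>] 0) (𝓝 0) := nhdsWithin_le_nhds
  have hsmall : Tendsto (fun t : ℝ => t * Cr / 2 + C / 2 * (t⁻¹ ^ (((K + 1 : ℕ) : ℝ)⁻¹))⁻¹ + A * t)
      (𝓝[>] 0) (𝓝 0) := by
    have h1 := hR.inv_tendsto_atTop.const_mul (C / 2)
    have := (((h0.mul_const Cr).div_const 2).add h1).add (h0.const_mul A)
    simpa using this
  filter_upwards [hR.eventually_ge_atTop (2 * r), hsmall.eventually_le_const (half_pos hε),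
    Ioc_mem_nhdsGT hδ] with t h1 h2 h3
  have ht := h3.1
  set R := t⁻¹ ^ (((K + 1 : ℕ) : ℝ)⁻¹) with hRdef
  have hR0 : 0 < R := by positivity
  have hRK : R ^ (K + 1) = t⁻¹ := by
    rw [hRdef, Real.rpow_inv_natCast_pow (by positivity) (by omega)]
  have e1 : R ^ K * t = R⁻¹ := by
    refine eq_inv_of_mul_eq_one_left ?_
    rw [mul_right_comm, ← pow_succ, hRK, inv_mul_cancel₀ ht.ne']
  have e2 : A / R ^ (2 * (K + 1)) = A * t ^ 2 := by
    rw [pow_mul', hRK, inv_pow, div_inv_eq_mul]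
  have h4 := hCr R h1 t ⟨ht.le, h3.2⟩
  rw [e2] at h4
  refine le_trans ?_ h4
  have h5 := mul_le_mul_of_nonneg_left h2 ht.le
  have h6 := mul_le_mul_of_nonneg_left hr ht.le
  have e3 : (Cr + C * R ^ K) * t ^ 2 / 2 = t * (t * Cr / 2 + C / 2 * R⁻¹) := by
    rw [← e1]; ring
  rw [e3]
  linarith

/-- Entropy dissipation at time zero: `d/dt KL(p_t, q) = - ∫ ‖∇ log (p / q)‖² dp`. -/
lemma IsLangevinEvolution.hasDerivWithinAt_klDiv (hp : IsRapidDensity p)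
    (hq : IsRapidDensity q) (hH : IsLangevinSemigroup q H) (hP : IsLangevinEvolution p q H P) :
    HasDerivWithinAt (fun t => (InformationTheory.klDiv (P t) (densityMeasure q)).toReal)
      (-fisherInfo p q) (Set.Ici 0) 0 := by
  have h0 : (InformationTheory.klDiv (P 0) (densityMeasure q)).toReal
      = ∫ x, logRatio p q x * p x := by
    have h1 := isProbabilityMeasure_densityMeasure hp
    have h2 := isProbabilityMeasure_densityMeasure hq
    rw [hP.zero_eq hp hq hH]
    rw [densityMeasure] at h1 h2
    exact (klDiv_withDensity hp.continuous.measurable hq.continuous.measurable hp.pos hq.pos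
      (hp.integrable_log_sub_mul hq)).2
  refine hasDerivWithinAt_of_bounds (fun ε hε => ?_) (fun ε hε => ?_) <;> rw [h0]
  · exact hP.eventually_toReal_klDiv_le hp hq hH hε
  · exact hP.eventually_le_toReal_klDiv hp hq hH hε

end LangevinDerivative

/-! ### The heat semigroup -/

section Gaussian

open ProbabilityTheory

variable {d : ℕ}

/-- The standard Gaussian measure on `ℝᵈ`. -/
noncomputable abbrev gaussian (d : ℕ) : Measure (Eucl d) := stdGaussian (Eucl d)

lemma charFun_gaussian_map_smul (c : ℝ) (x : Eucl d) :
    charFun ((gaussian d).map fun z => c • z) x = Complex.exp (-(c ^ 2 * ‖x‖ ^ 2) / 2) := by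
  have h : (‖c‖ * ‖x‖) ^ 2 = c ^ 2 * ‖x‖ ^ 2 := by rw [mul_pow, Real.norm_eq_abs, sq_abs]
  rw [charFun_map_smul, charFun_stdGaussian, norm_smul, ← Complex.ofReal_pow, h]
  push_cast
  rfl

lemma multivariateGaussian_eq_map {c t : ℝ} (ht : 0 ≤ t) (hc : c ^ 2 = 2 * t) :
    multivariateGaussian (0 : Eucl d) ((2 * t) • (1 : Matrix (Fin d) (Fin d) ℝ))
      = (gaussian d).map fun z => c • z := by
  have hS : ((2 * t) • (1 : Matrix (Fin d) (Fin d) ℝ)).PosSemidef :=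
    Matrix.PosSemidef.one.smul (by positivity)
  refine Measure.ext_of_charFun (funext fun x => ?_)
  rw [charFun_multivariateGaussian hS, charFun_gaussian_map_smul]
  have h1 : (x.ofLp ⬝ᵥ x.ofLp : ℝ) = ‖x‖ ^ 2 := by
    rw [EuclideanSpace.real_norm_sq_eq]
    simp [dotProduct, sq]
  have h2 : (x.ofLp ⬝ᵥ (((2 * t) • (1 : Matrix (Fin d) (Fin d) ℝ)).mulVec x.ofLp) : ℝ)
      = c ^ 2 * ‖x‖ ^ 2 := by
    rw [Matrix.smul_mulVec, Matrix.one_mulVec, dotProduct_smul, h1, hc, smul_eq_mul]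
  rw [h2]
  simp [neg_div]

lemma gaussian_map_conv_map (a b : ℝ) :
    ((gaussian d).map fun z => a • z).conv ((gaussian d).map fun z => b • z)
      = (gaussian d).map fun z => √(a ^ 2 + b ^ 2) • z := by
  have : IsProbabilityMeasure ((gaussian d).map fun z => a • z) :=
    Measure.isProbabilityMeasure_map (by fun_prop)
  have : IsProbabilityMeasure ((gaussian d).map fun z => b • z) :=
    Measure.isProbabilityMeasure_map (by fun_prop)
  have : IsProbabilityMeasure ((gaussian d).map fun z => √(a ^ 2 + b ^ 2) • z) :=
    Measure.isProbabilityMeasure_map (by fun_prop)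
  refine Measure.ext_of_charFun (funext fun x => ?_)
  have h : ((√(a ^ 2 + b ^ 2) : ℝ) : ℂ) ^ 2 = (a : ℂ) ^ 2 + (b : ℂ) ^ 2 := by
    norm_cast
    exact Real.sq_sqrt (by positivity)
  rw [charFun_conv, charFun_gaussian_map_smul, charFun_gaussian_map_smul,
    charFun_gaussian_map_smul, ← Complex.exp_add, h]
  ring_nf

lemma integrable_pow_mul_exp_gaussian (k : ℕ) (b c : ℝ) (hb : 0 ≤ b) :
    Integrable (fun z : Eucl d => (1 + b * ‖z‖) ^ k * Real.exp (c * ‖z‖)) (gaussian d) := by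
  obtain ⟨C, hC, hint⟩ := IsGaussian.exists_integrable_exp_sq (gaussian d)
  refine (hint.const_mul (Real.exp ((k * b + c) ^ 2 / (4 * C)))).mono' (by fun_prop)
    (Eventually.of_forall fun z => ?_)
  have h0 : 0 ≤ 1 + b * ‖z‖ := by positivity
  rw [Real.norm_of_nonneg (by positivity), ← Real.exp_add]
  have h1 : (1 + b * ‖z‖) ^ k ≤ Real.exp (k * (b * ‖z‖)) := by
    rw [Real.exp_nat_mul]
    exact pow_le_pow_left₀ h0 (by linarith [Real.add_one_le_exp (b * ‖z‖)]) k
  calc _ ≤ Real.exp (k * (b * ‖z‖)) * Real.exp (c * ‖z‖) :=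
        mul_le_mul_of_nonneg_right h1 (Real.exp_pos _).le
    _ = Real.exp ((k * b + c) * ‖z‖) := by rw [← Real.exp_add]; ring_nf
    _ ≤ _ := by
        refine Real.exp_le_exp.2 ?_
        have h2 : (k * b + c) ^ 2 / (4 * C) + C * ‖z‖ ^ 2 - (k * b + c) * ‖z‖
            = ((k * b + c) - 2 * C * ‖z‖) ^ 2 / (4 * C) := by field_simp; ring
        have h3 : 0 ≤ ((k * b + c) - 2 * C * ‖z‖) ^ 2 / (4 * C) := by positivity
        linarith

lemma integrable_pow_gaussian (k : ℕ) (b : ℝ) (hb : 0 ≤ b) :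
    Integrable (fun z : Eucl d => (1 + b * ‖z‖) ^ k) (gaussian d) := by
  simpa using integrable_pow_mul_exp_gaussian (d := d) k b 0 hb

lemma abs_coord_le (z : Eucl d) (i : Fin d) : |z i| ≤ ‖z‖ := by
  simpa using PiLp.norm_apply_le z i

lemma integrable_coord_gaussian (i : Fin d) : Integrable (fun z : Eucl d => z i) (gaussian d) := by
  refine (integrable_pow_gaussian (d := d) 1 1 zero_le_one).mono' (by fun_prop)
    (Eventually.of_forall fun z => ?_)
  rw [Real.norm_eq_abs, pow_one, one_mul]
  linarith [abs_coord_le z i]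

lemma integral_coord_gaussian (i : Fin d) : ∫ z : Eucl d, z i ∂gaussian d = 0 := by
  have h := integral_strongDual_stdGaussian (E := Eucl d) (EuclideanSpace.proj i)
  simpa using h

lemma integrable_coord_mul_coord_gaussian (i j : Fin d) :
    Integrable (fun z : Eucl d => z i * z j) (gaussian d) := by
  refine (integrable_pow_gaussian (d := d) 2 1 zero_le_one).mono' (by fun_prop)
    (Eventually.of_forall fun z => ?_)
  rw [Real.norm_eq_abs, abs_mul, one_mul]
  have h1 := abs_coord_le z i
  have h2 := abs_coord_le z j
  nlinarith [abs_nonneg (z i), abs_nonneg (z j), norm_nonneg z]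

lemma integral_coord_mul_coord_gaussian (i j : Fin d) :
    ∫ z : Eucl d, z i * z j ∂gaussian d = if i = j then 1 else 0 := by
  have h := covariance_eval_multivariateGaussian (μ := (0 : Eucl d))
    (S := (1 : Matrix (Fin d) (Fin d) ℝ)) Matrix.PosSemidef.one i j
  rw [multivariateGaussian_zero_one, covariance] at h
  simpa [integral_coord_gaussian, Matrix.one_apply] using h

/-- The heat semigroup `e^{tΔ}`, `t ≥ 0`, as averaging over `N(0, 2t)`: the standard Gaussian
measure is rescaled by `√(2t)`. -/
noncomputable def heat (t : ℝ) (u : Eucl d → ℝ) (x : Eucl d) : ℝ :=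
  ∫ z, u (x + √(2 * t) • z) ∂gaussian d

lemma heat_zero (u : Eucl d → ℝ) : heat 0 u = u := by
  ext x; simp [heat]

variable {u : Eucl d → ℝ} {C : ℝ}

lemma heat_integrable (hu : Continuous u) (hC : ∀ x, |u x| ≤ C) (s : ℝ) (x : Eucl d) :
    Integrable (fun z => u (x + s • z)) (gaussian d) :=
  Integrable.of_bound (by fun_prop) C (Eventually.of_forall fun z => hC _)

lemma abs_heat_le (hC : ∀ x, |u x| ≤ C) (t : ℝ) (x : Eucl d) : |heat t u x| ≤ C := by
  have := norm_integral_le_of_norm_le_const (μ := gaussian d) (f := fun z => u (x + √(2 * t) • z))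
    (Eventually.of_forall fun z => hC _)
  simpa [heat] using this

lemma continuous_heat (hu : Continuous u) (hC : ∀ x, |u x| ≤ C) (t : ℝ) :
    Continuous (heat t u) := by
  refine continuous_of_dominated (bound := fun _ => C) (fun x => by fun_prop)
    (fun x => Eventually.of_forall fun z => hC _) (integrable_const _)
    (Eventually.of_forall fun z => by fun_prop)

lemma continuous_heat_time (hu : Continuous u) (hC : ∀ x, |u x| ≤ C) (x : Eucl d) :
    Continuous fun t => heat t u x := by
  refine continuous_of_dominated (bound := fun _ => C) (fun x => by fun_prop)
    (fun x => Eventually.of_forall fun z => hC _) (integrable_const _)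
    (Eventually.of_forall fun z => by fun_prop)

lemma heat_add (hu : Continuous u) (hC : ∀ x, |u x| ≤ C) {s t : ℝ} (hs : 0 ≤ s) (ht : 0 ≤ t)
    (x : Eucl d) : heat (s + t) u x = ∫ z, heat t u (x + √(2 * s) • z) ∂gaussian d := by
  have hm := gaussian_map_conv_map (d := d) √(2 * s) √(2 * t)
  rw [Real.sq_sqrt (by positivity), Real.sq_sqrt (by positivity), ← mul_add] at hm
  have p1 : IsProbabilityMeasure ((gaussian d).map fun z => √(2 * s) • z) :=
    Measure.isProbabilityMeasure_map (by fun_prop)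
  have p2 : IsProbabilityMeasure ((gaussian d).map fun z => √(2 * t) • z) :=
    Measure.isProbabilityMeasure_map (by fun_prop)
  have h1 : heat (s + t) u x
      = ∫ w, u (x + w) ∂((gaussian d).map fun z => √(2 * (s + t)) • z) := by
    rw [integral_map (by fun_prop) (by fun_prop), heat]
  rw [h1, ← hm, integral_conv (Integrable.of_bound (by fun_prop) C
    (Eventually.of_forall fun z => hC _)), integral_map (by fun_prop)]
  · refine integral_congr_ae (Eventually.of_forall fun z => ?_)
    simp only
    rw [integral_map (by fun_prop) (by fun_prop), heat]
    simp only [add_assoc]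
  · refine (continuous_of_dominated (bound := fun _ => C) (fun x => by fun_prop)
      (fun x => Eventually.of_forall fun z => hC _) (integrable_const _)
      (Eventually.of_forall fun z => by fun_prop)).aestronglyMeasurable

/-- The law of `X + N(0, 2t)`, for `X` with density `ρ`, has density `heat t ρ`. The Gaussian is
written as the law of `-√(2t) Z`, so that the translation in `heat` appears with the right sign. -/
lemma addNoise_eq_withDensity {ρ : Eucl d → ℝ} (hρ : Continuous ρ) (h0 : ∀ x, 0 ≤ ρ x)
    (hC : ∀ x, |ρ x| ≤ C) [IsProbabilityMeasure (densityMeasure ρ)] {t : ℝ} (ht : 0 ≤ t) :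
    addNoise ρ t = (volume : Measure (Eucl d)).withDensity fun x => .ofReal (heat t ρ x) := by
  have hc : (-√(2 * t)) ^ 2 = 2 * t := by rw [neg_sq, Real.sq_sqrt (by positivity)]
  have hpm : IsProbabilityMeasure ((gaussian d).map fun z => (-√(2 * t)) • z) :=
    Measure.isProbabilityMeasure_map (by fun_prop)
  have hρm : Measurable fun x => ENNReal.ofReal (ρ x) := by fun_prop
  rw [addNoise, multivariateGaussian_eq_map ht hc]
  ext A hA
  rw [← lintegral_indicator_one hA, withDensity_apply _ hA, Measure.lintegral_conv
    (measurable_one.indicator hA), densityMeasure, lintegral_withDensity_eq_lintegral_mul _ hρm]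
  · have e1 : ∀ x, heat t ρ x = ∫ z, ρ (x + √(2 * t) • z) ∂gaussian d := fun x => rfl
    have e2 : ∀ x, ENNReal.ofReal (heat t ρ x)
        = ∫⁻ z, ENNReal.ofReal (ρ (x + √(2 * t) • z)) ∂gaussian d := fun x => by
      rw [e1, ofReal_integral_eq_lintegral_ofReal (heat_integrable hρ hC _ _)
        (Eventually.of_forall fun z => h0 _)]
    simp only [e2, Pi.mul_apply]
    have e3 : ∀ x, ∫⁻ y, A.indicator (1 : Eucl d → ENNReal) (x + y)
        ∂((gaussian d).map fun z => (-√(2 * t)) • z)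
        = ∫⁻ z, A.indicator (1 : Eucl d → ENNReal) (x + (-√(2 * t)) • z) ∂gaussian d := fun x => by
      exact lintegral_map (f := fun y => A.indicator (1 : Eucl d → ENNReal) (x + y))
        ((measurable_one.indicator hA).comp (measurable_const_add x)) (by fun_prop)
    simp only [e3]
    have hAm : Measurable fun p : Eucl d × Eucl d =>
        A.indicator (1 : Eucl d → ENNReal) (p.1 + (-√(2 * t)) • p.2) :=
      (measurable_one.indicator hA).comp (by fun_prop)
    calc ∫⁻ x, ENNReal.ofReal (ρ x) *
          ∫⁻ z, A.indicator (1 : Eucl d → ENNReal) (x + (-√(2 * t)) • z) ∂gaussian d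
        = ∫⁻ x, (∫⁻ z, ENNReal.ofReal (ρ x) *
          A.indicator (1 : Eucl d → ENNReal) (x + (-√(2 * t)) • z) ∂gaussian d) := by
          refine lintegral_congr fun x => ?_
          rw [lintegral_const_mul]
          exact hAm.comp measurable_prodMk_left
      _ = ∫⁻ z, (∫⁻ x, ENNReal.ofReal (ρ x) *
          A.indicator (1 : Eucl d → ENNReal) (x + (-√(2 * t)) • z)) ∂gaussian d := by
          refine lintegral_lintegral_swap ?_
          exact ((hρm.comp measurable_fst).mul hAm).aemeasurable
      _ = ∫⁻ z, (∫⁻ x, ENNReal.ofReal (ρ (x + √(2 * t) • z)) *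
          A.indicator (1 : Eucl d → ENNReal) x) ∂gaussian d := by
          refine lintegral_congr fun z => ?_
          rw [← lintegral_add_right_eq_self _ (√(2 * t) • z)]
          simp
      _ = ∫⁻ x, (∫⁻ z, ENNReal.ofReal (ρ (x + √(2 * t) • z)) *
          A.indicator (1 : Eucl d → ENNReal) x ∂gaussian d) := by
          refine lintegral_lintegral_swap ?_
          refine ((hρm.comp (by fun_prop)).mul
            ((measurable_one.indicator hA).comp measurable_snd)).aemeasurable
      _ = ∫⁻ x, A.indicator
          (fun x => ∫⁻ z, ENNReal.ofReal (ρ (x + √(2 * t) • z)) ∂gaussian d) x := by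
          refine lintegral_congr fun x => ?_
          by_cases hx : x ∈ A <;> simp [hx]
      _ = _ := lintegral_indicator hA _
  · exact (measurable_one.indicator hA).comp (by fun_prop) |>.lintegral_prod_right'
      (f := fun p : Eucl d × Eucl d => A.indicator (1 : Eucl d → ENNReal) (p.1 + p.2))

end Gaussian

/-! ### The heat equation -/

/-- Taylor's formula of order two with Lagrange remainder, by applying Rolle's theorem twice. -/
lemma exists_taylor_two {f f' f'' : ℝ → ℝ} (h1 : ∀ r, HasDerivAt f (f' r) r)
    (h2 : ∀ r, HasDerivAt f' (f'' r) r) {s : ℝ} (hs : 0 < s) :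
    ∃ r ∈ Set.Ioo 0 s, f s = f 0 + f' 0 * s + f'' r * s ^ 2 / 2 := by
  set K := (f s - f 0 - f' 0 * s) / s ^ 2 with hK
  have hg : ∀ r, HasDerivAt (fun r => f r - f 0 - f' 0 * r - K * r ^ 2)
      (f' r - f' 0 - K * (2 * r)) r := fun r => by
    have := (((h1 r).sub_const (f 0)).fun_sub ((hasDerivAt_id r).const_mul (f' 0))).fun_sub
      ((hasDerivAt_pow 2 r).const_mul K)
    simpa using this
  have hg' : ∀ r, HasDerivAt (fun r => f' r - f' 0 - K * (2 * r)) (f'' r - K * 2) r := fun r => by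
    have := ((h2 r).sub_const (f' 0)).fun_sub (((hasDerivAt_id r).const_mul 2).const_mul K)
    simpa using this
  obtain ⟨r1, hr1, e1⟩ := exists_hasDerivAt_eq_zero hs
    (fun r _ => (hg r).continuousAt.continuousWithinAt)
    (by rw [hK]; field_simp; ring) fun r _ => hg r
  obtain ⟨r, hr, e⟩ := exists_hasDerivAt_eq_zero hr1.1
    (fun r _ => (hg' r).continuousAt.continuousWithinAt) (by simp only [e1]; ring) fun r _ => hg' r
  refine ⟨r, ⟨hr.1, hr.2.trans hr1.2⟩, ?_⟩
  have e2 : f'' r = 2 * K := by linarith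
  rw [e2, hK]
  field_simp
  ring

section HeatEquation

variable {d : ℕ} {u : Eucl d → ℝ} {C : ℝ}

lemma fderiv_apply_eq_sum_pd (y z : Eucl d) : fderiv ℝ u y z = ∑ i, z i * pd i u y := by
  conv_lhs => rw [← (EuclideanSpace.basisFun (Fin d) ℝ).sum_repr z]
  simp [pd]

lemma hasDerivAt_line (hu : ContDiff ℝ (⊤ : ℕ∞) u) (x z : Eucl d) (r : ℝ) :
    HasDerivAt (fun r : ℝ => u (x + r • z)) (∑ i, z i * pd i u (x + r • z)) r := by
  rw [← fderiv_apply_eq_sum_pd]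
  have h : HasDerivAt (fun r : ℝ => x + r • z) z r := by
    simpa using ((hasDerivAt_id r).smul_const z).const_add x
  exact (smooth_differentiable hu (x + r • z)).hasFDerivAt.comp_hasDerivAt r h

/-- The second derivative of `u` at `y` in the direction `z`. -/
noncomputable def hess (u : Eucl d → ℝ) (y z : Eucl d) : ℝ :=
  ∑ i, z i * ∑ j, z j * pd j (pd i u) y

lemma exists_taylor_line (hu : ContDiff ℝ (⊤ : ℕ∞) u) (x z : Eucl d) {s : ℝ} (hs : 0 < s) :
    ∃ r ∈ Set.Ioo 0 s,
      u (x + s • z) = u x + (∑ i, z i * pd i u x) * s + hess u (x + r • z) z * s ^ 2 / 2 := by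
  obtain ⟨r, hr, e⟩ := exists_taylor_two (hasDerivAt_line hu x z)
    (f'' := fun r => hess u (x + r • z) z)
    (fun r => HasDerivAt.fun_sum fun i _ => (hasDerivAt_line (hu.pd i) x z r).const_mul (z i)) hs
  exact ⟨r, hr, by simpa using e⟩

lemma Growth2.abs_hess_le (hu : Growth2 C 0 u) (y z : Eucl d) :
    |hess u y z| ≤ d ^ 2 * C * (1 + ‖z‖) ^ 2 := by
  have hz : ∀ i, |z i| ≤ 1 + ‖z‖ := fun i => by linarith [abs_coord_le z i]
  have hC := hu.nonneg
  have h0 : 0 ≤ 1 + ‖z‖ := by positivity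
  have h1 : ∀ i, |z i * ∑ j, z j * pd j (pd i u) y| ≤ (1 + ‖z‖) * (d * ((1 + ‖z‖) * C)) :=
    fun i => by
    rw [abs_mul]
    refine mul_le_mul (hz i) ((Finset.abs_sum_le_sum_abs _ _).trans
      ((Finset.sum_le_card_nsmul _ _ ((1 + ‖z‖) * C) fun j _ => ?_).trans (by simp)))
      (abs_nonneg _) h0
    rw [abs_mul]
    exact mul_le_mul (hz j) (by simpa using hu.bound_pd_pd j i y) (abs_nonneg _) h0
  refine (Finset.abs_sum_le_sum_abs _ _).trans
    ((Finset.sum_le_card_nsmul _ _ _ fun i _ => h1 i).trans (le_of_eq ?_))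
  simp
  ring

lemma continuous_hess (hu : ContDiff ℝ (⊤ : ℕ∞) u) (z : Eucl d) :
    Continuous fun y => hess u y z :=
  continuous_finsetSum _ fun i _ => continuous_const.mul <| continuous_finsetSum _ fun j _ =>
    continuous_const.mul ((hu.pd i).pd j).continuous

lemma integral_hess_gaussian (y : Eucl d) :
    ∫ z, hess u y z ∂gaussian d = ∑ i, pd i (pd i u) y := by
  have h : ∀ z, hess u y z = ∑ i, ∑ j, (z i * z j) * pd j (pd i u) y := fun z => by
    simp only [hess, Finset.mul_sum, mul_assoc]
  simp only [h]
  have hi : ∀ i j, Integrable (fun z : Eucl d => (z i * z j) * pd j (pd i u) y) (gaussian d) :=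
    fun i j => (integrable_coord_mul_coord_gaussian i j).mul_const _
  rw [integral_finsetSum _ fun i _ => integrable_finsetSum _ fun j _ => hi i j]
  refine Finset.sum_congr rfl fun i _ => ?_
  rw [integral_finsetSum _ fun j _ => hi i j]
  simp only [integral_mul_const, integral_coord_mul_coord_gaussian]
  simp

/-- The first-order Taylor remainder `(u(x + √(2h) z) - u(x) - √(2h) ⟨∇u(x), z⟩) / h`. The linear
term has Gaussian mean zero, so the mean of the remainder is the difference quotient of `heat`. -/
noncomputable def taylorQuot (u : Eucl d → ℝ) (x : Eucl d) (h : ℝ) (z : Eucl d) : ℝ :=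
  (u (x + √(2 * h) • z) - u x - (∑ i, z i * pd i u x) * √(2 * h)) / h

lemma exists_taylorQuot_eq (hu : ContDiff ℝ (⊤ : ℕ∞) u) (x z : Eucl d) {h : ℝ} (hh : 0 < h) :
    ∃ r ∈ Set.Ioo 0 √(2 * h), taylorQuot u x h z = hess u (x + r • z) z := by
  have hs : 0 < √(2 * h) := Real.sqrt_pos.2 (by positivity)
  obtain ⟨r, hr, e⟩ := exists_taylor_line hu x z hs
  refine ⟨r, hr, ?_⟩
  rw [taylorQuot, e, Real.sq_sqrt (by positivity)]
  field_simp
  ring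

lemma tendsto_taylorQuot (hu : ContDiff ℝ (⊤ : ℕ∞) u) (x z : Eucl d) :
    Tendsto (fun h => taylorQuot u x h z) (𝓝[>] 0) (𝓝 (hess u x z)) := by
  have hex : ∀ h : ℝ, ∃ r, 0 < h → r ∈ Set.Ioo 0 √(2 * h) ∧
      taylorQuot u x h z = hess u (x + r • z) z := fun h => by
    by_cases hh : 0 < h
    · obtain ⟨r, hr⟩ := exists_taylorQuot_eq hu x z hh
      exact ⟨r, fun _ => hr⟩
    · exact ⟨0, fun h' => absurd h' hh⟩
  choose r hr using hex
  have hr0 : Tendsto r (𝓝[>] 0) (𝓝 0) := by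
    have hsq : Tendsto (fun h : ℝ => √(2 * h)) (𝓝[>] 0) (𝓝 0) := by
      have : Continuous fun h : ℝ => √(2 * h) := by fun_prop
      simpa using (this.tendsto 0).mono_left nhdsWithin_le_nhds
    refine tendsto_of_tendsto_of_tendsto_of_le_of_le' tendsto_const_nhds hsq ?_ ?_
    · filter_upwards [self_mem_nhdsWithin] with h hh using (hr h hh).1.1.le
    · filter_upwards [self_mem_nhdsWithin] with h hh using (hr h hh).1.2.le
  have hc : Continuous fun r : ℝ => hess u (x + r • z) z :=
    (continuous_hess hu z).comp (by fun_prop)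
  have := (hc.tendsto 0).comp hr0
  rw [zero_smul, add_zero] at this
  refine this.congr' ?_
  filter_upwards [self_mem_nhdsWithin] with h hh using ((hr h hh).2).symm

lemma Growth2.abs_le (hu : Growth2 C 0 u) (x : Eucl d) : |u x| ≤ C := by
  simpa using hu.bound x

lemma integral_taylorQuot (hu : Growth2 C 0 u) (x : Eucl d) (h : ℝ) :
    ∫ z, taylorQuot u x h z ∂gaussian d = (heat h u x - u x) / h := by
  have hi : ∀ i, Integrable (fun z : Eucl d => z i * pd i u x) (gaussian d) := fun i =>
    (integrable_coord_gaussian i).mul_const _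
  have h1 := heat_integrable hu.smooth.continuous hu.abs_le √(2 * h) x
  have h2 : Integrable (fun z : Eucl d => (∑ i, z i * pd i u x) * √(2 * h)) (gaussian d) :=
    (integrable_finsetSum _ fun i _ => hi i).mul_const _
  have h3 : Integrable (fun z => u (x + √(2 * h) • z) - u x) (gaussian d) :=
    h1.sub (integrable_const _)
  simp only [taylorQuot]
  rw [integral_div, integral_sub h3 h2, integral_sub h1 (integrable_const _), integral_mul_const,
    integral_finsetSum _ fun i _ => hi i]
  simp only [integral_mul_const, integral_coord_gaussian]
  simp [heat]

lemma continuous_taylorQuot (hu : ContDiff ℝ (⊤ : ℕ∞) u) (x : Eucl d) (h : ℝ) :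
    Continuous (taylorQuot u x h) := by
  have := hu.continuous
  unfold taylorQuot
  fun_prop

lemma Growth2.abs_taylorQuot_le (hu : Growth2 C 0 u) (x z : Eucl d) {h : ℝ} (hh : 0 < h) :
    |taylorQuot u x h z| ≤ d ^ 2 * C * (1 + ‖z‖) ^ 2 := by
  obtain ⟨r, -, e⟩ := exists_taylorQuot_eq hu.smooth x z hh
  rw [e]
  exact hu.abs_hess_le _ _

lemma integrable_taylor_bound (C : ℝ) :
    Integrable (fun z : Eucl d => d ^ 2 * C * (1 + ‖z‖) ^ 2) (gaussian d) := by
  simpa using (integrable_pow_gaussian (d := d) 2 1 zero_le_one).const_mul (d ^ 2 * C)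

lemma Growth2.abs_heat_sub_div_le (hu : Growth2 C 0 u) (x : Eucl d) {h : ℝ} (hh : 0 < h) :
    |(heat h u x - u x) / h| ≤ ∫ z : Eucl d, d ^ 2 * C * (1 + ‖z‖) ^ 2 ∂gaussian d := by
  rw [← integral_taylorQuot hu]
  exact norm_integral_le_of_norm_le (f := taylorQuot u x h) (integrable_taylor_bound C)
    (Eventually.of_forall fun z => hu.abs_taylorQuot_le x z hh)

lemma Growth2.tendsto_heat_sub_div (hu : Growth2 C 0 u) (x : Eucl d) :
    Tendsto (fun h => (heat h u x - u x) / h) (𝓝[>] 0) (𝓝 (∑ i, pd i (pd i u) x)) := by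
  rw [← integral_hess_gaussian]
  refine Tendsto.congr (fun h => integral_taylorQuot hu x h) ?_
  refine tendsto_integral_filter_of_dominated_convergence _
    (Eventually.of_forall fun h => (continuous_taylorQuot hu.smooth x h).aestronglyMeasurable)
    ?_ (integrable_taylor_bound C) (Eventually.of_forall fun z => tendsto_taylorQuot hu.smooth x z)
  filter_upwards [self_mem_nhdsWithin] with h hh
  exact Eventually.of_forall fun z => hu.abs_taylorQuot_le x z hh

/-- The heat equation `∂ₜ e^{tΔ} u = e^{tΔ} Δu`, up to and including the initial time. -/
lemma Growth2.hasDerivWithinAt_heat (hu : Growth2 C 0 u) {t : ℝ} (ht : 0 ≤ t) (x : Eucl d) :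
    HasDerivWithinAt (fun t => heat t u x) (heat t (fun y => ∑ i, pd i (pd i u) y) x)
      (Set.Ici t) t := by
  have hc := hu.smooth.continuous
  have hh : ∀ h, Continuous (heat h u) := continuous_heat hc hu.abs_le
  rw [← hasDerivWithinAt_Ioi_iff_Ici, hasDerivWithinAt_iff_tendsto_slope' (by simp)]
  have hshift : Tendsto (fun s => s - t) (𝓝[>] t) (𝓝[>] 0) := by
    refine tendsto_nhdsWithin_iff.2 ⟨?_, ?_⟩
    · have : Tendsto (fun s => s - t) (𝓝 t) (𝓝 (t - t)) := tendsto_id.sub_const t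
      rw [sub_self] at this
      exact this.mono_left nhdsWithin_le_nhds
    · filter_upwards [self_mem_nhdsWithin] with s (hs : t < s) using sub_pos.2 hs
  have key : Tendsto (fun h => ∫ z, (heat h u (x + √(2 * t) • z) - u (x + √(2 * t) • z)) / h
      ∂gaussian d) (𝓝[>] 0) (𝓝 (heat t (fun y => ∑ i, pd i (pd i u) y) x)) := by
    refine tendsto_integral_filter_of_dominated_convergence
      (fun _ => ∫ z : Eucl d, d ^ 2 * C * (1 + ‖z‖) ^ 2 ∂gaussian d)
      (Eventually.of_forall fun h => ?_) ?_ (integrable_const _)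
      (Eventually.of_forall fun z => hu.tendsto_heat_sub_div _)
    · have := hh h
      exact Continuous.aestronglyMeasurable (by fun_prop)
    · filter_upwards [self_mem_nhdsWithin] with h hpos
      exact Eventually.of_forall fun z => hu.abs_heat_sub_div_le _ hpos
  refine (key.comp hshift).congr' ?_
  filter_upwards [self_mem_nhdsWithin] with s (hs : t < s)
  have e : heat s u x = ∫ z, heat (s - t) u (x + √(2 * t) • z) ∂gaussian d := by
    rw [← heat_add hc hu.abs_le ht (sub_nonneg.2 hs.le), add_sub_cancel]
  rw [slope_def_field, e]
  simp only [Function.comp]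
  rw [integral_div, integral_sub (heat_integrable (hh _) (abs_heat_le hu.abs_le _) _ _)
    (heat_integrable hc hu.abs_le _ _)]
  rfl

end HeatEquation

/-! ### Bounds for the heat evolution of a rapidly decaying density -/

section HeatBounds

variable {d : ℕ} {ρ : Eucl d → ℝ}

lemma one_add_norm_add_le (x y : Eucl d) : 1 + ‖x + y‖ ≤ (1 + ‖x‖) * (1 + ‖y‖) := by
  nlinarith [norm_add_le x y, norm_nonneg x, norm_nonneg y]

lemma one_add_norm_le (x y : Eucl d) : 1 + ‖x‖ ≤ (1 + ‖x + y‖) * (1 + ‖y‖) := by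
  simpa using one_add_norm_add_le (x + y) (-y)

lemma one_add_norm_smul_le {s c : ℝ} (hs : 0 ≤ s) (hsc : s ≤ c) (z : Eucl d) :
    1 + ‖s • z‖ ≤ 1 + c * ‖z‖ := by
  rw [norm_smul, Real.norm_of_nonneg hs]
  gcongr

lemma sqrt_two_mul_le {t T : ℝ} (ht : t ∈ Set.Icc 0 T) : √(2 * t) ≤ √(2 * T) :=
  Real.sqrt_le_sqrt (by linarith [ht.2])

lemma poly_comp_le {F : Eucl d → ℝ} {C c s : ℝ} {k : ℕ} (hF : ∀ x, |F x| ≤ C * (1 + ‖x‖) ^ k)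
    (hs : 0 ≤ s) (hsc : s ≤ c) (x z : Eucl d) :
    |F (x + s • z)| ≤ C * (1 + ‖x‖) ^ k * (1 + c * ‖z‖) ^ k := by
  have hC : 0 ≤ C := by simpa using (abs_nonneg _).trans (hF 0)
  refine (hF _).trans ?_
  rw [mul_assoc, ← mul_pow]
  gcongr
  exact (one_add_norm_add_le _ _).trans (mul_le_mul_of_nonneg_left
    (one_add_norm_smul_le hs hsc z) (by positivity))

lemma abs_pow_mul_heat_le {u : Eucl d → ℝ} {C T t : ℝ} {N : ℕ}
    (hu : ∀ x, (1 + ‖x‖) ^ N * |u x| ≤ C) (ht : t ∈ Set.Icc 0 T) (x : Eucl d) :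
    (1 + ‖x‖) ^ N * |heat t u x| ≤ C * ∫ z : Eucl d, (1 + √(2 * T) * ‖z‖) ^ N ∂gaussian d := by
  have hC : 0 ≤ C := le_trans (by positivity) (hu 0)
  have h1 : 0 < (1 + ‖x‖) ^ N := by positivity
  rw [← abs_of_pos h1, ← abs_mul, heat, ← integral_const_mul, ← integral_const_mul]
  refine norm_integral_le_of_norm_le
    (f := fun z : Eucl d => (1 + ‖x‖) ^ N * u (x + √(2 * t) • z))
    ((integrable_pow_gaussian N _ (Real.sqrt_nonneg _)).const_mul C)
    (Eventually.of_forall fun z => ?_)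
  rw [Real.norm_eq_abs, abs_mul, abs_of_pos h1]
  have h2 := one_add_norm_smul_le (Real.sqrt_nonneg _) (sqrt_two_mul_le ht) z
  calc (1 + ‖x‖) ^ N * |u (x + √(2 * t) • z)|
      ≤ ((1 + ‖x + √(2 * t) • z‖) * (1 + √(2 * T) * ‖z‖)) ^ N * |u (x + √(2 * t) • z)| := by
        gcongr
        exact (one_add_norm_le x _).trans (mul_le_mul_of_nonneg_left h2 (by positivity))
    _ = ((1 + ‖x + √(2 * t) • z‖) ^ N * |u (x + √(2 * t) • z)|) * (1 + √(2 * T) * ‖z‖) ^ N := by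
        rw [mul_pow]; ring
    _ ≤ _ := by gcongr; exact hu _

namespace IsRapidDensity

lemma exists_pow_mul_abs_le (h : IsRapidDensity ρ) {G : Eucl d → ℝ} {C : ℝ} {m : ℕ}
    (hG : ∀ x, |G x| ≤ C * (1 + ‖x‖) ^ m) (N : ℕ) :
    ∃ C', ∀ x, (1 + ‖x‖) ^ N * |ρ x * G x| ≤ C' := by
  obtain ⟨B, -, hB⟩ := h.exists_bound (N + m)
  have hC : 0 ≤ C := by simpa using (abs_nonneg _).trans (hG 0)
  refine ⟨C * B, fun x => ?_⟩
  rw [abs_mul, abs_of_pos (h.pos x)]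
  have := (h.pos x).le
  calc (1 + ‖x‖) ^ N * (ρ x * |G x|) ≤ (1 + ‖x‖) ^ N * (ρ x * (C * (1 + ‖x‖) ^ m)) := by
        gcongr; exact hG x
    _ = C * ((1 + ‖x‖) ^ (N + m) * ρ x) := by rw [pow_add]; ring
    _ ≤ _ := by gcongr; exact hB x

/-- `Δρ = ρ (Δ log ρ + ‖∇ log ρ‖²)`. -/
lemma sum_pd_pd_eq (h : IsRapidDensity ρ) :
    (fun x => ∑ i, pd i (pd i ρ) x)
      = fun x => ρ x * langevinOp ρ (fun y => Real.log (ρ y)) x := by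
  ext x
  rw [langevinOp_eq_sum ρ h.smooth_log, Finset.mul_sum]
  refine Finset.sum_congr rfl fun i _ => ?_
  rw [funext (h.pd_eq i), pd_mul i h.smooth (h.smooth_log.pd i)]
  simp only [h.pd_eq i x]
  ring

lemma exists_growth2_self (h : IsRapidDensity ρ) : ∃ C, Growth2 C 0 ρ := by
  obtain ⟨A, k, ha⟩ := h.exists_growth2
  have hA := ha.nonneg
  obtain ⟨B, hB0, hB⟩ := h.exists_bound (k + k)
  have hw : ∀ x : Eucl d, 1 ≤ (1 + ‖x‖) ^ k := fun x =>
    one_le_pow₀ (by linarith [norm_nonneg x])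
  have key : ∀ (F : Eucl d → ℝ) (D : ℝ) (x : Eucl d), 0 ≤ D → |F x| ≤ D * (1 + ‖x‖) ^ (k + k) →
      |ρ x * F x| ≤ D * B := fun F D x hD hF => by
    have hρ := (h.pos x).le
    rw [abs_mul, abs_of_pos (h.pos x)]
    calc ρ x * |F x| ≤ ρ x * (D * (1 + ‖x‖) ^ (k + k)) := by gcongr
      _ = D * ((1 + ‖x‖) ^ (k + k) * ρ x) := by ring
      _ ≤ _ := by gcongr; exact hB x
  refine ⟨(1 + A + A * A) * B, h.smooth, fun x => ?_, fun i x => ?_, fun i j x => ?_⟩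
  · have h1 := key (fun _ => 1) 1 x zero_le_one (by
      rw [abs_one, one_mul, pow_add]
      exact one_le_mul_of_one_le_of_one_le (hw x) (hw x))
    rw [mul_one] at h1
    rw [pow_zero, mul_one]
    exact h1.trans (mul_le_mul_of_nonneg_right (by nlinarith) hB0)
  · rw [h.pd_eq, pow_zero, mul_one]
    refine (key _ A x hA ((ha.bound_pd i x).trans ?_)).trans
      (mul_le_mul_of_nonneg_right (by nlinarith) hB0)
    rw [pow_add, ← mul_assoc]
    exact le_mul_of_one_le_right (by positivity) (hw x)
  · have e : pd i (pd j ρ) x = ρ x * (pd i (pd j fun y => Real.log (ρ y)) x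
        + pd i (fun y => Real.log (ρ y)) x * pd j (fun y => Real.log (ρ y)) x) := by
      rw [funext (h.pd_eq j), pd_mul i h.smooth (h.smooth_log.pd j)]
      simp only [h.pd_eq i x]
      ring
    rw [e, pow_zero, mul_one]
    refine (key (fun x => pd i (pd j fun y => Real.log (ρ y)) x
        + pd i (fun y => Real.log (ρ y)) x * pd j (fun y => Real.log (ρ y)) x) (A + A * A) x
      (by positivity) ?_).trans (mul_le_mul_of_nonneg_right (by nlinarith) hB0)
    have h1 := ha.bound_pd_pd i j x
    have h2 := mul_le_mul (ha.bound_pd i x) (ha.bound_pd j x) (abs_nonneg _)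
      ((abs_nonneg _).trans (ha.bound_pd i x))
    rw [← abs_mul] at h2
    refine (abs_add_le _ _).trans ?_
    have h3 : A * (1 + ‖x‖) ^ k ≤ A * (1 + ‖x‖) ^ (k + k) := by
      rw [pow_add, ← mul_assoc]
      exact le_mul_of_one_le_right (by positivity) (hw x)
    have h4 : A * (1 + ‖x‖) ^ k * (A * (1 + ‖x‖) ^ k) = A * A * (1 + ‖x‖) ^ (k + k) := by ring
    linarith

lemma heat_pos (h : IsRapidDensity ρ) (t : ℝ) (x : Eucl d) : 0 < heat t ρ x := by
  obtain ⟨C, -, hC⟩ := h.exists_bound 0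
  have hint := heat_integrable h.continuous (C := C)
    (fun x => by rw [abs_of_pos (h.pos x)]; simpa using hC x) √(2 * t) x
  rw [heat, integral_pos_iff_support_of_nonneg (fun z => (h.pos _).le) hint]
  have : Function.support (fun z => ρ (x + √(2 * t) • z)) = Set.univ :=
    Set.eq_univ_of_forall fun z => (h.pos _).ne'
  rw [this]
  simp

/-- Jensen's inequality bounds `log (e^{tΔ} ρ)` from below by `e^{tΔ} log ρ`. -/
lemma exists_abs_log_heat_le (h : IsRapidDensity ρ) (T : ℝ) :
    ∃ C k, 0 ≤ C ∧ ∀ t ∈ Set.Icc 0 T, ∀ x, |Real.log (heat t ρ x)| ≤ C * (1 + ‖x‖) ^ k := by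
  obtain ⟨A, k, ha⟩ := h.exists_growth2
  obtain ⟨S, -, hS⟩ := h.exists_bound 0
  have hS' : ∀ x, ρ x ≤ S := fun x => by simpa using hS x
  have hS'' : ∀ x, |ρ x| ≤ S := fun x => by rw [abs_of_pos (h.pos x)]; exact hS' x
  have hA := ha.nonneg
  set M := ∫ z : Eucl d, (1 + √(2 * T) * ‖z‖) ^ k ∂gaussian d with hM
  have hM0 : 0 ≤ M := integral_nonneg fun z => by positivity
  refine ⟨A * M + |Real.log S|, k, by positivity, fun t ht x => ?_⟩
  have hpos := h.heat_pos t x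
  have hw : 1 ≤ (1 + ‖x‖) ^ k := one_le_pow₀ (by linarith [norm_nonneg x])
  have hint := heat_integrable h.continuous hS'' √(2 * t) x
  rw [abs_le]
  constructor
  · have hiw := (integrable_pow_gaussian (d := d) k √(2 * T) (Real.sqrt_nonneg _)).const_mul
      (A * (1 + ‖x‖) ^ k)
    have hb : ∀ z : Eucl d, |Real.log (ρ (x + √(2 * t) • z))|
        ≤ A * (1 + ‖x‖) ^ k * (1 + √(2 * T) * ‖z‖) ^ k := fun z =>
      poly_comp_le (F := fun y => Real.log (ρ y)) ha.bound (Real.sqrt_nonneg _)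
        (sqrt_two_mul_le ht) x z
    have hir : Integrable (fun z => ρ (x + √(2 * t) • z) / heat t ρ x
        + (Real.log (heat t ρ x) - 1)) (gaussian d) := (hint.div_const _).add (integrable_const _)
    have hmono := integral_mono (μ := gaussian d) hiw.neg hir fun z => by
      have h1 := (neg_le_of_abs_le (hb z))
      have h2 := Real.log_le_sub_one_of_pos (div_pos (h.pos (x + √(2 * t) • z)) hpos)
      rw [Real.log_div (h.pos _).ne' hpos.ne'] at h2
      simp only [Pi.neg_apply]
      linarith
    rw [integral_add (hint.div_const _) (integrable_const _), integral_div] at hmono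
    have e : (∫ z, ρ (x + √(2 * t) • z) ∂gaussian d) / heat t ρ x = 1 := div_self hpos.ne'
    rw [e] at hmono
    simp only [Pi.neg_apply, integral_neg, integral_const_mul, ← hM, integral_const,
      probReal_univ, smul_eq_mul, one_mul] at hmono
    have : 0 ≤ |Real.log S| * (1 + ‖x‖) ^ k := by positivity
    linarith
  · have hle : heat t ρ x ≤ S := (le_abs_self _).trans (abs_heat_le hS'' t x)
    calc Real.log (heat t ρ x) ≤ Real.log S := Real.log_le_log hpos hle
      _ ≤ |Real.log S| * (1 + ‖x‖) ^ k :=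
          (le_abs_self _).trans (le_mul_of_one_le_right (abs_nonneg _) hw)
      _ ≤ _ := by
          rw [add_mul]
          have : 0 ≤ A * M * (1 + ‖x‖) ^ k := by positivity
          linarith

/-- A polynomial weight costs only a polynomial factor relative to `e^{tΔ} ρ`. For `ρ G = Δρ` this
bounds `∂ₜ log (e^{tΔ} ρ)`. -/
lemma exists_abs_heat_mul_le (h : IsRapidDensity ρ) {G : Eucl d → ℝ} {C : ℝ} {m : ℕ}
    (hG : ∀ x, |G x| ≤ C * (1 + ‖x‖) ^ m) (T : ℝ) :
    ∃ C' k, 0 ≤ C' ∧ ∀ t ∈ Set.Icc 0 T, ∀ x,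
      |heat t (fun y => ρ y * G y) x| ≤ C' * (1 + ‖x‖) ^ k * heat t ρ x := by
  obtain ⟨L, k, hL0, hL⟩ := h.exists_abs_log_heat_le T
  obtain ⟨S, -, hS⟩ := h.exists_bound 0
  have hS' : ∀ x, ρ x ≤ S := fun x => by simpa using hS x
  have hS'' : ∀ x, |ρ x| ≤ S := fun x => by rw [abs_of_pos (h.pos x)]; exact hS' x
  have hSpos : 0 < S := (h.pos 0).trans_le (hS' 0)
  have hC : 0 ≤ C := by simpa using (abs_nonneg _).trans (hG 0)
  set c := √(2 * T) with hc
  have hc0 : 0 ≤ c := Real.sqrt_nonneg _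
  have hiK : Integrable (fun z : Eucl d => (1 + c * ‖z‖) ^ m * Real.exp (1 + c * ‖z‖))
      (gaussian d) := by
    refine ((integrable_pow_mul_exp_gaussian (d := d) m c c hc0).const_mul (Real.exp 1)).congr
      (Eventually.of_forall fun z => ?_)
    simp only [Real.exp_add]
    ring
  set K := ∫ z : Eucl d, (1 + c * ‖z‖) ^ m * Real.exp (1 + c * ‖z‖) ∂gaussian d with hK
  have hK0 : 0 ≤ K := integral_nonneg fun z => by positivity
  refine ⟨C * ((|Real.log S| + L) ^ m + K), m + k * m, by positivity, fun t ht x => ?_⟩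
  have hpos := h.heat_pos t x
  have hw : 1 ≤ 1 + ‖x‖ := by linarith [norm_nonneg x]
  have hint := heat_integrable h.continuous hS'' √(2 * t) x
  set b := heat t ρ x with hb
  -- Beyond the threshold `N` the weight is absorbed by `exp (w - N) ≥ 1`, and `N` is chosen with
  -- `S * exp (-N) ≤ b`.
  set N := |Real.log S| + |Real.log b| with hN
  have hN0 : 0 ≤ N := by positivity
  have hSN : S * Real.exp (-N) ≤ b := by
    rw [← Real.exp_log hSpos, ← Real.exp_add, ← Real.le_log_iff_exp_le hpos, hN]
    linarith [le_abs_self (Real.log S), neg_abs_le (Real.log b)]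
  have hNle : N ^ m ≤ (|Real.log S| + L) ^ m * (1 + ‖x‖) ^ (k * m) := by
    rw [pow_mul, ← mul_pow]
    refine pow_le_pow_left₀ hN0 ?_ m
    have h1 := hL t ht x
    have h2 : |Real.log S| ≤ |Real.log S| * (1 + ‖x‖) ^ k :=
      le_mul_of_one_le_right (abs_nonneg _) (one_le_pow₀ hw)
    rw [add_mul]
    exact add_le_add h2 h1
  have hpt : ∀ z : Eucl d, |ρ (x + √(2 * t) • z) * G (x + √(2 * t) • z)|
      ≤ C * (1 + ‖x‖) ^ m * (N ^ m * ρ (x + √(2 * t) • z)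
        + b * ((1 + c * ‖z‖) ^ m * Real.exp (1 + c * ‖z‖))) := fun z => by
    set y := x + √(2 * t) • z with hy
    have hρ := (h.pos y).le
    have h1 : |G y| ≤ C * (1 + ‖x‖) ^ m * (1 + c * ‖z‖) ^ m :=
      poly_comp_le hG (Real.sqrt_nonneg _) (sqrt_two_mul_le ht) x z
    set w := 1 + c * ‖z‖ with hwdef
    have hw0 : 0 ≤ w := by positivity
    have h2 : ρ y * w ^ m ≤ N ^ m * ρ y + b * (w ^ m * Real.exp w) := by
      rcases le_total w N with hwN | hwN
      · have h3 : w ^ m ≤ N ^ m := pow_le_pow_left₀ hw0 hwN m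
        have h4 : 0 ≤ b * (w ^ m * Real.exp w) := by positivity
        nlinarith
      · have h3 : ρ y * w ^ m ≤ S * Real.exp (-N) * (w ^ m * Real.exp w) := by
          have h4 : 1 ≤ Real.exp (-N) * Real.exp w := by
            rw [← Real.exp_add]
            exact Real.one_le_exp (by linarith)
          calc ρ y * w ^ m ≤ S * w ^ m := by gcongr; exact hS' y
            _ ≤ S * w ^ m * (Real.exp (-N) * Real.exp w) :=
                le_mul_of_one_le_right (by positivity) h4
            _ = _ := by ring
        have h5 : S * Real.exp (-N) * (w ^ m * Real.exp w) ≤ b * (w ^ m * Real.exp w) := by gcongr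
        have h6 : 0 ≤ N ^ m * ρ y := by positivity
        linarith
    rw [abs_mul, abs_of_pos (h.pos y)]
    calc ρ y * |G y| ≤ ρ y * (C * (1 + ‖x‖) ^ m * w ^ m) := by gcongr
      _ = C * (1 + ‖x‖) ^ m * (ρ y * w ^ m) := by ring
      _ ≤ _ := by gcongr
  have hsum : Integrable (fun z => N ^ m * ρ (x + √(2 * t) • z)
      + b * ((1 + c * ‖z‖) ^ m * Real.exp (1 + c * ‖z‖))) (gaussian d) :=
    (hint.const_mul (N ^ m)).add (hiK.const_mul b)
  have hbound := norm_integral_le_of_norm_le (μ := gaussian d)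
    (f := fun z => ρ (x + √(2 * t) • z) * G (x + √(2 * t) • z))
    (hsum.const_mul (C * (1 + ‖x‖) ^ m)) (Eventually.of_forall hpt)
  rw [integral_const_mul] at hbound
  rw [integral_add (hint.const_mul _) (hiK.const_mul b), integral_const_mul, integral_const_mul,
    ← hK] at hbound
  have e : ∫ z, ρ (x + √(2 * t) • z) ∂gaussian d = b := rfl
  rw [e] at hbound
  refine hbound.trans ?_
  have hk1 : K ≤ K * (1 + ‖x‖) ^ (k * m) := le_mul_of_one_le_right hK0 (one_le_pow₀ hw)
  calc C * (1 + ‖x‖) ^ m * (N ^ m * b + b * K) = C * (1 + ‖x‖) ^ m * ((N ^ m + K) * b) := by ring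
    _ ≤ C * (1 + ‖x‖) ^ m * (((|Real.log S| + L) ^ m * (1 + ‖x‖) ^ (k * m)
          + K * (1 + ‖x‖) ^ (k * m)) * b) := by gcongr
    _ = _ := by rw [pow_add]; ring

end IsRapidDensity

end HeatBounds

/-! ### Differentiation of the divergence along the heat flow -/

section HeatFlow

variable {d : ℕ} {p q : Eucl d → ℝ}

/-- The integrand of `KL(e^{tΔ} p, e^{tΔ} q)`. -/
noncomputable def heatIntegrand (p q : Eucl d → ℝ) (t : ℝ) (x : Eucl d) : ℝ :=
  (Real.log (heat t p x) - Real.log (heat t q x)) * heat t p x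

/-- The time derivative of `heatIntegrand p q`. -/
noncomputable def heatIntegrandDeriv (p q : Eucl d → ℝ) (t : ℝ) (x : Eucl d) : ℝ :=
  (Real.log (heat t p x) - Real.log (heat t q x)) * heat t (fun y => ∑ i, pd i (pd i p) y) x
    + heat t (fun y => ∑ i, pd i (pd i p) y) x
    - heat t (fun y => ∑ i, pd i (pd i q) y) x / heat t q x * heat t p x

lemma hasDerivWithinAt_heatIntegrand (hp : IsRapidDensity p) (hq : IsRapidDensity q) {t : ℝ}
    (ht : 0 ≤ t) (x : Eucl d) :
    HasDerivWithinAt (fun t => heatIntegrand p q t x) (heatIntegrandDeriv p q t x)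
      (Set.Ici t) t := by
  obtain ⟨A, hA⟩ := hp.exists_growth2_self
  obtain ⟨B, hB⟩ := hq.exists_growth2_self
  have ha := hA.hasDerivWithinAt_heat ht x
  have hb := hB.hasDerivWithinAt_heat ht x
  have hpa := (hp.heat_pos t x).ne'
  have hpb := (hq.heat_pos t x).ne'
  refine (((ha.log hpa).fun_sub (hb.log hpb)).fun_mul ha).congr_deriv ?_
  rw [heatIntegrandDeriv]
  field_simp
  ring

lemma continuous_heatIntegrand (hp : IsRapidDensity p) (hq : IsRapidDensity q) (t : ℝ) :
    Continuous (heatIntegrand p q t) := by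
  obtain ⟨A, hA⟩ := hp.exists_growth2_self
  obtain ⟨B, hB⟩ := hq.exists_growth2_self
  have ha := continuous_heat hp.continuous hA.abs_le t
  have hb := continuous_heat hq.continuous hB.abs_le t
  exact ((ha.log fun x => (hp.heat_pos t x).ne').sub
    (hb.log fun x => (hq.heat_pos t x).ne')).mul ha

lemma continuous_heatIntegrand_time (hp : IsRapidDensity p) (hq : IsRapidDensity q) (x : Eucl d) :
    Continuous fun t => heatIntegrand p q t x := by
  obtain ⟨A, hA⟩ := hp.exists_growth2_self
  obtain ⟨B, hB⟩ := hq.exists_growth2_self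
  have ha := continuous_heat_time hp.continuous hA.abs_le x
  have hb := continuous_heat_time hq.continuous hB.abs_le x
  exact ((ha.log fun t => (hp.heat_pos t x).ne').sub
    (hb.log fun t => (hq.heat_pos t x).ne')).mul ha

lemma pow_mul_abs_mul_le {N k : ℕ} {x : Eucl d} {f g L C : ℝ}
    (hg : |g| ≤ L * (1 + ‖x‖) ^ k) (hf : (1 + ‖x‖) ^ (N + k) * |f| ≤ C) :
    (1 + ‖x‖) ^ N * |g * f| ≤ L * C := by
  have h1 : 0 < (1 + ‖x‖) ^ k := by positivity
  have hL : 0 ≤ L := nonneg_of_mul_nonneg_left ((abs_nonneg _).trans hg) h1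
  rw [abs_mul]
  calc (1 + ‖x‖) ^ N * (|g| * |f|) ≤ (1 + ‖x‖) ^ N * (L * (1 + ‖x‖) ^ k * |f|) := by gcongr
    _ = L * ((1 + ‖x‖) ^ (N + k) * |f|) := by rw [pow_add]; ring
    _ ≤ _ := by gcongr

lemma exists_pow_mul_heat_le (hp : IsRapidDensity p) (T : ℝ) (N : ℕ) :
    ∃ C, ∀ t ∈ Set.Icc 0 T, ∀ x, (1 + ‖x‖) ^ N * |heat t p x| ≤ C := by
  obtain ⟨C, -, hC⟩ := hp.exists_bound N
  exact ⟨_, fun t ht x => abs_pow_mul_heat_le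
    (fun x => by rw [abs_of_pos (hp.pos x)]; exact hC x) ht x⟩

lemma exists_pow_mul_heat_laplacian_le (hp : IsRapidDensity p) (T : ℝ) (N : ℕ) :
    ∃ C, ∀ t ∈ Set.Icc 0 T, ∀ x,
      (1 + ‖x‖) ^ N * |heat t (fun y => ∑ i, pd i (pd i p) y) x| ≤ C := by
  obtain ⟨A, k, ha⟩ := hp.exists_growth2
  obtain ⟨C, hC⟩ := hp.exists_pow_mul_abs_le (ha.abs_langevinOp_le ha) N
  rw [hp.sum_pd_pd_eq]
  exact ⟨_, fun t ht x => abs_pow_mul_heat_le hC ht x⟩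

lemma exists_abs_log_heat_sub_le (hp : IsRapidDensity p) (hq : IsRapidDensity q) (T : ℝ) :
    ∃ C k, ∀ t ∈ Set.Icc 0 T, ∀ x : Eucl d,
      |Real.log (heat t p x) - Real.log (heat t q x)| ≤ C * (1 + ‖x‖) ^ k := by
  obtain ⟨A, k, hA, ha⟩ := hp.exists_abs_log_heat_le T
  obtain ⟨B, m, hB, hb⟩ := hq.exists_abs_log_heat_le T
  refine ⟨A + B, max k m, fun t ht x => (abs_sub _ _).trans ?_⟩
  rw [add_mul]
  exact add_le_add ((ha t ht x).trans (poly_mono le_rfl hA (le_max_left _ _) x))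
    ((hb t ht x).trans (poly_mono le_rfl hB (le_max_right _ _) x))

lemma exists_pow_mul_abs_heatIntegrand_le (hp : IsRapidDensity p) (hq : IsRapidDensity q) (T : ℝ)
    (N : ℕ) : ∃ C, ∀ t ∈ Set.Icc 0 T, ∀ x, (1 + ‖x‖) ^ N * |heatIntegrand p q t x| ≤ C := by
  obtain ⟨L, k, hL⟩ := exists_abs_log_heat_sub_le hp hq T
  obtain ⟨C, hC⟩ := exists_pow_mul_heat_le hp T (N + k)
  exact ⟨L * C, fun t ht x => pow_mul_abs_mul_le (hL t ht x) (hC t ht x)⟩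

lemma exists_pow_mul_abs_heatIntegrandDeriv_le (hp : IsRapidDensity p) (hq : IsRapidDensity q)
    (T : ℝ) (N : ℕ) :
    ∃ C, ∀ t ∈ Set.Icc 0 T, ∀ x, (1 + ‖x‖) ^ N * |heatIntegrandDeriv p q t x| ≤ C := by
  obtain ⟨L, k, hL⟩ := exists_abs_log_heat_sub_le hp hq T
  obtain ⟨C₁, hC₁⟩ := exists_pow_mul_heat_laplacian_le hp T (N + k)
  obtain ⟨C₂, hC₂⟩ := exists_pow_mul_heat_laplacian_le hp T N
  obtain ⟨B, m, hb⟩ := hq.exists_growth2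
  obtain ⟨D, l, -, hD⟩ := hq.exists_abs_heat_mul_le (hb.abs_langevinOp_le hb) T
  obtain ⟨C₃, hC₃⟩ := exists_pow_mul_heat_le hp T (N + l)
  refine ⟨L * C₁ + C₂ + D * C₃, fun t ht x => ?_⟩
  have h1 := pow_mul_abs_mul_le (hL t ht x) (hC₁ t ht x)
  have h2 := hC₂ t ht x
  have hdiv : |heat t (fun y => ∑ i, pd i (pd i q) y) x / heat t q x| ≤ D * (1 + ‖x‖) ^ l := by
    rw [abs_div, abs_of_pos (hq.heat_pos t x), div_le_iff₀ (hq.heat_pos t x), hq.sum_pd_pd_eq]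
    exact hD t ht x
  have h3 := pow_mul_abs_mul_le hdiv (hC₃ t ht x)
  rw [heatIntegrandDeriv]
  refine (mul_le_mul_of_nonneg_left ((abs_sub _ _).trans (add_le_add_left (abs_add_le _ _) _))
    (by positivity)).trans ?_
  rw [mul_add, mul_add]
  exact add_le_add (add_le_add h1 h2) h3

lemma integrable_inv_one_add_norm_pow (d : ℕ) :
    Integrable fun x : Eucl d => ((1 + ‖x‖) ^ (d + 1))⁻¹ := by
  have h : Integrable (fun x : Eucl d => (1 + ‖x‖) ^ (-((d + 1 : ℕ) : ℝ))) :=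
    integrable_one_add_norm (by simp)
  refine h.congr (Eventually.of_forall fun x => ?_)
  simp only
  rw [Real.rpow_neg (by positivity), Real.rpow_natCast]

lemma abs_le_of_pow_mul_abs_le {N : ℕ} {x : Eucl d} {f C : ℝ} (h : (1 + ‖x‖) ^ N * |f| ≤ C) :
    |f| ≤ C * ((1 + ‖x‖) ^ N)⁻¹ := by
  rw [← div_eq_mul_inv, le_div_iff₀ (by positivity), mul_comm]
  exact h

lemma integrable_heatIntegrand (hp : IsRapidDensity p) (hq : IsRapidDensity q) {t : ℝ}
    (ht : 0 ≤ t) : Integrable (heatIntegrand p q t) := by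
  obtain ⟨C, hC⟩ := exists_pow_mul_abs_heatIntegrand_le hp hq t (d + 1)
  exact ((integrable_inv_one_add_norm_pow d).const_mul C).mono'
    (continuous_heatIntegrand hp hq t).aestronglyMeasurable
    (Eventually.of_forall fun x => abs_le_of_pow_mul_abs_le (hC t ⟨ht, le_rfl⟩ x))

lemma IsRapidDensity.addNoise_eq (hp : IsRapidDensity p) {t : ℝ} (ht : 0 ≤ t) :
    addNoise p t = (volume : Measure (Eucl d)).withDensity fun x => .ofReal (heat t p x) := by
  obtain ⟨A, hA⟩ := hp.exists_growth2_self
  have := isProbabilityMeasure_densityMeasure hp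
  exact addNoise_eq_withDensity hp.continuous (fun x => (hp.pos x).le) hA.abs_le ht

lemma klDiv_addNoise (hp : IsRapidDensity p) (hq : IsRapidDensity q) {t : ℝ} (ht : 0 ≤ t) :
    InformationTheory.klDiv (addNoise p t) (addNoise q t) ≠ ⊤ ∧
      (InformationTheory.klDiv (addNoise p t) (addNoise q t)).toReal
        = ∫ x, heatIntegrand p q t x := by
  have prob : ∀ {ρ : Eucl d → ℝ}, IsRapidDensity ρ → IsProbabilityMeasure
      ((volume : Measure (Eucl d)).withDensity fun x => .ofReal (heat t ρ x)) := fun {ρ} hρ => by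
    rw [← hρ.addNoise_eq ht]
    have := isProbabilityMeasure_densityMeasure hρ
    unfold addNoise
    infer_instance
  have := prob hp
  have := prob hq
  have meas : ∀ {ρ : Eucl d → ℝ}, IsRapidDensity ρ → Measurable (heat t ρ) := fun {ρ} hρ => by
    obtain ⟨A, hA⟩ := hρ.exists_growth2_self
    exact (continuous_heat hρ.continuous hA.abs_le t).measurable
  rw [hp.addNoise_eq ht, hq.addNoise_eq ht]
  exact klDiv_withDensity (meas hp) (meas hq) (hp.heat_pos t) (hq.heat_pos t)
    (integrable_heatIntegrand hp hq ht)

lemma hasDerivWithinAt_integral_heatIntegrand (hp : IsRapidDensity p) (hq : IsRapidDensity q) :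
    HasDerivWithinAt (fun t => ∫ x, heatIntegrand p q t x) (∫ x, heatIntegrandDeriv p q 0 x)
      (Set.Ici 0) 0 := by
  obtain ⟨C, hC⟩ := exists_pow_mul_abs_heatIntegrandDeriv_le hp hq 1 (d + 1)
  have hbound : ∀ t ∈ Set.Icc (0 : ℝ) 1, ∀ x : Eucl d,
      |heatIntegrand p q t x - heatIntegrand p q 0 x| ≤ C * ((1 + ‖x‖) ^ (d + 1))⁻¹ * t := by
    intro t ht x
    have := norm_image_sub_le_of_norm_deriv_right_le_segment (a := (0 : ℝ)) (b := 1)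
      (f := fun t => heatIntegrand p q t x) (f' := fun t => heatIntegrandDeriv p q t x)
      (C := C * ((1 + ‖x‖) ^ (d + 1))⁻¹) (continuous_heatIntegrand_time hp hq x).continuousOn
      (fun s hs => hasDerivWithinAt_heatIntegrand hp hq hs.1 x)
      (fun s hs => abs_le_of_pow_mul_abs_le (hC s ⟨hs.1, hs.2.le⟩ x)) t ht
    simpa using this
  rw [← hasDerivWithinAt_Ioi_iff_Ici, hasDerivWithinAt_iff_tendsto_slope' (by simp)]
  have hev : ∀ᶠ t : ℝ in 𝓝[>] 0, t ∈ Set.Ioo (0 : ℝ) 1 := Ioo_mem_nhdsGT one_pos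
  have key : Tendsto (fun t => ∫ x, (heatIntegrand p q t x - heatIntegrand p q 0 x) / t)
      (𝓝[>] 0) (𝓝 (∫ x, heatIntegrandDeriv p q 0 x)) := by
    refine tendsto_integral_filter_of_dominated_convergence
      (fun x => C * ((1 + ‖x‖) ^ (d + 1))⁻¹) (Eventually.of_forall fun t => ?_) ?_
      ((integrable_inv_one_add_norm_pow d).const_mul C) (Eventually.of_forall fun x => ?_)
    · exact (((continuous_heatIntegrand hp hq t).sub
        (continuous_heatIntegrand hp hq 0)).div_const t).aestronglyMeasurable
    · filter_upwards [hev] with t ht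
      refine Eventually.of_forall fun x => ?_
      rw [Real.norm_eq_abs, abs_div, abs_of_pos ht.1, div_le_iff₀ ht.1]
      exact hbound t ⟨ht.1.le, ht.2.le⟩ x
    · have := hasDerivWithinAt_heatIntegrand hp hq le_rfl x
      rw [← hasDerivWithinAt_Ioi_iff_Ici, hasDerivWithinAt_iff_tendsto_slope' (by simp)] at this
      refine this.congr fun t => ?_
      rw [slope_def_field, sub_zero]
  refine key.congr' ?_
  filter_upwards [hev] with t ht
  rw [slope_def_field, sub_zero, integral_div, integral_sub
    (integrable_heatIntegrand hp hq ht.1.le) (integrable_heatIntegrand hp hq le_rfl)]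

/-- De Bruijn's identity for the relative entropy, at the initial time: every term is an integral
against `p` of the Langevin operator of `p`, to which Green's formula applies. -/
lemma integral_heatIntegrandDeriv_zero (hp : IsRapidDensity p) (hq : IsRapidDensity q) :
    ∫ x, heatIntegrandDeriv p q 0 x = -fisherInfo p q := by
  obtain ⟨A, n, ha⟩ := hp.exists_growth2
  obtain ⟨B, m, hb⟩ := hq.exists_growth2
  obtain ⟨L, l, hl⟩ := exists_growth2_logRatio hp hq
  have hone : Growth2 (d := d) 1 0 fun _ => 1 :=
    ⟨contDiff_const, by simp, by simp [pd_const], by simp [pd_const]⟩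
  set a : Eucl d → ℝ := fun y => Real.log (p y)
  set b : Eucl d → ℝ := fun y => Real.log (q y)
  have hpd : ∀ i x, pd i (logRatio p q) x = pd i a x - pd i b x := fun i x =>
    congrFun (pd_sub i hp.smooth_log hq.smooth_log) x
  have hsq : ∀ x, langevinOp q b x = langevinOp p b x - ∑ i, pd i (logRatio p q) x * pd i b x :=
    fun x => by
    rw [langevinOp_eq_sum q hb.smooth, langevinOp_eq_sum p hb.smooth, ← Finset.sum_sub_distrib]
    refine Finset.sum_congr rfl fun i _ => ?_
    rw [hpd]
    ring
  have hpoint : ∀ x, heatIntegrandDeriv p q 0 x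
      = logRatio p q x * langevinOp p a x * p x + 1 * langevinOp p a x * p x
        - 1 * langevinOp p b x * p x + (∑ i, pd i (logRatio p q) x * pd i b x) * p x := fun x => by
    have hqx := (hq.pos x).ne'
    rw [heatIntegrandDeriv, heat_zero, heat_zero, heat_zero, heat_zero, congrFun hp.sum_pd_pd_eq x,
      congrFun hq.sum_pd_pd_eq x, mul_div_cancel_left₀ _ hqx, hsq, logRatio]
    ring
  have hprod : ∀ {u v : Eucl d → ℝ} {C C' : ℝ} {k k' : ℕ}, Growth2 C k u → Growth2 C' k' v →
      Integrable (fun x => (∑ i, pd i u x * pd i v x) * p x) := fun {u v C C' k k'} hu hv => by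
    refine hp.integrable_mul (C := d * (C * C')) (k := k + k') (continuous_finsetSum _ fun i _ =>
      (hu.smooth.pd i).continuous.mul (hv.smooth.pd i).continuous).aestronglyMeasurable fun x => ?_
    refine (Finset.abs_sum_le_sum_abs _ _).trans ((Finset.sum_le_card_nsmul _ _
      (C * C' * (1 + ‖x‖) ^ (k + k')) fun i _ => ?_).trans (le_of_eq (by simp; ring)))
    rw [abs_mul]
    refine (mul_le_mul (hu.bound_pd i x) (hv.bound_pd i x) (abs_nonneg _)
      ((abs_nonneg _).trans (hu.bound_pd i x))).trans (le_of_eq (by ring))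
  have hop : ∀ {u v : Eucl d → ℝ} {C C' : ℝ} {k k' : ℕ}, Growth2 C k u → Growth2 C' k' v →
      Integrable (fun x => u x * langevinOp p v x * p x) := fun {u v C C' k k'} hu hv => by
    refine hp.integrable_mul (C := C * (d * (A * C' + C'))) (k := k + (n + k'))
      (hu.smooth.continuous.mul (ha.smooth.langevinOp hv.smooth).continuous).aestronglyMeasurable
      fun x => ?_
    rw [abs_mul]
    refine (mul_le_mul (hu.bound x) (ha.abs_langevinOp_le hv x) (abs_nonneg _)
      ((abs_nonneg _).trans (hu.bound x))).trans (le_of_eq (by ring))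
  have i12 : Integrable (fun x => logRatio p q x * langevinOp p a x * p x
      + 1 * langevinOp p a x * p x) := (hop hl ha).add (hop hone ha)
  have i123 : Integrable (fun x => logRatio p q x * langevinOp p a x * p x
      + 1 * langevinOp p a x * p x - 1 * langevinOp p b x * p x) := i12.sub (hop hone hb)
  simp only [hpoint]
  rw [integral_add i123 (hprod hl hb), integral_sub i12 (hop hone hb),
    integral_add (hop hl ha) (hop hone ha), hp.integral_mul_langevinOp hl ha,
    hp.integral_mul_langevinOp hone ha, hp.integral_mul_langevinOp hone hb]
  simp only [pd_const, zero_mul, Finset.sum_const_zero, integral_zero, neg_zero, add_zero,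
    sub_zero]
  rw [neg_add_eq_sub, ← neg_sub, ← integral_sub (hprod hl ha) (hprod hl hb), fisherInfo]
  refine congrArg _ (integral_congr_ae (Eventually.of_forall fun x => ?_))
  simp only
  rw [← sub_mul, ← Finset.sum_sub_distrib]
  refine congrArg (· * p x) (Finset.sum_congr rfl fun i _ => ?_)
  rw [← mul_sub, hpd, sq]

lemma hasDerivWithinAt_klDiv_addNoise (hp : IsRapidDensity p) (hq : IsRapidDensity q) :
    HasDerivWithinAt
      (fun t : ℝ => (InformationTheory.klDiv (addNoise p t) (addNoise q t)).toReal)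
      (-fisherInfo p q) (Set.Ici 0) 0 := by
  rw [← integral_heatIntegrandDeriv_zero hp hq]
  exact (hasDerivWithinAt_integral_heatIntegrand hp hq).congr
    (fun t ht => (klDiv_addNoise hp hq ht).2) (klDiv_addNoise hp hq le_rfl).2

end HeatFlow

theorem mainTheorem10 (d : ℕ) (p q : Eucl d → ℝ)
    (hp : IsRapidDensity p) (hq : IsRapidDensity q)
    (H : ℝ → Lp ℝ 2 (densityMeasure q) →L[ℝ] Lp ℝ 2 (densityMeasure q))
    (hH : IsLangevinSemigroup q H)
    (P : ℝ → Measure (Eucl d)) (hP : IsLangevinEvolution p q H P) :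
    (∀ t : ℝ, 0 ≤ t → InformationTheory.klDiv (P t) (densityMeasure q) ≠ ⊤) ∧
    (∀ t : ℝ, 0 ≤ t → InformationTheory.klDiv (addNoise p t) (addNoise q t) ≠ ⊤) ∧
    ∃ c : ℝ,
      HasDerivWithinAt
        (fun t : ℝ => (InformationTheory.klDiv (P t) (densityMeasure q)).toReal)
        c (Set.Ici 0) 0 ∧
      HasDerivWithinAt
        (fun t : ℝ => (InformationTheory.klDiv (addNoise p t) (addNoise q t)).toReal)
        c (Set.Ici 0) 0 :=
  ⟨fun _ ht => hP.klDiv_ne_top hp hq hH ht, fun _ ht => (klDiv_addNoise hp hq ht).1,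
    -fisherInfo p q, hP.hasDerivWithinAt_klDiv hp hq hH, hasDerivWithinAt_klDiv_addNoise hp hq⟩
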